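/- Let $M$ be a (connected) smooth Riemannian surface with Riemannian distance $d$, and let $U\subset M$ be a totally normal neighbourhood: $U$ is open and there is $\delta>0$ such that for every $p\in U$ the exponential map $\exp_p$ is a smooth diffeomorphism from the ball $B_\delta(0)\subset T_pM$ onto an open set containing $U$. Let $\gamma:\mathbb R\to U$ be a $C^2$ curve parametrized by arc length, and put $H(s,s')=d(\gamma(s),\gamma(s'))$. Let $s_0,s_1$ be parameters with $\gamma(s_0)\neq\gamma(s_1)$, write $\ell=H(s_0,s_1)$, let $\sigma:[0,\ell]\to M$ be the unit speed geodesic from $\gamma(s_0)$ to $\gamma(s_1)$, and let $J:[0,\ell]\to\mathbb R$ be the Jacobi field along it with $J(0)=0$, $J'(0)=1$, that is, the solution of $J''(t)+K(\sigma(t))J(t)=0$ with these initial values, where $K$ is the Gaussian curvature. Let $(b_0,b_1)$ be any orthonormal basis of $T_{\gamma(s_0)}M$ and let $\Phi(r,\theta)=\exp_{\gamma(s_0)}\bigl(r(\cos\theta\, b_0+\sin\theta\, b_1)\bigr)$ be the corresponding geodesic polar coordinates. Suppose that the geodesic curvature of $\gamma$ vanishes at $\gamma(s_1)$. Then $s\mapsto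 H(s_0,s)$ is of class $C^2$ near $s_1$; there is a function $\theta$, continuous at $s_1$, with $\gamma(s)=\Phi(H(s_0,s),\theta(s))$ for all $s$ near $s_1$; and every such $\theta$ is of class $C^2$ near $s_1$ and satisfies $$\partial_{22}H(s_0,s_1)=\theta'(s_1)^2\,J(\ell)\,J'(\ell).$$ Moreover, if $\sigma$ is not tangent to $\gamma$ at $\gamma(s_1)$, then $\partial_{22}H(s_0,s_1)$ has the same sign (positive, zero or negative) as $J(\ell)J'(\ell)$. In particular this is so if $\gamma$ is a strictly convex closed curve in $U$, that is, if $\gamma$ is periodic and simple and its image is the boundary of a compact set $D\subset U$ such that the open minimizing geodesic segment between any two distinct points of $D$ lies in the interior of $D$. -/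

import Mathlib

open Set Filter Topology Manifold Bundle
open scoped ContDiff

noncomputable section

namespace SurfaceBilliard

/-- The model space of a surface. -/
abbrev Plane : Type := EuclideanSpace ℝ (Fin 2)

/-! ### Coordinate formulas for a metric `(g_ij)` given on (an open part of) the plane -/

/-- The partial derivative `∂_i f` at `y`. -/
def pderiv (i : Fin 2) (f : Plane → ℝ) (y : Plane) : ℝ :=
  fderiv ℝ f y (EuclideanSpace.single i 1)

/-- `Γ^k_ij = ½ ∑_l g^{kl} (∂_i g_jl + ∂_j g_il - ∂_l g_ij)`. -/
def christoffel (g : Plane → Matrix (Fin 2) (Fin 2) ℝ) (k i j : Fin 2) (y : Plane) : ℝ :=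
  (1 / 2) * ∑ l, (g y)⁻¹ k l *
    (pderiv i (fun z => g z j l) y + pderiv j (fun z => g z i l) y - pderiv l (fun z => g z i j) y)

/-- The `l`-th component of `R(∂_i, ∂_j) ∂_k = ∇_i ∇_j ∂_k - ∇_j ∇_i ∂_k`. -/
def curvatureTensor (g : Plane → Matrix (Fin 2) (Fin 2) ℝ) (i j k l : Fin 2) (y : Plane) : ℝ :=
  pderiv i (christoffel g l j k) y - pderiv j (christoffel g l i k) y
    + ∑ m, (christoffel g m j k y * christoffel g l i m y
        - christoffel g m i k y * christoffel g l j m y)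

/-- `⟨R(∂_0, ∂_1) ∂_1, ∂_0⟩ / det g`. -/
def gaussCurvatureOfGram (g : Plane → Matrix (Fin 2) (Fin 2) ℝ) (y : Plane) : ℝ :=
  (∑ l, curvatureTensor g 0 1 1 l y * g y l 0) / (g y).det

/-! ### Riemannian surfaces -/

section Surface

variable {M : Type*} [MetricSpace M] [ChartedSpace Plane M]
  [RiemannianBundle (fun x : M => TangentSpace (𝓡 2) x)]

/-- The coordinate vector `∂_i` of the chart around `x`, at the point with coordinates `y`. -/
def coordVec (x : M) (y : Plane) (i : Fin 2) :
    TangentSpace (𝓡 2) ((extChartAt (𝓡 2) x).symm y) :=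
  mfderiv 𝓘(ℝ, Plane) (𝓡 2) (extChartAt (𝓡 2) x).symm y (EuclideanSpace.single i (1 : ℝ))

/-- The coefficients `g_ij = ⟨∂_i, ∂_j⟩` of the Riemannian metric in the chart around `x`. -/
def chartGram (x : M) (y : Plane) : Matrix (Fin 2) (Fin 2) ℝ :=
  Matrix.of fun i j => inner ℝ (coordVec x y i) (coordVec x y j)

/-- The Gaussian curvature at `x` (computed in the chart around `x`). -/
def gaussianCurvature (x : M) : ℝ :=
  gaussCurvatureOfGram (chartGram x) (extChartAt (𝓡 2) x x)

/-- The velocity `σ'(t)`. -/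
def velocity (σ : ℝ → M) (t : ℝ) : TangentSpace (𝓡 2) (σ t) :=
  mfderiv 𝓘(ℝ, ℝ) (𝓡 2) σ t (1 : ℝ)

/-- The velocity as a point of the tangent bundle. -/
def lift (σ : ℝ → M) (t : ℝ) : TangentBundle (𝓡 2) M := ⟨σ t, velocity σ t⟩

/-- The `k`-th component of the covariant acceleration `Dσ'/dt` in the chart around `x`:
`c_k'' + ∑_{i,j} Γ^k_ij c_i' c_j'`, where `c` is the curve `σ` read in the chart. -/
def covAccel (x : M) (σ : ℝ → M) (t : ℝ) (k : Fin 2) : ℝ :=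
  let c : Fin 2 → ℝ → ℝ := fun i τ => extChartAt (𝓡 2) x (σ τ) i
  deriv (deriv (c k)) t
    + ∑ i, ∑ j, christoffel (chartGram x) k i j (extChartAt (𝓡 2) x (σ t))
        * deriv (c i) t * deriv (c j) t

/-- `σ` is a geodesic on the time set `s`: it is of class `C²` around every time of `s` and satisfies
the geodesic equation there, in every chart of the surface. -/
def IsGeodesicOn (σ : ℝ → M) (s : Set ℝ) : Prop :=
  ∀ t ∈ s, ContMDiffAt 𝓘(ℝ, ℝ) (𝓡 2) 2 σ t ∧
    ∀ x : M, σ t ∈ (chartAt Plane x).source → ∀ k, covAccel x σ t k = 0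

/-- `σ : [0, ℓ] → M` is a unit speed geodesic from `p` to `q`. -/
structure IsUnitGeodesic (σ : ℝ → M) (ℓ : ℝ) (p q : M) : Prop where
  geodesic : IsGeodesicOn σ (Icc 0 ℓ)
  unit_speed : ∀ t ∈ Icc 0 ℓ, ‖velocity σ t‖ = 1
  source : σ 0 = p
  target : σ ℓ = q

/-- The absolute value `‖Dγ'/ds‖` of the geodesic curvature, at the parameter `s`, of a curve
parametrized by arc length. -/
def geodesicCurvature (γ : ℝ → M) (s : ℝ) : ℝ :=
  √(∑ i, ∑ j, chartGram (γ s) (extChartAt (𝓡 2) (γ s) (γ s)) i j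
      * covAccel (γ s) γ s i * covAccel (γ s) γ s j)

/-- There is a geodesic on `[0, 1]` which starts at `p` with velocity `v`. -/
def HasExp (p : M) (v : TangentSpace (𝓡 2) p) : Prop :=
  ∃ σ : ℝ → M, IsGeodesicOn σ (Icc 0 1) ∧ lift σ 0 = ⟨p, v⟩

open Classical in
/-- The exponential map `exp_p` (with the value `p` where it is undefined). -/
def expMap (p : M) (v : TangentSpace (𝓡 2) p) : M :=
  if h : HasExp p v then h.choose 1 else p

/-- `exp_p` is defined on the ball of radius `δ` of `T_pM` and is a smooth diffeomorphism from it
onto an open subset of `M`. -/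
def IsNormalRadius (p : M) (δ : ℝ) : Prop :=
  (∀ v ∈ Metric.ball (0 : TangentSpace (𝓡 2) p) δ, HasExp p v) ∧
  ∃ e : OpenPartialHomeomorph (TangentSpace (𝓡 2) p) M,
    e.source = Metric.ball 0 δ ∧ EqOn e (expMap p) e.source ∧
    ContMDiffOn 𝓘(ℝ, TangentSpace (𝓡 2) p) (𝓡 2) ∞ e e.source ∧
    ContMDiffOn (𝓡 2) 𝓘(ℝ, TangentSpace (𝓡 2) p) ∞ e.symm e.target

/-- `U` is a totally normal neighbourhood: it is a normal neighbourhood of each of its points, with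
a common radius. -/
def IsTotallyNormal (U : Set M) : Prop :=
  IsOpen U ∧ ∃ δ > 0, ∀ p ∈ U, IsNormalRadius p δ ∧ U ⊆ expMap p '' Metric.ball 0 δ

/-- Geodesic polar coordinates around `p`: `(r, θ) ↦ exp_p (r (cos θ b₀ + sin θ b₁))`. -/
def polar (p : M) (b : OrthonormalBasis (Fin 2) ℝ (TangentSpace (𝓡 2) p)) (r θ : ℝ) : M :=
  expMap p (r • (Real.cos θ • b 0 + Real.sin θ • b 1))

/-- The generating function `H(s, s')`: the geodesic distance from `γ s` to `γ s'`. -/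
def genFun (γ : ℝ → M) (s s' : ℝ) : ℝ := dist (γ s) (γ s')

/-- `θ` is a polar angle of `γ` around `γ s₀` near the parameter `s₁`, i.e.
`γ s = Φ(H(s₀, s), θ(s))` near `s₁`, with `θ` continuous at `s₁`. -/
def IsPolarAngle (γ : ℝ → M) (s₀ s₁ : ℝ)
    (b : OrthonormalBasis (Fin 2) ℝ (TangentSpace (𝓡 2) (γ s₀))) (θ : ℝ → ℝ) : Prop :=
  ContinuousAt θ s₁ ∧ ∀ᶠ s in 𝓝 s₁, γ s = polar (γ s₀) b (genFun γ s₀ s) (θ s)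

/-- `J : [0, ℓ] → ℝ`, with derivative `J'`, is the normal Jacobi field along the unit speed geodesic
`σ` with `J(0) = 0` and `J'(0) = 1`: it solves `J'' + K J = 0`, with `K` the Gaussian curvature
along `σ`. -/
structure IsJacobiField (σ : ℝ → M) (ℓ : ℝ) (J J' : ℝ → ℝ) : Prop where
  deriv_J : ∀ t ∈ Icc 0 ℓ, HasDerivWithinAt J (J' t) (Icc 0 ℓ) t
  jacobi : ∀ t ∈ Icc 0 ℓ, HasDerivWithinAt J' (-(gaussianCurvature (σ t) * J t)) (Icc 0 ℓ) t
  zero : J 0 = 0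
  one : J' 0 = 1

/-- The unit speed curves `σ` and `γ`, meeting at `σ t = γ s`, are tangent there. -/
def AreTangent (σ : ℝ → M) (t : ℝ) (γ : ℝ → M) (s : ℝ) : Prop :=
  lift σ t = ⟨γ s, velocity γ s⟩ ∨ lift σ t = ⟨γ s, -velocity γ s⟩

/-- `γ` is (the `L`-periodic parametrization of) a simple closed curve that bounds a compact strictly
convex region of `U`: the open minimizing geodesic segment between any two points of the region
lies in its interior. -/
structure IsConvexCurve (U : Set M) (γ : ℝ → M) (L : ℝ) : Prop where
  pos : 0 < L
  periodic : Function.Periodic γ L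
  simple : InjOn γ (Ico 0 L)
  convex : ∃ D : Set M, IsCompact D ∧ D ⊆ U ∧ frontier D = range γ ∧
    ∀ p ∈ D, ∀ q ∈ D, p ≠ q → ∀ σ : ℝ → M, IsUnitGeodesic σ (dist p q) p q →
      ∀ t ∈ Ioo 0 (dist p q), σ t ∈ interior D

end Surface

end SurfaceBilliard

end

/-! In the exponential chart at `p = γ s₀` the distance to `p` is the norm, so `H(s₀, s)` and
the polar angle are the polar coordinates `(r, θ)` of `γ s` in the tangent plane. By the Gauss
lemma the metric is `dr² + G² dθ²` in these coordinates, and `G` satisfies the Jacobi equation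
along the rays, so `G = J` on the chord. Where the covariant acceleration of `γ` vanishes, its
radial component gives `r'' = ½ ∂_r(G²) θ'² = J J' θ'²`. If `θ' = 0` there, then `γ'` is radial,
i.e. tangent to the chord; and a curve bounding a strictly convex region cannot be tangent to
its chords, since otherwise it would enter the cone swept out by the chords from `γ s₁` to the
neighbourhood of an interior point.
-/

noncomputable section

namespace SurfaceBilliard

/-! ### Riemannian metrics in coordinates -/

section Metric

/-- The bilinear form `⟨u, v⟩ = ∑ g_ij u_i v_j` at the point `y`. -/
def metricForm (g : Plane → Matrix (Fin 2) (Fin 2) ℝ) (y : Plane) : LinearMap.BilinForm ℝ Plane :=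
  Matrix.toBilin (PiLp.basisFun 2 ℝ (Fin 2)) (g y)

/-- The bilinear map `Γ(u, v)` with components `∑ Γ^k_ij u_i v_j` at the point `y`. -/
def christoffelForm (g : Plane → Matrix (Fin 2) (Fin 2) ℝ) (y : Plane) :
    Plane →ₗ[ℝ] Plane →ₗ[ℝ] Plane :=
  LinearMap.mk₂ ℝ (fun u v => WithLp.toLp 2 fun k => ∑ i, ∑ j, christoffel g k i j y * u i * v j)
    (fun u u' v => by ext; simp; ring)
    (fun a u v => by ext; simp; ring)
    (fun u v v' => by ext; simp; ring)
    (fun a u v => by ext; simp; ring)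

/-- The vector `R(t, u) w`, where `R(t, u) = (t ∧ u) R(∂₀, ∂₁)` by skew-symmetry in `t` and `u`. -/
def curvatureForm (g : Plane → Matrix (Fin 2) (Fin 2) ℝ) (y t u w : Plane) : Plane :=
  WithLp.toLp 2 fun l => (t 0 * u 1 - t 1 * u 0) * ∑ k, curvatureTensor g 0 1 k l y * w k

/-- `g` is a smooth pseudo-Riemannian metric on the open set `Ω`. -/
structure IsMetricOn (g : Plane → Matrix (Fin 2) (Fin 2) ℝ) (Ω : Set Plane) : Prop where
  isOpen : IsOpen Ω
  contDiffAt : ∀ y ∈ Ω, ∀ i j, ContDiffAt ℝ ∞ (fun z => g z i j) y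
  symm : ∀ y ∈ Ω, ∀ i j, g y i j = g y j i
  det_ne_zero : ∀ y ∈ Ω, (g y).det ≠ 0

variable {g : Plane → Matrix (Fin 2) (Fin 2) ℝ} {Ω : Set Plane}

lemma metricForm_apply (y u v : Plane) :
    metricForm g y u v = ∑ i, ∑ j, g y i j * u i * v j := by
  simp [metricForm, Matrix.toBilin_apply, mul_comm]

@[simp]
lemma christoffelForm_apply (y u v : Plane) (k : Fin 2) :
    christoffelForm g y u v k = ∑ i, ∑ j, christoffel g k i j y * u i * v j := rfl

@[simp]
lemma curvatureForm_apply (y t u w : Plane) (l : Fin 2) :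
    curvatureForm g y t u w l =
      (t 0 * u 1 - t 1 * u 0) * ∑ k, curvatureTensor g 0 1 k l y * w k := rfl

lemma IsMetricOn.det_eq (hg : IsMetricOn g Ω) {y : Plane} (hy : y ∈ Ω) :
    (g y).det = g y 0 0 * g y 1 1 - g y 0 1 ^ 2 := by
  rw [Matrix.det_fin_two, hg.symm y hy 1 0, sq]

lemma IsMetricOn.pderiv_symm (hg : IsMetricOn g Ω) {y : Plane} (hy : y ∈ Ω) (k i j : Fin 2) :
    pderiv k (fun z => g z i j) y = pderiv k (fun z => g z j i) y := by
  have hsymm : (fun z => g z i j) =ᶠ[𝓝 y] fun z => g z j i :=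
    eventually_of_mem (hg.isOpen.mem_nhds hy) fun z hz => hg.symm z hz i j
  rw [pderiv, pderiv, hsymm.fderiv_eq]

lemma christoffel_eq_adjugate (k i j : Fin 2) (y : Plane) :
    christoffel g k i j y = (1 / 2) * (g y).det⁻¹ *
      ∑ l, (g y).adjugate k l * (pderiv i (fun z => g z j l) y + pderiv j (fun z => g z i l) y
        - pderiv l (fun z => g z i j) y) := by
  simp only [christoffel, Matrix.inv_def, Ring.inverse_eq_inv', Matrix.smul_apply, smul_eq_mul,
    Fin.sum_univ_two]
  ring

lemma IsMetricOn.christoffel_symm (hg : IsMetricOn g Ω) {y : Plane} (hy : y ∈ Ω) (k i j : Fin 2) :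
    christoffel g k i j y = christoffel g k j i y := by
  simp only [christoffel, hg.pderiv_symm hy _ i j, add_comm]

lemma IsMetricOn.pderiv_eq_christoffel (hg : IsMetricOn g Ω) {y : Plane} (hy : y ∈ Ω)
    (k i j : Fin 2) :
    pderiv k (fun z => g z i j) y =
      ∑ m, (christoffel g m k i y * g y m j + christoffel g m k j y * g y m i) := by
  have hdet : g y 0 0 * g y 1 1 - g y 0 1 ^ 2 ≠ 0 := hg.det_eq hy ▸ hg.det_ne_zero y hy
  simp only [christoffel_eq_adjugate, hg.det_eq hy, Matrix.adjugate_fin_two, Fin.sum_univ_two]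
  fin_cases k <;> fin_cases i <;> fin_cases j <;>
    simp [hg.symm y hy 1 0, hg.pderiv_symm hy _ 1 0] <;> field_simp <;> ring

lemma IsMetricOn.christoffelForm_symm (hg : IsMetricOn g Ω) {y : Plane} (hy : y ∈ Ω)
    (u v : Plane) : christoffelForm g y u v = christoffelForm g y v u := by
  ext k
  simp only [christoffelForm_apply, Fin.sum_univ_two, hg.christoffel_symm hy k 1 0]
  ring

lemma IsMetricOn.metricForm_symm (hg : IsMetricOn g Ω) {y : Plane} (hy : y ∈ Ω) (u v : Plane) :
    metricForm g y u v = metricForm g y v u := by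
  simp only [metricForm_apply, Fin.sum_univ_two, hg.symm y hy 1 0]
  ring

/-- The Gram determinant of the three linearly dependent plane vectors `t`, `u`, `w` vanishes. -/
lemma IsMetricOn.metricForm_mul_of_orthogonal (hg : IsMetricOn g Ω) {y : Plane} (hy : y ∈ Ω)
    {t u w : Plane} (ht : metricForm g y t t = 1) (htu : metricForm g y t u = 0)
    (htw : metricForm g y t w = 0) :
    metricForm g y u u * metricForm g y w w = metricForm g y u w ^ 2 := by
  have hgram : metricForm g y t t *
      (metricForm g y u u * metricForm g y w w - metricForm g y u w ^ 2)
      - metricForm g y t u * (metricForm g y t u * metricForm g y w w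
        - metricForm g y u w * metricForm g y t w)
      + metricForm g y t w * (metricForm g y t u * metricForm g y u w
        - metricForm g y u u * metricForm g y t w) = 0 := by
    simp only [metricForm_apply, Fin.sum_univ_two, hg.symm y hy 1 0]
    ring
  rw [ht, htu, htw] at hgram
  linarith

end Metric

/-! ### Directional and covariant derivatives -/

section Directional

variable {E : Type*} [NormedAddCommGroup E] [NormedSpace ℝ E]
  {G : Type*} [NormedAddCommGroup G] [NormedSpace ℝ G]

/-- The derivative of `F` in the constant direction `v`. -/
def dirDeriv (v : E) (F : E → G) (z : E) : G := fderiv ℝ F z v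

lemma pderiv_eq_dirDeriv (i : Fin 2) (f : Plane → ℝ) :
    pderiv i f = dirDeriv (EuclideanSpace.single i 1) f := rfl

lemma dirDeriv_one (F : ℝ → G) : dirDeriv 1 F = deriv F := rfl

lemma contDiffAt_dirDeriv {F : E → G} {z : E} (h : ContDiffAt ℝ ∞ F z) (v : E) :
    ContDiffAt ℝ ∞ (dirDeriv v F) z :=
  (h.fderiv_right (m := ∞) (by simp)).clm_apply contDiffAt_const

lemma differentiableAt_dirDeriv {F : E → G} {z : E} (h : ContDiffAt ℝ 2 F z) (v : E) :
    DifferentiableAt ℝ (dirDeriv v F) z :=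
  ((h.fderiv_right (m := 1) (by norm_num)).differentiableAt one_ne_zero).clm_apply
    (differentiableAt_const v)

lemma dirDeriv_comm {F : E → G} {z : E} (h : ContDiffAt ℝ 2 F z) (v w : E) :
    dirDeriv v (dirDeriv w F) z = dirDeriv w (dirDeriv v F) z := by
  have hdiff : DifferentiableAt ℝ (fderiv ℝ F) z :=
    (h.fderiv_right (m := 1) (by norm_num)).differentiableAt one_ne_zero
  have hsnd (a b : E) : dirDeriv a (dirDeriv b F) z = fderiv ℝ (fderiv ℝ F) z a b := by
    change fderiv ℝ (fun y => fderiv ℝ F y b) z a = _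
    simp [fderiv_clm_apply hdiff (differentiableAt_const b)]
  rw [hsnd, hsnd, (h.isSymmSndFDerivAt (by simp)).eq]

lemma dirDeriv_congr {F F' : E → G} {z : E} (h : F =ᶠ[𝓝 z] F') (v : E) :
    dirDeriv v F z = dirDeriv v F' z := by
  rw [dirDeriv, dirDeriv, h.fderiv_eq]

lemma dirDeriv_prodMk (F : ℝ × ℝ → G) (z : ℝ × ℝ) (a b : ℝ) :
    dirDeriv (a, b) F z = a • dirDeriv (1, 0) F z + b • dirDeriv (0, 1) F z := by
  have hab : ((a, b) : ℝ × ℝ) = a • ((1 : ℝ), (0 : ℝ)) + b • ((0 : ℝ), (1 : ℝ)) := by simp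
  rw [hab, dirDeriv, map_add, map_smul, map_smul]
  rfl

lemma dirDeriv_comp {E' : Type*} [NormedAddCommGroup E'] [NormedSpace ℝ E'] {F : E' → G}
    {f : E → E'} {z : E} (hF : DifferentiableAt ℝ F (f z)) (hf : DifferentiableAt ℝ f z) (v : E) :
    dirDeriv v (fun y => F (f y)) z = dirDeriv (dirDeriv v f z) F (f z) := by
  simp only [dirDeriv, fderiv_fun_comp z hF hf, ContinuousLinearMap.comp_apply]

lemma dirDeriv_mul {a b : E → ℝ} {z : E} (ha : DifferentiableAt ℝ a z)
    (hb : DifferentiableAt ℝ b z) (v : E) :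
    dirDeriv v (fun y => a y * b y) z = dirDeriv v a z * b z + a z * dirDeriv v b z := by
  simp only [dirDeriv, fderiv_fun_mul ha hb, add_apply,
    smul_apply, smul_eq_mul]
  ring

lemma dirDeriv_add {a b : E → G} {z : E} (ha : DifferentiableAt ℝ a z)
    (hb : DifferentiableAt ℝ b z) (v : E) :
    dirDeriv v (fun y => a y + b y) z = dirDeriv v a z + dirDeriv v b z := by
  simp only [dirDeriv, fderiv_fun_add ha hb, add_apply]

lemma dirDeriv_sum {ι : Type*} {s : Finset ι} {F : ι → E → G} {z : E}
    (h : ∀ i ∈ s, DifferentiableAt ℝ (F i) z) (v : E) :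
    dirDeriv v (fun y => ∑ i ∈ s, F i y) z = ∑ i ∈ s, dirDeriv v (F i) z := by
  simp only [dirDeriv, fderiv_fun_sum h, sum_apply]

lemma dirDeriv_sum_mul_mul {ι κ : Type*} [Fintype ι] [Fintype κ] {a : ι → κ → E → ℝ}
    {b : ι → E → ℝ} {c : κ → E → ℝ} {z : E} (ha : ∀ i j, DifferentiableAt ℝ (a i j) z)
    (hb : ∀ i, DifferentiableAt ℝ (b i) z) (hc : ∀ j, DifferentiableAt ℝ (c j) z) (v : E) :
    dirDeriv v (fun y => ∑ i, ∑ j, a i j y * b i y * c j y) z =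
      ∑ i, ∑ j, (dirDeriv v (a i j) z * b i z * c j z + a i j z * dirDeriv v (b i) z * c j z
        + a i j z * b i z * dirDeriv v (c j) z) := by
  have hab (i j) := (ha i j).fun_mul (hb i)
  have habc (i j) := (hab i j).fun_mul (hc j)
  rw [dirDeriv_sum fun i _ => DifferentiableAt.fun_sum fun j _ => habc i j]
  refine Finset.sum_congr rfl fun i _ => ?_
  rw [dirDeriv_sum fun j _ => habc i j]
  refine Finset.sum_congr rfl fun j _ => ?_
  rw [dirDeriv_mul (hab i j) (hc j), dirDeriv_mul (ha i j) (hb i)]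
  ring

lemma dirDeriv_apply {X : E → Plane} {z : E} (hX : DifferentiableAt ℝ X z) (v : E) (i : Fin 2) :
    dirDeriv v (fun y => X y i) z = dirDeriv v X z i :=
  congrArg (· v)
    (((EuclideanSpace.proj i : Plane →L[ℝ] ℝ).hasFDerivAt (x := X z)).comp z hX.hasFDerivAt).fderiv

lemma differentiableAt_coord {X : E → Plane} {z : E} (hX : DifferentiableAt ℝ X z) (i : Fin 2) :
    DifferentiableAt ℝ (fun y => X y i) z :=
  differentiableAt_euclidean.1 hX i

lemma contDiffAt_coord {n : ℕ∞ω} {X : E → Plane} {z : E} (hX : ContDiffAt ℝ n X z) (i : Fin 2) :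
    ContDiffAt ℝ n (fun y => X y i) z :=
  contDiffAt_euclidean.1 hX i

lemma dirDeriv_eq_sum_pderiv (F : Plane → ℝ) (y u : Plane) :
    dirDeriv u F y = ∑ k, pderiv k F y * u k := by
  have hu : u = ∑ k, u k • EuclideanSpace.single k (1 : ℝ) := by
    ext i
    fin_cases i <;> simp
  conv_lhs => rw [dirDeriv, hu, map_sum]
  simp [pderiv, mul_comm]

end Directional

/-! ### The Levi-Civita connection along a map -/

section CovDeriv

variable {E : Type*} [NormedAddCommGroup E] [NormedSpace ℝ E]
  {g : Plane → Matrix (Fin 2) (Fin 2) ℝ} {Ω : Set Plane} {f X Y : E → Plane} {z : E}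

/-- The covariant derivative, in the direction `v`, of the vector field `X` along the map `f`. -/
def covDeriv (g : Plane → Matrix (Fin 2) (Fin 2) ℝ) (f : E → Plane) (v : E) (X : E → Plane)
    (z : E) : Plane :=
  dirDeriv v X z + christoffelForm g (f z) (dirDeriv v f z) (X z)

lemma covDeriv_apply (v : E) (l : Fin 2) :
    covDeriv g f v X z l = dirDeriv v X z l
      + ∑ i, ∑ j, christoffel g l i j (f z) * dirDeriv v f z i * X z j := rfl

lemma covDeriv_congr {X' : E → Plane} (h : X =ᶠ[𝓝 z] X') (v : E) :
    covDeriv g f v X z = covDeriv g f v X' z := by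
  rw [covDeriv, covDeriv, dirDeriv_congr h, h.self_of_nhds]

lemma covDeriv_congr_left {f' : E → Plane} (h : f =ᶠ[𝓝 z] f') (v : E) :
    covDeriv g f v X z = covDeriv g f' v X z := by
  rw [covDeriv, covDeriv, dirDeriv_congr h, h.self_of_nhds]

lemma covDeriv_zero (v : E) : covDeriv g f v (fun _ => 0) z = 0 := by
  simp [covDeriv, dirDeriv]

lemma covDeriv_prodMk {f X : ℝ × ℝ → Plane} {z : ℝ × ℝ} (a b : ℝ) :
    covDeriv g f (a, b) X z = a • covDeriv g f (1, 0) X z + b • covDeriv g f (0, 1) X z := by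
  simp only [covDeriv, dirDeriv_prodMk _ z a b, map_add, map_smul, LinearMap.add_apply,
    LinearMap.smul_apply, smul_add]
  abel

lemma covDeriv_comp {E' : Type*} [NormedAddCommGroup E'] [NormedSpace ℝ E'] {P : E' → E} {y : E'}
    (hf : DifferentiableAt ℝ f (P y)) (hX : DifferentiableAt ℝ X (P y))
    (hP : DifferentiableAt ℝ P y) (v : E') :
    covDeriv g (fun y => f (P y)) v (fun y => X (P y)) y =
      covDeriv g f (dirDeriv v P y) X (P y) := by
  rw [covDeriv, covDeriv, dirDeriv_comp hf hP, dirDeriv_comp hX hP]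

lemma IsMetricOn.contDiffAt_christoffel (hg : IsMetricOn g Ω) {y : Plane} (hy : y ∈ Ω)
    (k i j : Fin 2) : ContDiffAt ℝ ∞ (christoffel g k i j) y := by
  have hentry (i j) := hg.contDiffAt y hy i j
  have hpderiv (k i j) : ContDiffAt ℝ ∞ (pderiv k fun z => g z i j) y :=
    contDiffAt_dirDeriv (hentry i j) _
  have hdet : ContDiffAt ℝ ∞ (fun z => (g z).det) y := by
    simp only [Matrix.det_fin_two]
    exact ((hentry 0 0).mul (hentry 1 1)).sub ((hentry 0 1).mul (hentry 1 0))
  have hadj (k l) : ContDiffAt ℝ ∞ (fun z => (g z).adjugate k l) y := by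
    simp only [Matrix.adjugate_fin_two]
    fin_cases k <;> fin_cases l <;> simp [hentry, (hentry _ _).neg]
  rw [funext (christoffel_eq_adjugate k i j)]
  exact (contDiffAt_const.mul (hdet.inv (hg.det_ne_zero y hy))).mul <| ContDiffAt.sum fun l _ =>
    (hadj k l).mul (((hpderiv i j l).add (hpderiv j i l)).sub (hpderiv l i j))

lemma IsMetricOn.differentiableAt_christoffel (hg : IsMetricOn g Ω) {y : Plane} (hy : y ∈ Ω)
    (k i j : Fin 2) : DifferentiableAt ℝ (christoffel g k i j) y :=
  (hg.contDiffAt_christoffel hy k i j).differentiableAt (by simp)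

lemma IsMetricOn.differentiableAt (hg : IsMetricOn g Ω) {y : Plane} (hy : y ∈ Ω) (i j : Fin 2) :
    DifferentiableAt ℝ (fun z => g z i j) y :=
  (hg.contDiffAt y hy i j).differentiableAt (by simp)

lemma IsMetricOn.contDiffAt_metricForm (hg : IsMetricOn g Ω) (hz : f z ∈ Ω)
    (hf : ContDiffAt ℝ ∞ f z) (hX : ContDiffAt ℝ ∞ X z) (hY : ContDiffAt ℝ ∞ Y z) :
    ContDiffAt ℝ ∞ (fun y => metricForm g (f y) (X y) (Y y)) z := by
  simp only [metricForm_apply]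
  exact ContDiffAt.sum fun i _ => ContDiffAt.sum fun j _ =>
    (((hg.contDiffAt _ hz i j).comp z hf).mul (contDiffAt_coord hX i)).mul (contDiffAt_coord hY j)

lemma IsMetricOn.contDiffAt_christoffelForm (hg : IsMetricOn g Ω) (hz : f z ∈ Ω)
    (hf : ContDiffAt ℝ ∞ f z) (hX : ContDiffAt ℝ ∞ X z) (hY : ContDiffAt ℝ ∞ Y z) :
    ContDiffAt ℝ ∞ (fun y => christoffelForm g (f y) (X y) (Y y)) z := by
  refine contDiffAt_euclidean.2 fun k => ?_
  simp only [christoffelForm_apply]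
  exact ContDiffAt.sum fun i _ => ContDiffAt.sum fun j _ =>
    (((hg.contDiffAt_christoffel hz k i j).comp z hf).mul (contDiffAt_coord hX i)).mul
      (contDiffAt_coord hY j)

lemma IsMetricOn.contDiffAt_covDeriv (hg : IsMetricOn g Ω) (hz : f z ∈ Ω)
    (hf : ContDiffAt ℝ ∞ f z) (hX : ContDiffAt ℝ ∞ X z) (v : E) :
    ContDiffAt ℝ ∞ (covDeriv g f v X) z :=
  (contDiffAt_dirDeriv hX v).add
    (hg.contDiffAt_christoffelForm hz hf (contDiffAt_dirDeriv hf v) hX)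

lemma IsMetricOn.dirDeriv_metricForm (hg : IsMetricOn g Ω) (hz : f z ∈ Ω)
    (hf : DifferentiableAt ℝ f z) (hX : DifferentiableAt ℝ X z) (hY : DifferentiableAt ℝ Y z)
    (v : E) :
    dirDeriv v (fun y => metricForm g (f y) (X y) (Y y)) z =
      metricForm g (f z) (covDeriv g f v X z) (Y z)
        + metricForm g (f z) (X z) (covDeriv g f v Y z) := by
  have hentry (i j) : DifferentiableAt ℝ (fun y => g (f y) i j) z :=
    (hg.differentiableAt hz i j).comp z hf
  simp only [metricForm_apply]
  rw [dirDeriv_sum_mul_mul hentry (differentiableAt_coord hX) (differentiableAt_coord hY)]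
  simp only [dirDeriv_apply hX, dirDeriv_apply hY, dirDeriv_comp (hg.differentiableAt hz _ _) hf,
    dirDeriv_eq_sum_pderiv, hg.pderiv_eq_christoffel hz, covDeriv_apply, Fin.sum_univ_two,
    hg.symm _ hz 1 0, hg.christoffel_symm hz _ 1 0]
  ring

lemma IsMetricOn.covDeriv_comm (hg : IsMetricOn g Ω) (hz : f z ∈ Ω) (hf : ContDiffAt ℝ 2 f z)
    (v w : E) : covDeriv g f v (dirDeriv w f) z = covDeriv g f w (dirDeriv v f) z := by
  rw [covDeriv, covDeriv, dirDeriv_comm hf, hg.christoffelForm_symm hz]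

lemma IsMetricOn.dirDeriv_covDeriv_apply (hg : IsMetricOn g Ω) (hz : f z ∈ Ω)
    (hf : ContDiffAt ℝ ∞ f z) (hX : ContDiffAt ℝ ∞ X z) (v w : E) (l : Fin 2) :
    dirDeriv v (covDeriv g f w X) z l = dirDeriv v (dirDeriv w X) z l +
      ∑ i, ∑ j, ((∑ k, pderiv k (christoffel g l i j) (f z) * dirDeriv v f z k)
          * dirDeriv w f z i * X z j
        + christoffel g l i j (f z) * dirDeriv v (dirDeriv w f) z i * X z j
        + christoffel g l i j (f z) * dirDeriv w f z i * dirDeriv v X z j) := by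
  have hdf : DifferentiableAt ℝ f z := hf.differentiableAt (by simp)
  have hdX : DifferentiableAt ℝ X z := hX.differentiableAt (by simp)
  have hdwf := differentiableAt_dirDeriv (hf.of_le ENat.LEInfty.out) w
  have hdwX := differentiableAt_dirDeriv (hX.of_le ENat.LEInfty.out) w
  have hΓ (i j) : DifferentiableAt ℝ (fun y => christoffel g l i j (f y)) z :=
    (hg.differentiableAt_christoffel hz l i j).comp z hdf
  have hcov : DifferentiableAt ℝ (covDeriv g f w X) z :=
    (hg.contDiffAt_covDeriv hz hf hX w).differentiableAt (by simp)
  have hwf (i) := differentiableAt_coord hdwf i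
  have hX' (j) := differentiableAt_coord hdX j
  rw [← dirDeriv_apply hcov]
  simp only [covDeriv_apply]
  rw [dirDeriv_add (differentiableAt_coord hdwX l) (DifferentiableAt.fun_sum fun i _ =>
      DifferentiableAt.fun_sum fun j _ => ((hΓ i j).fun_mul (hwf i)).fun_mul (hX' j)),
    dirDeriv_sum_mul_mul hΓ hwf hX']
  simp only [dirDeriv_apply hdwX, dirDeriv_apply hdwf, dirDeriv_apply hdX,
    dirDeriv_comp (hg.differentiableAt_christoffel hz _ _ _) hdf, dirDeriv_eq_sum_pderiv]

lemma IsMetricOn.covDeriv_covDeriv (hg : IsMetricOn g Ω) (hz : f z ∈ Ω)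
    (hf : ContDiffAt ℝ ∞ f z) (hX : ContDiffAt ℝ ∞ X z) (v w : E) :
    covDeriv g f v (covDeriv g f w X) z = covDeriv g f w (covDeriv g f v X) z
      + curvatureForm g (f z) (dirDeriv v f z) (dirDeriv w f z) (X z) := by
  ext l
  rw [PiLp.add_apply, covDeriv_apply, covDeriv_apply w, hg.dirDeriv_covDeriv_apply hz hf hX,
    hg.dirDeriv_covDeriv_apply hz hf hX, dirDeriv_comm (hX.of_le ENat.LEInfty.out) w v,
    dirDeriv_comm (hf.of_le ENat.LEInfty.out) w v]
  simp only [covDeriv_apply, Fin.sum_univ_two, curvatureForm_apply, curvatureTensor]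
  ring

end CovDeriv

/-! ### Curvature -/

section Curvature

variable {g : Plane → Matrix (Fin 2) (Fin 2) ℝ} {Ω : Set Plane} {y : Plane}

lemma IsMetricOn.pderiv_pderiv (hg : IsMetricOn g Ω) (hy : y ∈ Ω) (a c j k : Fin 2) :
    pderiv a (pderiv c fun z => g z j k) y =
      ∑ m, ((pderiv a (christoffel g m c j) y * g y m k
          + christoffel g m c j y * pderiv a (fun z => g z m k) y)
        + (pderiv a (christoffel g m c k) y * g y m j
          + christoffel g m c k y * pderiv a (fun z => g z m j) y)) := by
  have hprod (m c j k) :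
      DifferentiableAt ℝ (fun z => christoffel g m c j z * g z m k) y :=
    (hg.differentiableAt_christoffel hy m c j).fun_mul (hg.differentiableAt hy m k)
  have hfst : (pderiv c fun z => g z j k) =ᶠ[𝓝 y] fun z =>
      ∑ m, (christoffel g m c j z * g z m k + christoffel g m c k z * g z m j) :=
    eventually_of_mem (hg.isOpen.mem_nhds hy) fun z hz => hg.pderiv_eq_christoffel hz c j k
  simp only [pderiv_eq_dirDeriv a]
  rw [dirDeriv_congr hfst,
    dirDeriv_sum fun m _ => (hprod m c j k).fun_add (hprod m c k j)]
  simp only [dirDeriv_add (hprod _ c j k) (hprod _ c k j),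
    dirDeriv_mul (hg.differentiableAt_christoffel hy _ _ _) (hg.differentiableAt hy _ _)]

/-- `R(∂₀, ∂₁)` is skew-adjoint: this is the equality of the mixed second derivatives of `g`. -/
lemma IsMetricOn.curvatureTensor_skew (hg : IsMetricOn g Ω) (hy : y ∈ Ω) (j k : Fin 2) :
    ∑ l, (curvatureTensor g 0 1 j l y * g y l k + curvatureTensor g 0 1 k l y * g y l j) = 0 := by
  have hcomm : pderiv 0 (pderiv 1 fun z => g z j k) y = pderiv 1 (pderiv 0 fun z => g z j k) y :=
    dirDeriv_comm ((hg.contDiffAt y hy j k).of_le ENat.LEInfty.out) _ _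
  rw [hg.pderiv_pderiv hy, hg.pderiv_pderiv hy] at hcomm
  simp only [hg.pderiv_eq_christoffel hy, Fin.sum_univ_two, curvatureTensor,
    hg.symm y hy 1 0] at hcomm ⊢
  linear_combination hcomm

lemma IsMetricOn.metricForm_curvatureForm (hg : IsMetricOn g Ω) (hy : y ∈ Ω) (t u : Plane) :
    metricForm g y (curvatureForm g y t u t) u = -gaussCurvatureOfGram g y *
      (metricForm g y t t * metricForm g y u u - metricForm g y t u ^ 2) := by
  have h00 := hg.curvatureTensor_skew hy 0 0
  have h01 := hg.curvatureTensor_skew hy 0 1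
  have h11 := hg.curvatureTensor_skew hy 1 1
  have hK : gaussCurvatureOfGram g y * (g y).det = ∑ l, curvatureTensor g 0 1 1 l y * g y l 0 :=
    div_mul_cancel₀ _ (hg.det_ne_zero y hy)
  rw [hg.det_eq hy] at hK
  simp only [metricForm_apply, curvatureForm_apply, Fin.sum_univ_two, hg.symm y hy 1 0]
    at h00 h01 h11 hK ⊢
  linear_combination (t 0 * u 1 - t 1 * u 0) ^ 2 * hK
    + (t 0 * u 1 - t 1 * u 0) * t 0 * u 0 / 2 * h00
    + (t 0 * u 1 - t 1 * u 0) * t 1 * u 1 / 2 * h11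
    + (t 0 * u 1 - t 1 * u 0) * t 0 * u 1 * h01

end Curvature

/-! ### Families of geodesics -/

section Families

variable {E : Type*} [NormedAddCommGroup E] [NormedSpace ℝ E]
  {g : Plane → Matrix (Fin 2) (Fin 2) ℝ} {Ω : Set Plane} {f : E → Plane} {z : E} {v w : E}

lemma IsMetricOn.dirDeriv_metricForm_self (hg : IsMetricOn g Ω) (hz : f z ∈ Ω)
    (hf : ContDiffAt ℝ 2 f z) :
    dirDeriv w (fun y => metricForm g (f y) (dirDeriv v f y) (dirDeriv v f y)) z =
      2 * metricForm g (f z) (dirDeriv v f z) (covDeriv g f v (dirDeriv w f) z) := by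
  have hv := differentiableAt_dirDeriv hf v
  rw [hg.dirDeriv_metricForm hz (hf.differentiableAt two_ne_zero) hv hv, hg.covDeriv_comm hz hf v w,
    hg.metricForm_symm hz]
  ring

lemma IsMetricOn.dirDeriv_metricForm_of_geodesic (hg : IsMetricOn g Ω) (hz : f z ∈ Ω)
    (hf : ContDiffAt ℝ 2 f z) (hgeo : covDeriv g f v (dirDeriv v f) z = 0) :
    2 * dirDeriv v (fun y => metricForm g (f y) (dirDeriv v f y) (dirDeriv w f y)) z =
      dirDeriv w (fun y => metricForm g (f y) (dirDeriv v f y) (dirDeriv v f y)) z := by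
  rw [hg.dirDeriv_metricForm hz (hf.differentiableAt two_ne_zero) (differentiableAt_dirDeriv hf v)
    (differentiableAt_dirDeriv hf w), hgeo, hg.dirDeriv_metricForm_self hz hf, map_zero,
    LinearMap.zero_apply, zero_add]

lemma IsMetricOn.covDeriv_covDeriv_variation (hg : IsMetricOn g Ω) (hz : f z ∈ Ω)
    (hf : ContDiffAt ℝ ∞ f z) (hgeo : covDeriv g f v (dirDeriv v f) =ᶠ[𝓝 z] fun _ => 0) :
    covDeriv g f v (covDeriv g f v (dirDeriv w f)) z =
      curvatureForm g (f z) (dirDeriv v f z) (dirDeriv w f z) (dirDeriv v f z) := by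
  have hf2 : ContDiffAt ℝ 2 f z := hf.of_le ENat.LEInfty.out
  have hcomm : covDeriv g f v (dirDeriv w f) =ᶠ[𝓝 z] covDeriv g f w (dirDeriv v f) := by
    filter_upwards [hf2.eventually (by simp),
      hf.continuousAt.eventually_mem (hg.isOpen.mem_nhds hz)] with y hy hyΩ
    exact hg.covDeriv_comm hyΩ hy v w
  rw [covDeriv_congr hcomm, hg.covDeriv_covDeriv hz hf (contDiffAt_dirDeriv hf v),
    covDeriv_congr hgeo, covDeriv_zero, zero_add]

lemma IsMetricOn.metricForm_covDeriv_eq_zero (hg : IsMetricOn g Ω) (hz : f z ∈ Ω)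
    (hf : ContDiffAt ℝ 2 f z)
    (hunit : ∀ᶠ y in 𝓝 z, metricForm g (f y) (dirDeriv v f y) (dirDeriv v f y) = 1) :
    metricForm g (f z) (dirDeriv v f z) (covDeriv g f v (dirDeriv w f) z) = 0 := by
  have hconst : dirDeriv w (fun y => metricForm g (f y) (dirDeriv v f y) (dirDeriv v f y)) z
      = dirDeriv w (fun _ => (1 : ℝ)) z := dirDeriv_congr hunit w
  rw [hg.dirDeriv_metricForm_self hz hf] at hconst
  simpa [dirDeriv] using hconst

/-- The Jacobi equation `G'' = -K G` for the length `G` of a transversal field orthogonal to a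
family of unit speed geodesics, as an equation for `q = G²`. -/
lemma IsMetricOn.jacobi_sq (hg : IsMetricOn g Ω) (hz : f z ∈ Ω) (hf : ContDiffAt ℝ ∞ f z)
    (hgeo : covDeriv g f v (dirDeriv v f) =ᶠ[𝓝 z] fun _ => 0)
    (hunit : ∀ᶠ y in 𝓝 z, metricForm g (f y) (dirDeriv v f y) (dirDeriv v f y) = 1)
    (horth : metricForm g (f z) (dirDeriv v f z) (dirDeriv w f z) = 0) :
    let q : E → ℝ := fun y => metricForm g (f y) (dirDeriv w f y) (dirDeriv w f y)
    q z * dirDeriv v (dirDeriv v q) z =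
      dirDeriv v q z ^ 2 / 2 - 2 * gaussCurvatureOfGram g (f z) * q z ^ 2 := by
  intro q
  set Y : E → Plane := dirDeriv w f
  set Z : E → Plane := covDeriv g f v Y
  have hf2 : ContDiffAt ℝ 2 f z := hf.of_le ENat.LEInfty.out
  have hY : ContDiffAt ℝ ∞ Y z := contDiffAt_dirDeriv hf w
  have hZ : ContDiffAt ℝ ∞ Z z := hg.contDiffAt_covDeriv hz hf hY v
  have hYZ : DifferentiableAt ℝ (fun y => metricForm g (f y) (Y y) (Z y)) z :=
    (hg.contDiffAt_metricForm hz hf hY hZ).differentiableAt (by simp)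
  have hq : dirDeriv v q =ᶠ[𝓝 z] fun y =>
      metricForm g (f y) (Y y) (Z y) + metricForm g (f y) (Y y) (Z y) := by
    filter_upwards [hf2.eventually (by simp),
      hf.continuousAt.eventually_mem (hg.isOpen.mem_nhds hz)] with y hy hyΩ
    have hYy := differentiableAt_dirDeriv hy w
    rw [hg.dirDeriv_metricForm hyΩ (hy.differentiableAt two_ne_zero) hYy hYy,
      hg.metricForm_symm hyΩ]
  have hcurv : metricForm g (f z) (Y z) (covDeriv g f v Z z) =
      -gaussCurvatureOfGram g (f z) * q z := by
    rw [hg.covDeriv_covDeriv_variation hz hf hgeo, hg.metricForm_symm hz,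
      hg.metricForm_curvatureForm hz, hunit.self_of_nhds, horth]
    ring
  have hgram := hg.metricForm_mul_of_orthogonal hz hunit.self_of_nhds horth
    (hg.metricForm_covDeriv_eq_zero (w := w) hz hf2 hunit)
  rw [dirDeriv_congr hq, dirDeriv_add hYZ hYZ, hg.dirDeriv_metricForm hz
    (hf.differentiableAt (by simp)) (hY.differentiableAt (by simp))
    (hZ.differentiableAt (by simp)), hcurv, hq.self_of_nhds]
  linear_combination 2 * hgram

end Families

section PolarRadius

variable {g : Plane → Matrix (Fin 2) (Fin 2) ℝ} {Ω : Set Plane} {f : ℝ × ℝ → Plane}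
  {r θ : ℝ → ℝ} {s : ℝ}

lemma dirDeriv_one_prodMk (hr : DifferentiableAt ℝ r s) (hθ : DifferentiableAt ℝ θ s) :
    dirDeriv 1 (fun τ => (r τ, θ τ)) s = (deriv r s, deriv θ s) := by
  rw [dirDeriv_one, (hr.hasDerivAt.prodMk hθ.hasDerivAt).deriv]

lemma deriv_comp_prodMk {G : Type*} [NormedAddCommGroup G] [NormedSpace ℝ G] {F : ℝ × ℝ → G}
    (hF : DifferentiableAt ℝ F (r s, θ s)) (hr : DifferentiableAt ℝ r s)
    (hθ : DifferentiableAt ℝ θ s) :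
    deriv (fun τ => F (r τ, θ τ)) s = deriv r s • dirDeriv (1, 0) F (r s, θ s)
      + deriv θ s • dirDeriv (0, 1) F (r s, θ s) := by
  rw [← dirDeriv_one, dirDeriv_comp (f := fun τ => (r τ, θ τ)) hF (hr.prodMk hθ),
    dirDeriv_one_prodMk hr hθ, dirDeriv_prodMk]

lemma IsMetricOn.deriv_radius (hg : IsMetricOn g Ω) (hz : f (r s, θ s) ∈ Ω)
    (hf : DifferentiableAt ℝ f (r s, θ s))
    (hunit : metricForm g (f (r s, θ s)) (dirDeriv (1, 0) f (r s, θ s))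
      (dirDeriv (1, 0) f (r s, θ s)) = 1)
    (horth : metricForm g (f (r s, θ s)) (dirDeriv (1, 0) f (r s, θ s))
      (dirDeriv (0, 1) f (r s, θ s)) = 0)
    (hr : DifferentiableAt ℝ r s) (hθ : DifferentiableAt ℝ θ s) :
    deriv r s = metricForm g (f (r s, θ s)) (deriv (fun τ => f (r τ, θ τ)) s)
      (dirDeriv (1, 0) f (r s, θ s)) := by
  rw [deriv_comp_prodMk hf hr hθ, map_add, map_smul, map_smul, LinearMap.add_apply,
    LinearMap.smul_apply, LinearMap.smul_apply, hg.metricForm_symm hz (dirDeriv (0, 1) f _), hunit,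
    horth]
  simp

lemma IsMetricOn.covDeriv_radial (hg : IsMetricOn g Ω) (hz : f (r s, θ s) ∈ Ω)
    (hf : ContDiffAt ℝ 2 f (r s, θ s))
    (hgeo : covDeriv g f (1, 0) (dirDeriv (1, 0) f) (r s, θ s) = 0)
    (hr : DifferentiableAt ℝ r s) (hθ : DifferentiableAt ℝ θ s) :
    covDeriv g (fun τ => f (r τ, θ τ)) 1 (fun τ => dirDeriv (1, 0) f (r τ, θ τ)) s =
      deriv θ s • covDeriv g f (1, 0) (dirDeriv (0, 1) f) (r s, θ s) := by
  rw [covDeriv_comp (P := fun τ => (r τ, θ τ)) (hf.differentiableAt two_ne_zero)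
    (differentiableAt_dirDeriv hf _) (hr.prodMk hθ), dirDeriv_one_prodMk hr hθ, covDeriv_prodMk,
    hgeo, smul_zero, zero_add, hg.covDeriv_comm hz hf]

/-- Differentiate `r' = ⟨c', ∂_r f⟩` along the curve `c = f (r, θ)`: as the coordinate lines
`θ = const` are geodesics, only the term `θ' ⟨c', ∇_θ ∂_r f⟩` survives. -/
lemma IsMetricOn.deriv_deriv_radius (hg : IsMetricOn g Ω) (hz : f (r s, θ s) ∈ Ω)
    (hf : ContDiffAt ℝ 2 f (r s, θ s))
    (hgeo : covDeriv g f (1, 0) (dirDeriv (1, 0) f) (r s, θ s) = 0)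
    (hunit : ∀ᶠ y in 𝓝 (r s, θ s),
      metricForm g (f y) (dirDeriv (1, 0) f y) (dirDeriv (1, 0) f y) = 1)
    (horth : ∀ᶠ y in 𝓝 (r s, θ s),
      metricForm g (f y) (dirDeriv (1, 0) f y) (dirDeriv (0, 1) f y) = 0)
    (hr : ContDiffAt ℝ 2 r s) (hθ : ContDiffAt ℝ 2 θ s)
    (hacc : covDeriv g (fun τ => f (r τ, θ τ)) 1 (deriv fun τ => f (r τ, θ τ)) s = 0) :
    deriv (deriv r) s = deriv θ s ^ 2 *
      (dirDeriv (1, 0) (fun y => metricForm g (f y) (dirDeriv (0, 1) f y) (dirDeriv (0, 1) f y))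
        (r s, θ s) / 2) := by
  have hP : ContDiffAt ℝ 2 (fun τ => (r τ, θ τ)) s := hr.prodMk hθ
  have hc : ContDiffAt ℝ 2 (fun τ => f (r τ, θ τ)) s := hf.comp s hP
  have hr1 : DifferentiableAt ℝ r s := hr.differentiableAt two_ne_zero
  have hθ1 : DifferentiableAt ℝ θ s := hθ.differentiableAt two_ne_zero
  have hf1 : DifferentiableAt ℝ f (r s, θ s) := hf.differentiableAt two_ne_zero
  have hY := differentiableAt_dirDeriv hf (0, 1)
  have hr' : deriv r =ᶠ[𝓝 s] fun τ => metricForm g (f (r τ, θ τ))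
      (deriv (fun τ => f (r τ, θ τ)) τ) (dirDeriv (1, 0) f (r τ, θ τ)) := by
    filter_upwards [hP.continuousAt.eventually (hf.eventually (by simp)), hr.eventually (by simp),
      hθ.eventually (by simp), hP.continuousAt.eventually hunit, hP.continuousAt.eventually horth,
      hc.continuousAt.eventually_mem (hg.isOpen.mem_nhds hz)] with τ hfτ hrτ hθτ hunitτ horthτ hτΩ
    exact hg.deriv_radius hτΩ (hfτ.differentiableAt two_ne_zero) hunitτ horthτ
      (hrτ.differentiableAt two_ne_zero) (hθτ.differentiableAt two_ne_zero)
  have hc' : DifferentiableAt ℝ (deriv fun τ => f (r τ, θ τ)) s := differentiableAt_dirDeriv hc 1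
  have hT : DifferentiableAt ℝ (fun τ => dirDeriv (1, 0) f (r τ, θ τ)) s :=
    (differentiableAt_dirDeriv hf (1, 0)).comp (f := fun τ => (r τ, θ τ)) s (hr1.prodMk hθ1)
  have hTZ := hg.metricForm_covDeriv_eq_zero (w := (0, 1)) hz hf hunit
  rw [← dirDeriv_one, dirDeriv_congr hr', hg.dirDeriv_metricForm
    (f := fun τ => f (r τ, θ τ)) hz (hc.differentiableAt two_ne_zero) hc' hT, hacc,
    hg.covDeriv_radial hz hf hgeo hr1 hθ1, deriv_comp_prodMk hf1 hr1 hθ1,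
    hg.dirDeriv_metricForm hz hf1 hY hY,
    hg.metricForm_symm hz (covDeriv g f (1, 0) (dirDeriv (0, 1) f) (r s, θ s))]
  simp only [map_zero, map_add, map_smul, LinearMap.zero_apply, LinearMap.add_apply,
    LinearMap.smul_apply, smul_eq_mul, hTZ]
  ring

end PolarRadius

/-! ### The metric in a chart -/

section Chart

variable {M : Type*} [MetricSpace M] [ChartedSpace Plane M]

/-- The derivative at `w` of a map `F` into the surface, as a map from the vectors of `E` to the
tangent plane at `F w`. -/
def pushforward {E : Type*} [NormedAddCommGroup E] [NormedSpace ℝ E] (F : E → M) (w : E) :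
    E →L[ℝ] TangentSpace (𝓡 2) (F w) :=
  mfderiv 𝓘(ℝ, E) (𝓡 2) F w

/-- The components, in the chart around `x`, of the tangent vectors at `y`. -/
def chartDeriv (x y : M) : TangentSpace (𝓡 2) y →L[ℝ] Plane :=
  mfderiv (𝓡 2) 𝓘(ℝ, Plane) (extChartAt (𝓡 2) x) y

/-- The tangent vectors with given components in the chart around `x`, at the point with
coordinates `z`. -/
def chartSymmDeriv (x : M) (z : Plane) :
    Plane →L[ℝ] TangentSpace (𝓡 2) ((extChartAt (𝓡 2) x).symm z) :=
  mfderiv 𝓘(ℝ, Plane) (𝓡 2) (extChartAt (𝓡 2) x).symm z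

lemma contMDiffAt_coordVec [IsManifold (𝓡 2) ∞ M] (x : M) {z : Plane}
    (hz : z ∈ (extChartAt (𝓡 2) x).target) (i : Fin 2) :
    ContMDiffAt 𝓘(ℝ, Plane) ((𝓡 2).prod 𝓘(ℝ, Plane)) ∞
      (fun y => (coordVec x y i : TotalSpace Plane (fun x : M => TangentSpace (𝓡 2) x))) z := by
  have hopen := isOpen_extChartAt_target (I := 𝓡 2) x
  have htangentMap := (contMDiffOn_extChartAt_symm (I := 𝓡 2) (n := ∞)
    x).contMDiffOn_tangentMapWithin (m := ∞) (by simp) hopen.uniqueMDiffOn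
  have hsingle : ContMDiff 𝓘(ℝ, Plane) (𝓘(ℝ, Plane).prod 𝓘(ℝ, Plane)) ∞
      (fun y => (⟨y, EuclideanSpace.single i (1 : ℝ)⟩ : TangentBundle 𝓘(ℝ, Plane) Plane)) :=
    contMDiff_vectorSpace_iff_contDiff.2 contDiff_const
  have hcomp := (htangentMap.comp hsingle.contMDiffOn (s := (extChartAt (𝓡 2) x).target)
    (fun y hy => hy)).contMDiffAt (hopen.mem_nhds hz)
  refine hcomp.congr_of_eventuallyEq ?_
  filter_upwards [hopen.mem_nhds hz] with y hy
  simp only [Function.comp_apply, tangentMapWithin, coordVec]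
  rw [mfderivWithin_of_mem_nhds (hopen.mem_nhds hy)]

section Manifold

variable [IsManifold (𝓡 2) 1 M]

lemma chartSymmDeriv_chartDeriv (x : M) {z : Plane} (hz : z ∈ (extChartAt (𝓡 2) x).target)
    (u : TangentSpace (𝓡 2) ((extChartAt (𝓡 2) x).symm z)) :
    chartSymmDeriv x z (chartDeriv x _ u) = u := by
  have h := mfderivWithin_extChartAt_symm_comp_mfderiv_extChartAt hz
  rw [ModelWithCorners.range_eq_univ, mfderivWithin_univ] at h
  exact congrArg (· u) h

lemma chartDeriv_chartSymmDeriv (x : M) {z : Plane} (hz : z ∈ (extChartAt (𝓡 2) x).target)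
    (u : Plane) : chartDeriv x _ (chartSymmDeriv x z u) = u := by
  have h := mfderiv_extChartAt_comp_mfderivWithin_extChartAt_symm hz
  rw [ModelWithCorners.range_eq_univ, mfderivWithin_univ] at h
  exact congrArg (· u) h

lemma chartDeriv_injective (x : M) {y : M} (hy : y ∈ (chartAt Plane x).source) :
    Function.Injective (chartDeriv x y) :=
  (isInvertible_mfderiv_extChartAt (by rwa [extChartAt_source])).injective

lemma chartDeriv_pushforward {E : Type*} [NormedAddCommGroup E] [NormedSpace ℝ E] {F : E → M}
    {z : E} (hF : MDifferentiableAt 𝓘(ℝ, E) (𝓡 2) F z) (x : M)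
    (hx : F z ∈ (chartAt Plane x).source) (v : E) :
    chartDeriv x (F z) (pushforward F z v) = dirDeriv v (extChartAt (𝓡 2) x ∘ F) z := by
  have h := mfderiv_comp z (mdifferentiableAt_extChartAt (I := 𝓡 2) hx) hF
  rw [mfderiv_eq_fderiv] at h
  exact (congrArg (· v) h).symm

end Manifold

variable [RiemannianBundle (fun x : M => TangentSpace (𝓡 2) x)]

lemma metricForm_chartGram (x : M) (z u v : Plane) :
    metricForm (chartGram x) z u v = inner ℝ (chartSymmDeriv x z u) (chartSymmDeriv x z v) := by
  have hsum (w : Plane) : chartSymmDeriv x z w = ∑ k, w k • coordVec x z k := by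
    conv_lhs => rw [← (EuclideanSpace.basisFun (Fin 2) ℝ).sum_repr w]
    simp only [map_sum, map_smul, EuclideanSpace.basisFun_repr, EuclideanSpace.basisFun_apply]
    rfl
  rw [hsum, hsum]
  simp only [metricForm_apply, chartGram, Fin.sum_univ_two, Matrix.of_apply, inner_add_left,
    inner_add_right, real_inner_smul_left, real_inner_smul_right]
  ring

section Manifold

variable [IsManifold (𝓡 2) 1 M]

lemma inner_eq_metricForm (x : M) {y : M} (hy : y ∈ (chartAt Plane x).source)
    (u v : TangentSpace (𝓡 2) y) :
    inner ℝ u v = metricForm (chartGram x) (extChartAt (𝓡 2) x y)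
      (chartDeriv x y u) (chartDeriv x y v) := by
  rw [← extChartAt_source (𝓡 2)] at hy
  obtain ⟨z, hz, rfl⟩ : ∃ z ∈ (extChartAt (𝓡 2) x).target, (extChartAt (𝓡 2) x).symm z = y :=
    ⟨_, (extChartAt (𝓡 2) x).map_source hy, (extChartAt (𝓡 2) x).left_inv hy⟩
  rw [(extChartAt (𝓡 2) x).right_inv hz, metricForm_chartGram, chartSymmDeriv_chartDeriv x hz,
    chartSymmDeriv_chartDeriv x hz]

lemma metricForm_chartGram_pos (x : M) {z : Plane} (hz : z ∈ (extChartAt (𝓡 2) x).target)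
    {u : Plane} (hu : u ≠ 0) : 0 < metricForm (chartGram x) z u u := by
  rw [metricForm_chartGram]
  refine real_inner_self_pos.2 fun h => hu ?_
  rw [← chartDeriv_chartSymmDeriv x hz u, h, map_zero]

lemma det_chartGram_ne_zero (x : M) {z : Plane} (hz : z ∈ (extChartAt (𝓡 2) x).target) :
    (chartGram x z).det ≠ 0 := by
  intro hdet
  obtain ⟨v, hv, hmul⟩ := Matrix.exists_mulVec_eq_zero_iff.2 hdet
  have hu : (WithLp.toLp 2 v : Plane) ≠ 0 := fun h => hv (by simpa using h)
  refine (metricForm_chartGram_pos x hz hu).ne' ?_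
  have h0 := congrFun hmul 0
  have h1 := congrFun hmul 1
  simp only [Matrix.mulVec, dotProduct, Fin.sum_univ_two, Pi.zero_apply] at h0 h1
  simp only [metricForm_apply, Fin.sum_univ_two]
  linear_combination v 0 * h0 + v 1 * h1

end Manifold

section Smooth

variable [IsManifold (𝓡 2) ∞ M]
  [IsContMDiffRiemannianBundle (𝓡 2) ∞ Plane (fun x : M => TangentSpace (𝓡 2) x)]

lemma isMetricOn_chartGram (x : M) : IsMetricOn (chartGram x) (extChartAt (𝓡 2) x).target where
  isOpen := isOpen_extChartAt_target x
  contDiffAt _ hz i j :=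
    ((contMDiffAt_coordVec x hz i).inner_bundle (contMDiffAt_coordVec x hz j)).contDiffAt
  symm z _ i j := real_inner_comm (coordVec x z j) (coordVec x z i)
  det_ne_zero _ hz := det_chartGram_ne_zero x hz

end Smooth

end Chart

/-! ### Geodesics -/

section ODE

variable {E : Type*} [NormedAddCommGroup E] [NormedSpace ℝ E]

lemma eventuallyEq_nhdsGE_of_hasDerivAt {V : E → E} {y₁ y₂ : ℝ → E} {a : ℝ}
    (hV : ContDiffAt ℝ 1 V (y₁ a)) (h₁ : ∀ᶠ t in 𝓝[≥] a, HasDerivAt y₁ (V (y₁ t)) t)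
    (h₂ : ∀ᶠ t in 𝓝[≥] a, HasDerivAt y₂ (V (y₂ t)) t) (h : y₁ a = y₂ a) :
    y₁ =ᶠ[𝓝[≥] a] y₂ := by
  obtain ⟨K, S, hS, hLip⟩ := hV.exists_lipschitzOnWith
  have hself {p : ℝ → Prop} (hp : ∀ᶠ t in 𝓝[≥] a, p t) : p a := hp.self_of_nhdsWithin self_mem_Ici
  have hS₁ : ∀ᶠ t in 𝓝[≥] a, y₁ t ∈ S :=
    nhdsWithin_le_nhds ((hself h₁).continuousAt.eventually_mem hS)
  have hS₂ : ∀ᶠ t in 𝓝[≥] a, y₂ t ∈ S :=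
    nhdsWithin_le_nhds ((hself h₂).continuousAt.eventually_mem (h ▸ hS))
  obtain ⟨b, hb, hsub⟩ :=
    mem_nhdsGE_iff_exists_Icc_subset.1 ((h₁.and hS₁).and (h₂.and hS₂))
  refine eventually_of_mem (Icc_mem_nhdsGE hb) (ODE_solution_unique_of_mem_Icc_right
    (v := fun _ => V) (s := fun _ => S) (K := K) (fun _ _ => hLip) ?_ ?_ ?_ ?_ ?_ ?_ h)
  · exact fun t ht => (hsub ht).1.1.continuousAt.continuousWithinAt
  · exact fun t ht => (hsub (Ico_subset_Icc_self ht)).1.1.hasDerivWithinAt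
  · exact fun t ht => (hsub (Ico_subset_Icc_self ht)).1.2
  · exact fun t ht => (hsub ht).2.1.continuousAt.continuousWithinAt
  · exact fun t ht => (hsub (Ico_subset_Icc_self ht)).2.1.hasDerivWithinAt
  · exact fun t ht => (hsub (Ico_subset_Icc_self ht)).2.2

lemma deriv_comp_affine (F : ℝ → E) (a b : ℝ) :
    deriv (fun τ => F (a * τ + b)) = fun τ => a • deriv F (a * τ + b) := by
  funext τ
  rw [deriv_comp_mul_left a (fun y => F (y + b)) τ, deriv_comp_add_const]

lemma deriv_eq_of_eventuallyEq_nhdsWithin {f₁ f₂ : ℝ → E} {s : Set ℝ} {t : ℝ}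
    (hs : UniqueDiffWithinAt ℝ s t) (h₁ : DifferentiableAt ℝ f₁ t) (h₂ : DifferentiableAt ℝ f₂ t)
    (h : f₁ =ᶠ[𝓝[s] t] f₂) (ht : t ∈ s) : deriv f₁ t = deriv f₂ t := by
  rw [← h₁.derivWithin hs, ← h₂.derivWithin hs]
  exact h.derivWithin_eq (h.self_of_nhdsWithin ht)

end ODE

section Velocity

variable {M : Type*} [MetricSpace M] [ChartedSpace Plane M]

lemma velocity_comp {E : Type*} [NormedAddCommGroup E] [NormedSpace ℝ E] {F : E → M} {u : ℝ → E}
    {u' : E} {t : ℝ} (hF : MDifferentiableAt 𝓘(ℝ, E) (𝓡 2) F (u t)) (hu : HasDerivAt u u' t) :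
    velocity (F ∘ u) t = pushforward F (u t) u' := by
  have h := mfderiv_comp t hF hu.differentiableAt.mdifferentiableAt
  rw [mfderiv_eq_fderiv] at h
  refine (congrArg (· (1 : ℝ)) h).trans (congrArg (pushforward F (u t)) ?_)
  exact hu.deriv

lemma lift_comp {σ : ℝ → M} {φ : ℝ → ℝ} {φ' t : ℝ} {p : M} {v : TangentSpace (𝓡 2) p}
    (hσ : MDifferentiableAt 𝓘(ℝ, ℝ) (𝓡 2) σ (φ t)) (hφ : HasDerivAt φ φ' t)
    (h : lift σ (φ t) = ⟨p, v⟩) : lift (σ ∘ φ) t = ⟨p, φ' • v⟩ := by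
  cases h
  refine congrArg (TotalSpace.mk _) ((velocity_comp hσ hφ).trans ?_)
  rw [← mul_one φ', ← smul_eq_mul, map_smul, smul_eq_mul, mul_one]
  rfl

/-- The coordinates of `lift σ t` in the chart around `x`. -/
def chartLift (x : M) (σ : ℝ → M) (t : ℝ) : Plane × Plane :=
  (extChartAt (𝓡 2) x (σ t), deriv (extChartAt (𝓡 2) x ∘ σ) t)

lemma contDiffAt_chart_comp {n : ℕ∞ω} [IsManifold (𝓡 2) n M] {E : Type*} [NormedAddCommGroup E]
    [NormedSpace ℝ E] {F : E → M} {z : E} (hF : ContMDiffAt 𝓘(ℝ, E) (𝓡 2) n F z) (x : M)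
    (hx : F z ∈ (chartAt Plane x).source) : ContDiffAt ℝ n (extChartAt (𝓡 2) x ∘ F) z :=
  ((contMDiffAt_extChartAt' hx).comp z hF).contDiffAt

variable [IsManifold (𝓡 2) 1 M]

lemma chartDeriv_velocity {σ : ℝ → M} {t : ℝ} (hσ : MDifferentiableAt 𝓘(ℝ, ℝ) (𝓡 2) σ t) (x : M)
    (hx : σ t ∈ (chartAt Plane x).source) :
    chartDeriv x (σ t) (velocity σ t) = deriv (extChartAt (𝓡 2) x ∘ σ) t :=
  chartDeriv_pushforward hσ x hx 1

lemma tangentBundle_ext {q₁ q₂ : TangentBundle (𝓡 2) M} (h : q₁.1 = q₂.1) (x : M)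
    (hx : q₁.1 ∈ (chartAt Plane x).source)
    (hd : chartDeriv x q₁.1 q₁.2 = chartDeriv x q₂.1 q₂.2) : q₁ = q₂ := by
  obtain ⟨p, u⟩ := q₁
  obtain ⟨p', v⟩ := q₂
  obtain rfl : p = p' := h
  exact congrArg _ (chartDeriv_injective x hx hd)

lemma lift_eq_iff {σ : ℝ → M} {t : ℝ} (hσ : MDifferentiableAt 𝓘(ℝ, ℝ) (𝓡 2) σ t)
    {q : TangentBundle (𝓡 2) M} (x : M) (hx : q.1 ∈ (chartAt Plane x).source) :
    lift σ t = q ↔ σ t = q.1 ∧ deriv (extChartAt (𝓡 2) x ∘ σ) t = chartDeriv x q.1 q.2 := by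
  constructor
  · rintro rfl
    exact ⟨rfl, (chartDeriv_velocity hσ x hx).symm⟩
  · rintro ⟨hpt, hd⟩
    have hx' : σ t ∈ (chartAt Plane x).source := hpt ▸ hx
    exact tangentBundle_ext hpt x hx' ((chartDeriv_velocity hσ x hx').trans hd)

lemma chartLift_eq_of_lift_eq {σ₁ σ₂ : ℝ → M} {t : ℝ}
    (hσ₁ : MDifferentiableAt 𝓘(ℝ, ℝ) (𝓡 2) σ₁ t) (hσ₂ : MDifferentiableAt 𝓘(ℝ, ℝ) (𝓡 2) σ₂ t)
    (h : lift σ₁ t = lift σ₂ t) (x : M) (hx : σ₂ t ∈ (chartAt Plane x).source) :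
    chartLift x σ₁ t = chartLift x σ₂ t := by
  obtain ⟨hpt, hd⟩ := (lift_eq_iff hσ₁ x hx).1 h
  exact Prod.ext (congrArg (extChartAt (𝓡 2) x) hpt) (hd.trans (chartDeriv_velocity hσ₂ x hx))

lemma lift_eq_of_eventuallyEq {σ₁ σ₂ : ℝ → M} {s : Set ℝ} {t : ℝ}
    (hs : UniqueDiffWithinAt ℝ s t) (hσ₁ : MDifferentiableAt 𝓘(ℝ, ℝ) (𝓡 2) σ₁ t)
    (hσ₂ : MDifferentiableAt 𝓘(ℝ, ℝ) (𝓡 2) σ₂ t) (h : σ₁ =ᶠ[𝓝[s] t] σ₂) (ht : t ∈ s) :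
    lift σ₁ t = lift σ₂ t := by
  have hpt : σ₁ t = σ₂ t := h.self_of_nhdsWithin ht
  have hx : σ₂ t ∈ (chartAt Plane (σ₂ t)).source := mem_chart_source Plane _
  have hdiff {σ : ℝ → M} (hσ : MDifferentiableAt 𝓘(ℝ, ℝ) (𝓡 2) σ t) (hσt : σ t = σ₂ t) :
      DifferentiableAt ℝ (extChartAt (𝓡 2) (σ₂ t) ∘ σ) t :=
    ((mdifferentiableAt_extChartAt (hσt ▸ hx)).comp t hσ).differentiableAt
  refine (lift_eq_iff hσ₁ (σ₂ t) hx).2 ⟨hpt, ?_⟩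
  rw [lift, chartDeriv_velocity hσ₂ _ hx]
  exact deriv_eq_of_eventuallyEq_nhdsWithin hs (hdiff hσ₁ hpt) (hdiff hσ₂ rfl)
    (h.fun_comp _) ht

end Velocity

section Geodesics

variable {M : Type*} [MetricSpace M] [ChartedSpace Plane M]
  [RiemannianBundle (fun x : M => TangentSpace (𝓡 2) x)] {σ : ℝ → M} {s s' : Set ℝ} {t : ℝ}

lemma covAccel_eq_covDeriv (x : M) (hσ : ContDiffAt ℝ 2 (extChartAt (𝓡 2) x ∘ σ) t) (k : Fin 2) :
    covAccel x σ t k = covDeriv (chartGram x) (extChartAt (𝓡 2) x ∘ σ) 1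
      (deriv (extChartAt (𝓡 2) x ∘ σ)) t k := by
  set c : ℝ → Plane := extChartAt (𝓡 2) x ∘ σ
  have hcoord : ∀ᶠ τ in 𝓝 t, ∀ i, deriv (fun τ => c τ i) τ = deriv c τ i := by
    filter_upwards [hσ.eventually (by simp)] with τ hτ i
    exact dirDeriv_apply (hτ.differentiableAt two_ne_zero) 1 i
  have hcoord' : deriv (deriv fun τ => c τ k) t = deriv (deriv c) t k := by
    rw [EventuallyEq.deriv_eq (hcoord.mono fun τ hτ => hτ k)]
    exact dirDeriv_apply (differentiableAt_dirDeriv hσ 1) 1 k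
  rw [covDeriv_apply, dirDeriv_one, dirDeriv_one, ← hcoord']
  simp only [← hcoord.self_of_nhds]
  rfl

lemma isGeodesicOn_iff [IsManifold (𝓡 2) 2 M] :
    IsGeodesicOn σ s ↔ ∀ t ∈ s, ContMDiffAt 𝓘(ℝ, ℝ) (𝓡 2) 2 σ t ∧
      ∀ x : M, σ t ∈ (chartAt Plane x).source →
        covDeriv (chartGram x) (extChartAt (𝓡 2) x ∘ σ) 1 (deriv (extChartAt (𝓡 2) x ∘ σ)) t
          = 0 := by
  refine forall₂_congr fun t _ => and_congr_right fun hσ => forall₂_congr fun x hx => ?_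
  simp only [covAccel_eq_covDeriv x (contDiffAt_chart_comp hσ x hx)]
  exact ⟨fun h => by ext k; exact h k, fun h k => by rw [h]; rfl⟩

lemma covAccel_affine (x : M) (σ : ℝ → M) (a b t : ℝ) (k : Fin 2) :
    covAccel x (fun τ => σ (a * τ + b)) t k = a ^ 2 * covAccel x σ (a * t + b) k := by
  simp only [covAccel, deriv_comp_affine (fun τ => extChartAt (𝓡 2) x (σ τ) _), smul_eq_mul,
    deriv_const_mul_field, deriv_comp_affine (deriv fun τ => extChartAt (𝓡 2) x (σ τ) _),
    Fin.sum_univ_two]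
  ring

lemma IsGeodesicOn.affine (h : IsGeodesicOn σ s) (a b : ℝ) (hs : ∀ t ∈ s', a * t + b ∈ s) :
    IsGeodesicOn (fun τ => σ (a * τ + b)) s' := by
  intro t ht
  obtain ⟨hσ, hacc⟩ := h _ (hs t ht)
  have haffine : ContMDiffAt 𝓘(ℝ, ℝ) 𝓘(ℝ, ℝ) 2 (fun τ : ℝ => a * τ + b) t :=
    ContDiffAt.contMDiffAt (by fun_prop)
  exact ⟨ContMDiffAt.comp t hσ haffine, fun x hx k => by
    rw [covAccel_affine, hacc x hx k, mul_zero]⟩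

lemma IsGeodesicOn.mono (h : IsGeodesicOn σ s) (hs : s' ⊆ s) : IsGeodesicOn σ s' :=
  fun t ht => h t (hs ht)

lemma IsGeodesicOn.mdifferentiableAt (h : IsGeodesicOn σ s) (ht : t ∈ s) :
    MDifferentiableAt 𝓘(ℝ, ℝ) (𝓡 2) σ t :=
  (h t ht).1.mdifferentiableAt two_ne_zero

/-- The geodesic equation in the chart around `x`, as a vector field on phase space. -/
def geodesicSpray (x : M) (y : Plane × Plane) : Plane × Plane :=
  (y.2, -christoffelForm (chartGram x) y.1 y.2 y.2)

lemma IsGeodesicOn.hasDerivAt_chartLift [IsManifold (𝓡 2) 2 M] (h : IsGeodesicOn σ s)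
    (ht : t ∈ s) {x : M} (hx : σ t ∈ (chartAt Plane x).source) :
    HasDerivAt (chartLift x σ) (geodesicSpray x (chartLift x σ t)) t := by
  obtain ⟨hσ, hgeo⟩ := isGeodesicOn_iff.1 h t ht
  have hc := contDiffAt_chart_comp hσ x hx
  have hc' : HasDerivAt (deriv (extChartAt (𝓡 2) x ∘ σ))
      (deriv (deriv (extChartAt (𝓡 2) x ∘ σ)) t) t := (differentiableAt_dirDeriv hc 1).hasDerivAt
  rw [show deriv (deriv (extChartAt (𝓡 2) x ∘ σ)) t = _ from
    eq_neg_of_add_eq_zero_left (hgeo x hx)] at hc'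
  exact (hc.differentiableAt two_ne_zero).hasDerivAt.prodMk hc'

section Smooth

variable [IsManifold (𝓡 2) ∞ M]
  [IsContMDiffRiemannianBundle (𝓡 2) ∞ Plane (fun x : M => TangentSpace (𝓡 2) x)]

lemma contDiffAt_geodesicSpray (x : M) {y : Plane × Plane}
    (hy : y.1 ∈ (extChartAt (𝓡 2) x).target) : ContDiffAt ℝ ∞ (geodesicSpray x) y :=
  contDiffAt_snd.prodMk ((isMetricOn_chartGram x).contDiffAt_christoffelForm hy contDiffAt_fst
    contDiffAt_snd contDiffAt_snd).neg

variable {σ₁ σ₂ : ℝ → M}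

lemma IsGeodesicOn.eventuallyEq_nhdsGE {a b : ℝ} (hab : a < b) (h₁ : IsGeodesicOn σ₁ (Icc a b))
    (h₂ : IsGeodesicOn σ₂ (Icc a b)) (h : lift σ₁ a = lift σ₂ a) : σ₁ =ᶠ[𝓝[≥] a] σ₂ := by
  have ha : a ∈ Icc a b := left_mem_Icc.2 hab.le
  have hpt : σ₁ a = σ₂ a := congrArg TotalSpace.proj h
  set x := σ₂ a
  have hsource {σ : ℝ → M} (hσ : IsGeodesicOn σ (Icc a b)) (hσa : σ a = x) :
      ∀ᶠ t in 𝓝[≥] a, σ t ∈ (chartAt Plane x).source :=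
    nhdsWithin_le_nhds ((hσ a ha).1.continuousAt.eventually_mem
      ((chartAt Plane x).open_source.mem_nhds (hσa ▸ mem_chart_source Plane x)))
  have hode {σ : ℝ → M} (hσ : IsGeodesicOn σ (Icc a b)) (hσa : σ a = x) :
      ∀ᶠ t in 𝓝[≥] a, HasDerivAt (chartLift x σ) (geodesicSpray x (chartLift x σ t)) t := by
    filter_upwards [hsource hσ hσa, Icc_mem_nhdsGE hab] with t htx ht
    exact hσ.hasDerivAt_chartLift ht htx
  have hV : ContDiffAt ℝ 1 (geodesicSpray x) (chartLift x σ₁ a) :=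
    (contDiffAt_geodesicSpray x (by simp [chartLift, hpt])).of_le ENat.LEInfty.out
  have hlift := eventuallyEq_nhdsGE_of_hasDerivAt hV (hode h₁ hpt) (hode h₂ rfl)
    (chartLift_eq_of_lift_eq (h₁.mdifferentiableAt ha) (h₂.mdifferentiableAt ha) h x
      (mem_chart_source Plane x))
  filter_upwards [hlift, hsource h₁ hpt, hsource h₂ rfl] with t ht ht₁ ht₂
  rw [← extChartAt_source (𝓡 2)] at ht₁ ht₂
  exact (extChartAt (𝓡 2) x).injOn ht₁ ht₂ (congrArg Prod.fst ht)

lemma IsGeodesicOn.eqOn_of_lift_eq {a b : ℝ} (h₁ : IsGeodesicOn σ₁ (Icc a b))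
    (h₂ : IsGeodesicOn σ₂ (Icc a b)) (h : lift σ₁ a = lift σ₂ a) : EqOn σ₁ σ₂ (Icc a b) := by
  have hcont {σ : ℝ → M} (hσ : IsGeodesicOn σ (Icc a b)) : ContinuousOn σ (Icc a b) :=
    fun t ht => (hσ t ht).1.continuousAt.continuousWithinAt
  have hclosed : IsClosed ({t | σ₁ t = σ₂ t} ∩ Icc a b) := by
    rw [inter_comm]
    exact ((hcont h₁).prodMk (hcont h₂)).preimage_isClosed_of_isClosed isClosed_Icc
      isClosed_diagonal
  refine hclosed.Icc_subset_of_forall_mem_nhdsGT_of_Icc_subset (congrArg TotalSpace.proj h) ?_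
  intro t ht heq
  have htab : t ∈ Icc a b := Ico_subset_Icc_self ht
  have hlift : lift σ₁ t = lift σ₂ t := by
    rcases ht.1.eq_or_lt with rfl | hat
    · exact h
    · exact lift_eq_of_eventuallyEq (uniqueDiffOn_Icc hat t (right_mem_Icc.2 hat.le))
        (h₁.mdifferentiableAt htab) (h₂.mdifferentiableAt htab)
        (eventuallyEq_nhdsWithin_of_eqOn heq) (right_mem_Icc.2 hat.le)
  exact nhdsWithin_mono t Ioi_subset_Ici_self (IsGeodesicOn.eventuallyEq_nhdsGE ht.2
    (h₁.mono (Icc_subset_Icc_left ht.1)) (h₂.mono (Icc_subset_Icc_left ht.1)) hlift)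

lemma expMap_eq {p : M} {v : TangentSpace (𝓡 2) p} (hσ : IsGeodesicOn σ (Icc 0 1))
    (h : lift σ 0 = ⟨p, v⟩) : expMap p v = σ 1 := by
  have hE : HasExp p v := ⟨σ, hσ, h⟩
  rw [expMap, dif_pos hE]
  exact hE.choose_spec.1.eqOn_of_lift_eq hσ (hE.choose_spec.2.trans h.symm)
    (right_mem_Icc.2 zero_le_one)

lemma expMap_smul {T : ℝ} {p : M} {v : TangentSpace (𝓡 2) p} (hσ : IsGeodesicOn σ (Icc 0 T))
    (h : lift σ 0 = ⟨p, v⟩) (ht : t ∈ Icc 0 T) : expMap p (t • v) = σ t := by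
  have hmem : ∀ τ ∈ Icc (0 : ℝ) 1, t * τ + 0 ∈ Icc 0 T := fun τ hτ => by
    rw [add_zero]
    exact ⟨mul_nonneg ht.1 hτ.1, (mul_le_of_le_one_right ht.1 hτ.2).trans ht.2⟩
  have hlift : lift (fun τ => σ (t * τ + 0)) 0 = ⟨p, t • v⟩ := by
    have h0 : t * 0 + 0 = 0 := by ring
    rw [← h0] at h
    exact lift_comp (φ := fun τ => t * τ + 0) (t := 0)
      (hσ.mdifferentiableAt (hmem 0 (left_mem_Icc.2 zero_le_one)))
      (((hasDerivAt_id' 0).const_mul t).add_const 0 |>.congr_deriv (mul_one t)) h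
  rw [expMap_eq (hσ.affine t 0 hmem) hlift, mul_one, add_zero]

end Smooth

end Geodesics

/-! ### Normal charts and the Gauss lemma -/

section Slices

variable {G : Type*} [NormedAddCommGroup G] [NormedSpace ℝ G] {P : ℝ × ℝ → G} {t τ : ℝ}

lemma hasDerivAt_slice_fst (hP : DifferentiableAt ℝ P (t, τ)) :
    HasDerivAt (fun s => P (s, τ)) (dirDeriv (1, 0) P (t, τ)) t :=
  hP.hasFDerivAt.comp_hasDerivAt (f := fun s : ℝ => (s, τ)) t
    ((hasDerivAt_id t).prodMk (hasDerivAt_const t τ))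

lemma hasDerivAt_slice_snd (hP : DifferentiableAt ℝ P (t, τ)) :
    HasDerivAt (fun s => P (t, s)) (dirDeriv (0, 1) P (t, τ)) τ :=
  hP.hasFDerivAt.comp_hasDerivAt (f := fun s : ℝ => (t, s)) τ
    ((hasDerivAt_const τ t).prodMk (hasDerivAt_id τ))

lemma deriv_slice_eventuallyEq (hP : ContDiffAt ℝ 1 P (t, τ)) :
    deriv (fun s => P (s, τ)) =ᶠ[𝓝 t] fun s => dirDeriv (1, 0) P (s, τ) := by
  have hline : ContinuousAt (fun s : ℝ => (s, τ)) t := by fun_prop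
  filter_upwards [hline.eventually (hP.eventually (by simp))] with s hs
    using (hasDerivAt_slice_fst (hs.differentiableAt one_ne_zero)).deriv

lemma eq_add_of_hasDerivAt_const {T : ℝ} {N : ℝ → ℝ} {c : ℝ} (hT : 0 ≤ T)
    (hN : ∀ t ∈ Icc 0 T, HasDerivAt N c t) : N T = N 0 + T * c := by
  have h := intervalIntegral.integral_eq_sub_of_hasDerivAt (f := N) (f' := fun _ => c)
    (by rwa [uIcc_of_le hT]) intervalIntegrable_const
  simp only [intervalIntegral.integral_const, sub_zero, smul_eq_mul] at h
  linarith

lemma covDeriv_slice {g : Plane → Matrix (Fin 2) (Fin 2) ℝ} {f : ℝ × ℝ → Plane}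
    (hf : ContDiffAt ℝ 2 f (t, τ)) :
    covDeriv g (fun s => f (s, τ)) 1 (deriv fun s => f (s, τ)) t =
      covDeriv g f (1, 0) (dirDeriv (1, 0) f) (t, τ) := by
  have hslice : HasDerivAt (fun s : ℝ => (s, τ)) ((1 : ℝ), (0 : ℝ)) t :=
    (hasDerivAt_id t).prodMk (hasDerivAt_const t τ)
  rw [covDeriv_congr (deriv_slice_eventuallyEq (hf.of_le one_le_two)),
    covDeriv_comp (P := fun s => (s, τ)) (hf.differentiableAt two_ne_zero)
      (differentiableAt_dirDeriv hf _) hslice.differentiableAt, dirDeriv_one, hslice.deriv]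

end Slices

section Rays

variable {V : Type*} [NormedAddCommGroup V] [NormedSpace ℝ V] {δ t T : ℝ} {u : V}

lemma smul_mem_ball_of_mem_Icc (hT : T • u ∈ Metric.ball (0 : V) δ) (ht : t ∈ Icc 0 T) :
    t • u ∈ Metric.ball (0 : V) δ := by
  rw [mem_ball_zero_iff, norm_smul] at hT ⊢
  refine lt_of_le_of_lt ?_ hT
  gcongr
  rw [Real.norm_of_nonneg ht.1, Real.norm_of_nonneg (ht.1.trans ht.2)]
  exact ht.2

lemma exists_gt_smul_mem_ball (h : t • u ∈ Metric.ball (0 : V) δ) :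
    ∃ T > t, T • u ∈ Metric.ball (0 : V) δ := by
  have hcont : Continuous fun T : ℝ => T • u := by fun_prop
  have hev : ∀ᶠ T in 𝓝[>] t, T • u ∈ Metric.ball (0 : V) δ :=
    (hcont.continuousAt.eventually_mem (Metric.isOpen_ball.mem_nhds h)).filter_mono
      nhdsWithin_le_nhds
  obtain ⟨T, hT, hgt⟩ := (hev.and self_mem_nhdsWithin).exists
  exact ⟨T, hgt, hT⟩

/-- The two-parameter family `(t, τ) ↦ t ν(τ)` of rays through a curve `ν` of vectors. -/
def rayFamily (ν : ℝ → V) (z : ℝ × ℝ) : V := z.1 • ν z.2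

variable {ν : ℝ → V} {z : ℝ × ℝ}

lemma contDiffAt_rayFamily {n : ℕ∞ω} (hν : ContDiffAt ℝ n ν z.2) :
    ContDiffAt ℝ n (rayFamily ν) z :=
  contDiffAt_fst.smul (hν.comp z contDiffAt_snd)

lemma dirDeriv_rayFamily (hν : DifferentiableAt ℝ ν z.2) (a b : ℝ) :
    dirDeriv (a, b) (rayFamily ν) z = a • ν z.2 + (z.1 * b) • deriv ν z.2 := by
  have h := (hasFDerivAt_fst (𝕜 := ℝ) (E := ℝ) (F := ℝ) (p := z)).smul
    (hν.hasFDerivAt.comp z (hasFDerivAt_snd (𝕜 := ℝ) (E := ℝ) (F := ℝ)))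
  refine (congrArg (fun L => L (a, b)) h.fderiv).trans ?_
  simp [add_comm, smul_smul]

lemma dirDeriv_fst_rayFamily (hν : DifferentiableAt ℝ ν z.2) :
    dirDeriv (1, 0) (rayFamily ν) z = ν z.2 := by
  simp [dirDeriv_rayFamily hν]

lemma dirDeriv_snd_rayFamily (hν : DifferentiableAt ℝ ν z.2) :
    dirDeriv (0, 1) (rayFamily ν) z = z.1 • deriv ν z.2 := by
  simp [dirDeriv_rayFamily hν]

end Rays

section NormalChart

variable {M : Type*} [MetricSpace M] [ChartedSpace Plane M]
  [RiemannianBundle (fun x : M => TangentSpace (𝓡 2) x)]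
  {V : Type*} [NormedAddCommGroup V] [InnerProductSpace ℝ V]

/-- The Riemannian metric, pulled back by the parametrization `e`, at the point `w`. -/
def pullbackMetric (e : V → M) (w : V) : LinearMap.BilinForm ℝ V :=
  (innerₗ (TangentSpace (𝓡 2) (e w))).compl₁₂ (pushforward e w).toLinearMap
    (pushforward e w).toLinearMap

lemma pullbackMetric_apply (e : V → M) (w a b : V) :
    pullbackMetric e w a b = inner ℝ (pushforward e w a) (pushforward e w b) := rfl

/-- Normal coordinates: `e` is a smooth parametrization of an open subset of the surface by the ball
of radius `δ`, which maps rays to geodesics and preserves the length of vectors at the origin. The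
model vector space `V` is arbitrary, in order that `e` may be defined on a tangent plane. -/
structure IsNormalChart (e : OpenPartialHomeomorph V M) (δ : ℝ) : Prop where
  source : e.source = Metric.ball 0 δ
  contMDiffOn : ContMDiffOn 𝓘(ℝ, V) (𝓡 2) ∞ e e.source
  contMDiffOn_symm : ContMDiffOn (𝓡 2) 𝓘(ℝ, V) ∞ e.symm e.target
  geodesic : ∀ w ∈ Metric.ball (0 : V) δ, IsGeodesicOn (fun t : ℝ => e (t • w)) (Icc 0 1)
  norm_velocity_zero : ∀ w ∈ Metric.ball (0 : V) δ,
    ‖velocity (fun t : ℝ => e (t • w)) 0‖ = ‖w‖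

namespace IsNormalChart

variable {e : OpenPartialHomeomorph V M} {δ : ℝ} (he : IsNormalChart e δ)
include he

lemma contMDiffAt {w : V} (hw : w ∈ Metric.ball (0 : V) δ) :
    ContMDiffAt 𝓘(ℝ, V) (𝓡 2) ∞ e w :=
  he.contMDiffOn.contMDiffAt (e.open_source.mem_nhds (by rwa [he.source]))

lemma mdifferentiableAt {w : V} (hw : w ∈ Metric.ball (0 : V) δ) :
    MDifferentiableAt 𝓘(ℝ, V) (𝓡 2) e w :=
  (he.contMDiffAt hw).mdifferentiableAt (by simp)

lemma lift_ray {u : V} {t : ℝ} (hz : t • u ∈ Metric.ball (0 : V) δ) :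
    lift (fun s : ℝ => e (s • u)) t = ⟨e (t • u), pushforward e (t • u) u⟩ := by
  have hline : HasDerivAt (fun s : ℝ => s • u) u t := by
    simpa using (hasDerivAt_id t).smul_const u
  exact congrArg (TotalSpace.mk _)
    (velocity_comp (u := fun s : ℝ => s • u) (he.mdifferentiableAt hz) hline)

lemma contDiffAt_symm_comp {n : ℕ∞ω} (hn : n ≤ ∞) {γ : ℝ → M} {t : ℝ}
    (hγ : ContMDiffAt 𝓘(ℝ, ℝ) (𝓡 2) n γ t) (ht : γ t ∈ e.target) :
    ContDiffAt ℝ n (e.symm ∘ γ) t :=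
  (((he.contMDiffOn_symm.contMDiffAt (e.open_target.mem_nhds ht)).of_le hn).comp t hγ).contDiffAt

lemma symm_mem_ball {y : M} (hy : y ∈ e.target) : e.symm y ∈ Metric.ball (0 : V) δ :=
  he.source ▸ e.map_target hy

lemma geodesic_ray (u : V) :
    IsGeodesicOn (fun t : ℝ => e (t • u)) {t | 0 ≤ t ∧ t • u ∈ Metric.ball (0 : V) δ} := by
  rintro t ⟨ht0, ht⟩
  obtain ⟨T, htT, hT⟩ := exists_gt_smul_mem_ball ht
  have hT0 : 0 < T := ht0.trans_lt htT
  have h := (he.geodesic _ hT).affine (s' := {t}) T⁻¹ 0 (by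
    rintro s rfl
    rw [add_zero]
    exact ⟨by positivity, inv_mul_le_one_of_le₀ htT.le hT0.le⟩)
  simp only [add_zero, smul_smul, mul_right_comm, inv_mul_cancel₀ hT0.ne', one_mul] at h
  exact h t rfl

lemma pullbackMetric_zero (hδ : 0 < δ) (u : V) : pullbackMetric e 0 u u = ‖u‖ ^ 2 := by
  have hball : ∀ w ∈ Metric.ball (0 : V) δ, pullbackMetric e 0 w w = ‖w‖ ^ 2 := by
    intro w hw
    have hvel : velocity (fun t : ℝ => e (t • w)) 0 = pushforward e ((0 : ℝ) • w) w :=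
      velocity_comp (u := fun t : ℝ => t • w) (he.mdifferentiableAt (by simpa using hδ))
        (by simpa using (hasDerivAt_id (0 : ℝ)).smul_const w)
    rw [← he.norm_velocity_zero w hw, hvel, ← real_inner_self_eq_norm_sq, ← pullbackMetric_apply,
      zero_smul]
  obtain ⟨r, hr, hru⟩ := exists_gt_smul_mem_ball (t := 0) (u := u) (by simpa using hδ)
  have h := hball _ hru
  rw [map_smul, LinearMap.map_smul₂, smul_eq_mul, smul_eq_mul, norm_smul,
    Real.norm_of_nonneg hr.le, mul_pow, ← mul_assoc, ← sq] at h
  exact mul_left_cancel₀ (pow_ne_zero 2 hr.ne') h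

lemma eventually_mem {E : Type*} [TopologicalSpace E] {F : E → V} {z : E} (hF : ContinuousAt F z)
    (hz : F z ∈ Metric.ball (0 : V) δ) {x : M} (hx : e (F z) ∈ (chartAt Plane x).source) :
    ∀ᶠ y in 𝓝 z, F y ∈ Metric.ball (0 : V) δ ∧ e (F y) ∈ (chartAt Plane x).source :=
  (hF.eventually_mem (Metric.isOpen_ball.mem_nhds hz)).and
    ((ContinuousAt.comp (he.contMDiffAt hz).continuousAt hF).eventually_mem
      ((chartAt Plane x).open_source.mem_nhds hx))

section Families

variable {E : Type*} [NormedAddCommGroup E] [NormedSpace ℝ E] {F : E → V} {z : E}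

variable [IsManifold (𝓡 2) ∞ M]

lemma contDiffAt_family (hF : ContDiffAt ℝ ∞ F z) (hz : F z ∈ Metric.ball (0 : V) δ) {x : M}
    (hx : e (F z) ∈ (chartAt Plane x).source) :
    ContDiffAt ℝ ∞ (extChartAt (𝓡 2) x ∘ e ∘ F) z :=
  contDiffAt_chart_comp ((he.contMDiffAt hz).comp z hF.contMDiffAt) x hx

lemma dirDeriv_family (hF : DifferentiableAt ℝ F z) (hz : F z ∈ Metric.ball (0 : V) δ) {x : M}
    (hx : e (F z) ∈ (chartAt Plane x).source) (v : E) :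
    dirDeriv v (extChartAt (𝓡 2) x ∘ e ∘ F) z =
      chartDeriv x (e (F z)) (pushforward e (F z) (dirDeriv v F z)) := by
  have hdiff := (contDiffAt_chart_comp (he.contMDiffAt hz) x hx).differentiableAt (by simp)
  rw [chartDeriv_pushforward (he.mdifferentiableAt hz) x hx]
  exact dirDeriv_comp hdiff hF v

lemma pullbackMetric_eq_metricForm (hF : DifferentiableAt ℝ F z)
    (hz : F z ∈ Metric.ball (0 : V) δ) {x : M} (hx : e (F z) ∈ (chartAt Plane x).source) (v w : E) :
    pullbackMetric e (F z) (dirDeriv v F z) (dirDeriv w F z) =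
      metricForm (chartGram x) (extChartAt (𝓡 2) x (e (F z)))
        (dirDeriv v (extChartAt (𝓡 2) x ∘ e ∘ F) z)
        (dirDeriv w (extChartAt (𝓡 2) x ∘ e ∘ F) z) := by
  rw [he.dirDeriv_family hF hz hx, he.dirDeriv_family hF hz hx, pullbackMetric_apply,
    ← inner_eq_metricForm x hx]

lemma pullbackMetric_eventuallyEq (hF : ContDiffAt ℝ ∞ F z) (hz : F z ∈ Metric.ball (0 : V) δ)
    {x : M} (hx : e (F z) ∈ (chartAt Plane x).source) (v w : E) :
    (fun y => pullbackMetric e (F y) (dirDeriv v F y) (dirDeriv w F y)) =ᶠ[𝓝 z]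
      fun y => metricForm (chartGram x) ((extChartAt (𝓡 2) x ∘ e ∘ F) y)
        (dirDeriv v (extChartAt (𝓡 2) x ∘ e ∘ F) y)
        (dirDeriv w (extChartAt (𝓡 2) x ∘ e ∘ F) y) := by
  have hF₁ : ContDiffAt ℝ 1 F z := hF.of_le ENat.LEInfty.out
  filter_upwards [hF₁.eventually (by simp), he.eventually_mem hF.continuousAt hz hx] with y hy hmem
    using he.pullbackMetric_eq_metricForm (hy.differentiableAt one_ne_zero) hmem.1 hmem.2 v w

variable [IsContMDiffRiemannianBundle (𝓡 2) ∞ Plane (fun x : M => TangentSpace (𝓡 2) x)]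

lemma contDiffAt_pullbackMetric (hF : ContDiffAt ℝ ∞ F z) (hz : F z ∈ Metric.ball (0 : V) δ)
    (v w : E) :
    ContDiffAt ℝ ∞ (fun y => pullbackMetric e (F y) (dirDeriv v F y) (dirDeriv w F y)) z := by
  have hx : e (F z) ∈ (chartAt Plane (e (F z))).source := mem_chart_source Plane _
  have hf := he.contDiffAt_family hF hz hx
  exact ((isMetricOn_chartGram _).contDiffAt_metricForm
    (f := extChartAt (𝓡 2) (e (F z)) ∘ e ∘ F) (mem_extChartAt_target (e (F z))) hf
    (contDiffAt_dirDeriv hf v) (contDiffAt_dirDeriv hf w)).congr_of_eventuallyEq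
    (he.pullbackMetric_eventuallyEq hF hz hx v w)

end Families

variable [IsManifold (𝓡 2) ∞ M]

lemma covDeriv_rayFamily {ν : ℝ → V} {t τ : ℝ} (ht : 0 ≤ t) (hν : ContDiffAt ℝ ∞ ν τ)
    (hz : t • ν τ ∈ Metric.ball (0 : V) δ) {x : M} (hx : e (t • ν τ) ∈ (chartAt Plane x).source) :
    covDeriv (chartGram x) (extChartAt (𝓡 2) x ∘ e ∘ rayFamily ν) (1, 0)
      (dirDeriv (1, 0) (extChartAt (𝓡 2) x ∘ e ∘ rayFamily ν)) (t, τ) = 0 := by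
  have hf : ContDiffAt ℝ ∞ (extChartAt (𝓡 2) x ∘ e ∘ rayFamily ν) (t, τ) :=
    he.contDiffAt_family (z := (t, τ)) (contDiffAt_rayFamily hν) hz hx
  rw [← covDeriv_slice (hf.of_le ENat.LEInfty.out)]
  exact (isGeodesicOn_iff.1 (he.geodesic_ray (ν τ)) t ⟨ht, hz⟩).2 x hx

variable [IsContMDiffRiemannianBundle (𝓡 2) ∞ Plane (fun x : M => TangentSpace (𝓡 2) x)]

lemma dirDeriv_pullbackMetric_rayFamily {ν : ℝ → V} {t τ : ℝ} (ht : 0 ≤ t)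
    (hν : ContDiffAt ℝ ∞ ν τ) (hz : t • ν τ ∈ Metric.ball (0 : V) δ) (a : ℝ × ℝ) :
    2 * dirDeriv (1, 0) (fun z => pullbackMetric e (rayFamily ν z) (dirDeriv (1, 0) (rayFamily ν) z)
        (dirDeriv a (rayFamily ν) z)) (t, τ) =
      dirDeriv a (fun z => pullbackMetric e (rayFamily ν z) (dirDeriv (1, 0) (rayFamily ν) z)
        (dirDeriv (1, 0) (rayFamily ν) z)) (t, τ) := by
  have hF : ContDiffAt ℝ ∞ (rayFamily ν) (t, τ) := contDiffAt_rayFamily hν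
  have hx : e (t • ν τ) ∈ (chartAt Plane (e (t • ν τ))).source := mem_chart_source Plane _
  rw [dirDeriv_congr (he.pullbackMetric_eventuallyEq hF hz hx _ _),
    dirDeriv_congr (he.pullbackMetric_eventuallyEq hF hz hx _ _)]
  exact (isMetricOn_chartGram _).dirDeriv_metricForm_of_geodesic
    (mem_extChartAt_target (e (t • ν τ)))
    ((he.contDiffAt_family hF hz hx).of_le ENat.LEInfty.out) (he.covDeriv_rayFamily ht hν hz hx)

lemma pullbackMetric_ray_self {u : V} {t : ℝ} (ht : 0 ≤ t)
    (hz : t • u ∈ Metric.ball (0 : V) δ) : pullbackMetric e (t • u) u u = ‖u‖ ^ 2 := by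
  have hδ : 0 < δ := (norm_nonneg _).trans_lt (mem_ball_zero_iff.1 hz)
  have hfst : dirDeriv (1, 0) (rayFamily fun _ => u) = fun _ => u :=
    funext fun z => dirDeriv_fst_rayFamily (differentiableAt_const u)
  have hderiv : ∀ s ∈ Icc 0 t, HasDerivAt (fun s => pullbackMetric e (s • u) u u) 0 s := by
    intro s hs
    have hsu := smul_mem_ball_of_mem_Icc hz hs
    have hmixed := he.dirDeriv_pullbackMetric_rayFamily (τ := 0) hs.1 contDiffAt_const hsu (1, 0)
    have hslice := hasDerivAt_slice_fst ((he.contDiffAt_pullbackMetric (z := (s, 0))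
      (contDiffAt_rayFamily contDiffAt_const) hsu (1, 0) (1, 0)).differentiableAt (by simp))
    rw [two_mul, add_eq_left] at hmixed
    rw [hmixed] at hslice
    simp only [hfst] at hslice
    exact hslice
  have h := eq_add_of_hasDerivAt_const ht hderiv
  rwa [zero_smul, he.pullbackMetric_zero hδ, mul_zero, add_zero] at h

lemma hasDerivAt_pullbackMetric_ray {ν : ℝ → V} (hν : ContDiff ℝ ∞ ν) {s τ : ℝ} (hs : 0 ≤ s)
    (hz : s • ν τ ∈ Metric.ball (0 : V) δ) :
    HasDerivAt (fun s => pullbackMetric e (s • ν τ) (ν τ) (s • deriv ν τ))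
      (inner ℝ (ν τ) (deriv ν τ)) s := by
  have hνd : Differentiable ℝ ν := hν.differentiable (by simp)
  have hfst : dirDeriv (1, 0) (rayFamily ν) = fun z => ν z.2 :=
    funext fun z => dirDeriv_fst_rayFamily hνd.differentiableAt
  have hsnd : dirDeriv (0, 1) (rayFamily ν) = fun z => z.1 • deriv ν z.2 :=
    funext fun z => dirDeriv_snd_rayFamily hνd.differentiableAt
  have hdiff (a b : ℝ × ℝ) := (he.contDiffAt_pullbackMetric (z := (s, τ))
    (contDiffAt_rayFamily hν.contDiffAt) hz a b).differentiableAt (by simp)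
  have hspeed : (fun τ => pullbackMetric e (s • ν τ) (ν τ) (ν τ)) =ᶠ[𝓝 τ] fun τ => ‖ν τ‖ ^ 2 := by
    have hcont : Continuous fun τ => s • ν τ := hν.continuous.const_smul s
    filter_upwards [hcont.continuousAt.eventually_mem (Metric.isOpen_ball.mem_nhds hz)] with τ hτ
      using he.pullbackMetric_ray_self hs hτ
  have hmixed := he.dirDeriv_pullbackMetric_rayFamily hs hν.contDiffAt hz (0, 1)
  have hslice₁ := hasDerivAt_slice_fst (hdiff (1, 0) (0, 1))
  have hslice₂ := hasDerivAt_slice_snd (hdiff (1, 0) (1, 0))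
  simp only [hfst, hsnd] at hmixed hslice₁ hslice₂
  rw [hslice₂.unique ((hνd τ).hasDerivAt.norm_sq.congr_of_eventuallyEq hspeed)] at hmixed
  rwa [mul_left_cancel₀ two_ne_zero hmixed] at hslice₁

/-- The Gauss lemma: `t ↦ ⟨F_t, F_τ⟩` along the rays `F(t, τ) = t (w + τ a)` vanishes at `t = 0`,
and has the derivative `½ ∂_τ |F_t|² = ⟨w, a⟩` because the rays are geodesics. -/
lemma gauss {w : V} (hw : w ∈ Metric.ball (0 : V) δ) (a : V) :
    pullbackMetric e w w a = inner ℝ w a := by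
  set ν : ℝ → V := fun τ => w + τ • a with hν
  have hderiv : deriv ν 0 = a := by simp [hν, deriv_smul_const]
  have hν0 : ν 0 = w := by simp [hν]
  have h := eq_add_of_hasDerivAt_const zero_le_one fun s hs =>
    he.hasDerivAt_pullbackMetric_ray (ν := ν) (τ := 0) (by fun_prop) hs.1
      (smul_mem_ball_of_mem_Icc (T := 1) (by rwa [hν0, one_smul]) hs)
  rw [hderiv, hν0] at h
  simpa only [one_smul, zero_smul, map_zero, one_mul, zero_add] using h

end IsNormalChart

end NormalChart

/-! ### Distances in a normal chart -/

section Congr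

variable {M : Type*} [MetricSpace M] [ChartedSpace Plane M] [IsManifold (𝓡 2) 2 M]
  [RiemannianBundle (fun x : M => TangentSpace (𝓡 2) x)]

lemma IsGeodesicOn.congr {σ₁ σ₂ : ℝ → M} {s : Set ℝ} (hs : UniqueDiffOn ℝ s)
    (h₁ : IsGeodesicOn σ₁ s) (h₂ : ∀ t ∈ s, ContMDiffAt 𝓘(ℝ, ℝ) (𝓡 2) 2 σ₂ t)
    (h : EqOn σ₁ σ₂ s) : IsGeodesicOn σ₂ s := by
  rw [isGeodesicOn_iff] at h₁ ⊢
  refine fun t ht => ⟨h₂ t ht, fun x hx => ?_⟩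
  obtain ⟨hσ₁, hgeo⟩ := h₁ t ht
  have hx₁ : σ₁ t ∈ (chartAt Plane x).source := h ht ▸ hx
  have hc₁ := contDiffAt_chart_comp hσ₁ x hx₁
  have hc₂ := contDiffAt_chart_comp (h₂ t ht) x hx
  have hderiv : deriv (extChartAt (𝓡 2) x ∘ σ₁) =ᶠ[𝓝[s] t] deriv (extChartAt (𝓡 2) x ∘ σ₂) := by
    filter_upwards [nhdsWithin_le_nhds (hc₁.eventually (by simp)),
      nhdsWithin_le_nhds (hc₂.eventually (by simp)), self_mem_nhdsWithin] with τ hτ₁ hτ₂ hτ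
    exact deriv_eq_of_eventuallyEq_nhdsWithin (hs τ hτ) (hτ₁.differentiableAt two_ne_zero)
      (hτ₂.differentiableAt two_ne_zero) ((eventuallyEq_nhdsWithin_of_eqOn h).fun_comp _) hτ
  have hderiv₂ : deriv (deriv (extChartAt (𝓡 2) x ∘ σ₁)) t =
      deriv (deriv (extChartAt (𝓡 2) x ∘ σ₂)) t :=
    deriv_eq_of_eventuallyEq_nhdsWithin (hs t ht) (differentiableAt_dirDeriv hc₁ 1)
      (differentiableAt_dirDeriv hc₂ 1) hderiv ht
  rw [← hgeo x hx₁, covDeriv, covDeriv, dirDeriv_one, dirDeriv_one, dirDeriv_one, dirDeriv_one,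
    hderiv₂, hderiv.self_of_nhdsWithin ht, Function.comp_apply, Function.comp_apply, h ht]

end Congr

section NormalRadius

variable {M : Type*} [MetricSpace M] [ChartedSpace Plane M] [IsManifold (𝓡 2) ∞ M]
  [RiemannianBundle (fun x : M => TangentSpace (𝓡 2) x)]
  [IsContMDiffRiemannianBundle (𝓡 2) ∞ Plane (fun x : M => TangentSpace (𝓡 2) x)]

lemma IsNormalRadius.exists_isNormalChart {p : M} {δ : ℝ} (h : IsNormalRadius p δ) :
    ∃ e : OpenPartialHomeomorph (TangentSpace (𝓡 2) p) M, IsNormalChart e δ ∧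
      EqOn e (expMap p) (Metric.ball 0 δ) ∧
      ∀ w ∈ Metric.ball (0 : TangentSpace (𝓡 2) p) δ,
        lift (fun t : ℝ => e (t • w)) 0 = ⟨p, w⟩ := by
  obtain ⟨hexp, e, hsrc, heq, hsm, hsm'⟩ := h
  have h01 : UniqueDiffOn ℝ (Icc (0 : ℝ) 1) := uniqueDiffOn_Icc zero_lt_one
  have h0 : (0 : ℝ) ∈ Icc (0 : ℝ) 1 := left_mem_Icc.2 zero_le_one
  have hray (w : TangentSpace (𝓡 2) p) (hw : w ∈ Metric.ball (0 : TangentSpace (𝓡 2) p) δ) :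
      IsGeodesicOn (fun t : ℝ => e (t • w)) (Icc 0 1) ∧
        lift (fun t : ℝ => e (t • w)) 0 = ⟨p, w⟩ := by
    have hmem : ∀ t ∈ Icc (0 : ℝ) 1, t • w ∈ e.source := fun t ht =>
      hsrc ▸ smul_mem_ball_of_mem_Icc (by rwa [one_smul]) ht
    have hC : ∀ t ∈ Icc (0 : ℝ) 1, ContMDiffAt 𝓘(ℝ, ℝ) (𝓡 2) 2 (fun t : ℝ => e (t • w)) t := by
      intro t ht
      have he := hsm.contMDiffAt (e.open_source.mem_nhds (hmem t ht))
      have hline : ContMDiffAt 𝓘(ℝ, ℝ) 𝓘(ℝ, TangentSpace (𝓡 2) p) 2 (fun s : ℝ => s • w) t :=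
        ContDiffAt.contMDiffAt (contDiffAt_id.smul contDiffAt_const)
      exact ContMDiffAt.comp t (he.of_le ENat.LEInfty.out) hline
    obtain ⟨σ, hσ, hlift⟩ := hexp w hw
    have hEq : EqOn σ (fun t : ℝ => e (t • w)) (Icc 0 1) := fun t ht =>
      (expMap_smul hσ hlift ht).symm.trans (heq (hmem t ht)).symm
    refine ⟨hσ.congr h01 hC hEq, Eq.trans ?_ hlift⟩
    exact (lift_eq_of_eventuallyEq (h01 0 h0) (hσ.mdifferentiableAt h0)
      ((hC 0 h0).mdifferentiableAt two_ne_zero) (eventuallyEq_nhdsWithin_of_eqOn hEq) h0).symm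
  exact ⟨e, ⟨hsrc, hsm, hsm', fun w hw => (hray w hw).1, fun w hw =>
    congrArg (fun q : TangentBundle (𝓡 2) M => ‖q.2‖) (hray w hw).2⟩, fun w hw => heq (hsrc ▸ hw),
    fun w hw => (hray w hw).2⟩

end NormalRadius

section RadialSpeed

variable {M : Type*} [MetricSpace M] [ChartedSpace Plane M] [IsManifold (𝓡 2) ∞ M]
  [RiemannianBundle (fun x : M => TangentSpace (𝓡 2) x)]
  {V : Type*} [NormedAddCommGroup V] [InnerProductSpace ℝ V]

lemma hasDerivAt_sqrt_add_norm_sq {u : ℝ → V} {u' : V} {ε t : ℝ} (hε : ε ≠ 0)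
    (hu : HasDerivAt u u' t) :
    HasDerivAt (fun s => √(ε ^ 2 + ‖u s‖ ^ 2)) (inner ℝ (u t) u' / √(ε ^ 2 + ‖u t‖ ^ 2)) t := by
  have hpos : 0 < ε ^ 2 + ‖u t‖ ^ 2 := by positivity
  convert (hu.norm_sq.const_add (ε ^ 2)).sqrt hpos.ne' using 1
  rw [mul_div_mul_left _ _ two_ne_zero]

namespace IsNormalChart

variable {e : OpenPartialHomeomorph V M} {δ : ℝ} (he : IsNormalChart e δ)
include he

lemma lift_eq_pushforward {γ : ℝ → M} {t : ℝ} (hγ : ContMDiffAt 𝓘(ℝ, ℝ) (𝓡 2) 1 γ t)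
    (ht : γ t ∈ e.target) :
    lift γ t = ⟨e (e.symm (γ t)), pushforward e (e.symm (γ t)) (deriv (e.symm ∘ γ) t)⟩ := by
  have hu : DifferentiableAt ℝ (e.symm ∘ γ) t :=
    (he.contDiffAt_symm_comp (by simp) hγ ht).differentiableAt one_ne_zero
  have hw := he.symm_mem_ball ht
  have hγd : MDifferentiableAt 𝓘(ℝ, ℝ) (𝓡 2) γ t := hγ.mdifferentiableAt one_ne_zero
  have hev : γ =ᶠ[𝓝 t] e ∘ e.symm ∘ γ := by
    filter_upwards [hγ.continuousAt.eventually_mem (e.open_target.mem_nhds ht)] with s hs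
    exact (e.right_inv hs).symm
  rw [lift_eq_of_eventuallyEq uniqueDiffWithinAt_univ hγd (hγd.congr_of_eventuallyEq hev.symm)
    (by rwa [nhdsWithin_univ]) (mem_univ t)]
  exact congrArg (TotalSpace.mk _)
    (velocity_comp (u := e.symm ∘ γ) (he.mdifferentiableAt hw) hu.hasDerivAt)

lemma norm_velocity {γ : ℝ → M} {t : ℝ} (hγ : ContMDiffAt 𝓘(ℝ, ℝ) (𝓡 2) 1 γ t)
    (ht : γ t ∈ e.target) :
    ‖velocity γ t‖ = ‖pushforward e (e.symm (γ t)) (deriv (e.symm ∘ γ) t)‖ :=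
  congrArg (fun q : TangentBundle (𝓡 2) M => ‖q.2‖) (he.lift_eq_pushforward hγ ht)

variable [IsContMDiffRiemannianBundle (𝓡 2) ∞ Plane (fun x : M => TangentSpace (𝓡 2) x)]

lemma norm_pushforward_ray {u : V} {t : ℝ} (ht : 0 ≤ t) (hz : t • u ∈ Metric.ball (0 : V) δ) :
    ‖pushforward e (t • u) u‖ = ‖u‖ := by
  have h := he.pullbackMetric_ray_self ht hz
  rw [pullbackMetric_apply, real_inner_self_eq_norm_sq] at h
  exact (sq_eq_sq₀ (norm_nonneg _) (norm_nonneg _)).1 h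

lemma norm_velocity_ray {u : V} {t : ℝ} (ht : 0 ≤ t) (hz : t • u ∈ Metric.ball (0 : V) δ) :
    ‖velocity (fun s : ℝ => e (s • u)) t‖ = ‖u‖ :=
  (congrArg (fun q : TangentBundle (𝓡 2) M => ‖q.2‖) (he.lift_ray hz)).trans
    (he.norm_pushforward_ray ht hz)

lemma abs_inner_le {w : V} (hw : w ∈ Metric.ball (0 : V) δ) (a : V) :
    |inner ℝ w a| ≤ ‖w‖ * ‖pushforward e w a‖ := by
  have h := he.norm_pushforward_ray (u := w) zero_le_one (by rwa [one_smul])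
  rw [one_smul] at h
  rw [← he.gauss hw a, ← h]
  exact abs_real_inner_le_norm (pushforward e w w) (pushforward e w a)

/- The radius is not differentiable at the centre of the chart, hence `ε`. -/
lemma sqrt_sub_sqrt_le_pathELength {γ : ℝ → M} (hγ : ContMDiff 𝓘(ℝ, ℝ) (𝓡 2) 1 γ) {T ε : ℝ}
    (hT : 0 ≤ T) (hε : ε ≠ 0) (hmem : ∀ t ∈ Icc 0 T, γ t ∈ e.target) :
    ENNReal.ofReal (√(ε ^ 2 + ‖e.symm (γ T)‖ ^ 2) - √(ε ^ 2 + ‖e.symm (γ 0)‖ ^ 2)) ≤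
      pathELength (𝓡 2) γ 0 T := by
  set u : ℝ → V := e.symm ∘ γ
  set m : ℝ → ℝ := fun t => √(ε ^ 2 + ‖u t‖ ^ 2)
  have hu : ∀ t ∈ Icc 0 T, ContDiffAt ℝ 1 u t := fun t ht =>
    he.contDiffAt_symm_comp (by simp) hγ.contMDiffAt (hmem t ht)
  have hpos (t : ℝ) : 0 < ε ^ 2 + ‖u t‖ ^ 2 := by positivity
  have hm : ContDiffOn ℝ 1 m (Icc 0 T) := fun t ht =>
    ((contDiffAt_const.add ((hu t ht).norm_sq ℝ)).sqrt (hpos t).ne').contDiffWithinAt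
  refine (Real.ofReal_le_enorm (m T - m 0)).trans
    ((enorm_sub_le_lintegral_deriv_of_contDiffOn_Icc hm hT).trans ?_)
  rw [pathELength_eq_lintegral_mfderiv_Icc]
  refine MeasureTheory.setLIntegral_mono' measurableSet_Icc fun t ht => ?_
  change ‖deriv m t‖ₑ ≤ ‖velocity γ t‖ₑ
  rw [← ofReal_norm, ← ofReal_norm]
  refine ENNReal.ofReal_le_ofReal ?_
  have hle : ‖u t‖ ≤ m t := Real.le_sqrt_of_sq_le (le_add_of_nonneg_left (sq_nonneg ε))
  calc ‖deriv m t‖ = |inner ℝ (u t) (deriv u t)| / m t := by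
        have hut := ((hu t ht).differentiableAt one_ne_zero).hasDerivAt
        rw [(hasDerivAt_sqrt_add_norm_sq hε hut).deriv, Real.norm_eq_abs, abs_div,
          abs_of_pos (Real.sqrt_pos.2 (hpos t))]
    _ ≤ ‖u t‖ * ‖velocity γ t‖ / m t := by
        rw [he.norm_velocity hγ.contMDiffAt (hmem t ht)]
        gcongr
        exact he.abs_inner_le (he.symm_mem_ball (hmem t ht)) _
    _ ≤ m t * ‖velocity γ t‖ / m t := by gcongr
    _ = ‖velocity γ t‖ := mul_div_cancel_left₀ _ (Real.sqrt_pos.2 (hpos t)).ne'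

lemma norm_sub_norm_le_pathELength {γ : ℝ → M} (hγ : ContMDiff 𝓘(ℝ, ℝ) (𝓡 2) 1 γ) {T : ℝ}
    (hT : 0 ≤ T) (hmem : ∀ t ∈ Icc 0 T, γ t ∈ e.target) :
    ENNReal.ofReal (‖e.symm (γ T)‖ - ‖e.symm (γ 0)‖) ≤ pathELength (𝓡 2) γ 0 T := by
  have hcont : Continuous fun ε : ℝ =>
      ENNReal.ofReal (√(ε ^ 2 + ‖e.symm (γ T)‖ ^ 2) - √(ε ^ 2 + ‖e.symm (γ 0)‖ ^ 2)) := by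
    refine ENNReal.continuous_ofReal.comp ?_
    fun_prop
  have hlim := (hcont.tendsto 0).mono_left (nhdsWithin_le_nhds (s := {0}ᶜ))
  simp only [ne_eq, OfNat.ofNat_ne_zero, not_false_eq_true, zero_pow, zero_add,
    Real.sqrt_sq (norm_nonneg _)] at hlim
  refine le_of_tendsto hlim ?_
  filter_upwards [self_mem_nhdsWithin] with ε hε
  exact he.sqrt_sub_sqrt_le_pathELength hγ hT hε hmem

end IsNormalChart

end RadialSpeed

section Distance

lemma exists_first_exit {X : Type*} [TopologicalSpace X] {γ : ℝ → X} (hγ : Continuous γ)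
    {O : Set X} (hO : IsOpen O) {a b : ℝ} (hab : a ≤ b) (ha : γ a ∈ O) (hb : γ b ∉ O) :
    ∃ T ∈ Ioc a b, γ T ∉ O ∧ ∀ t ∈ Ico a T, γ t ∈ O := by
  have hcompact : IsCompact (Icc a b ∩ γ ⁻¹' Oᶜ) :=
    isCompact_Icc.inter_right (hO.isClosed_compl.preimage hγ)
  obtain ⟨T, ⟨⟨haT, hTb⟩, hT⟩, hmin⟩ := hcompact.exists_isLeast ⟨b, right_mem_Icc.2 hab, hb⟩
  refine ⟨T, ⟨haT.lt_of_ne ?_, hTb⟩, hT, fun t ht => ?_⟩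
  · rintro rfl
    exact hT ha
  · by_contra hcon
    exact (hmin ⟨⟨ht.1, ht.2.le.trans hTb⟩, hcon⟩).not_gt ht.2

variable {M : Type*} [MetricSpace M] [ChartedSpace Plane M] [IsManifold (𝓡 2) ∞ M]
  [RiemannianBundle (fun x : M => TangentSpace (𝓡 2) x)]
  [IsContMDiffRiemannianBundle (𝓡 2) ∞ Plane (fun x : M => TangentSpace (𝓡 2) x)]
  {V : Type*} [NormedAddCommGroup V] [InnerProductSpace ℝ V]

namespace IsNormalChart

variable {e : OpenPartialHomeomorph V M} {δ : ℝ} (he : IsNormalChart e δ)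
include he

lemma riemannianEDist_le {w : V} (hw : w ∈ Metric.ball (0 : V) δ) :
    riemannianEDist (𝓡 2) (e 0) (e w) ≤ ENNReal.ofReal ‖w‖ := by
  have hray : ContMDiffOn 𝓘(ℝ, ℝ) (𝓡 2) 1 (fun t : ℝ => e (t • w)) (Icc 0 1) := fun t ht =>
    ((he.geodesic w hw t ht).1.of_le one_le_two).contMDiffWithinAt
  have hspeed : ∀ t ∈ Icc (0 : ℝ) 1,
      ‖mfderiv 𝓘(ℝ, ℝ) (𝓡 2) (fun t : ℝ => e (t • w)) t (1 : ℝ)‖ₑ = ENNReal.ofReal ‖w‖ := by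
    intro t ht
    rw [← he.norm_velocity_ray ht.1 (smul_mem_ball_of_mem_Icc (by rwa [one_smul]) ht), ofReal_norm]
    rfl
  refine (riemannianEDist_le_pathELength hray (by simp) (by simp) zero_le_one).trans ?_
  rw [pathELength_eq_lintegral_mfderiv_Icc]
  exact (MeasureTheory.setLIntegral_congr_fun measurableSet_Icc hspeed).le.trans (by simp)

variable [FiniteDimensional ℝ V]

lemma le_pathELength {w : V} (hw : w ∈ Metric.ball (0 : V) δ) {γ : ℝ → M}
    (hγ : ContMDiff 𝓘(ℝ, ℝ) (𝓡 2) 1 γ) (h0 : γ 0 = e 0) (h1 : γ 1 = e w) :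
    ENNReal.ofReal ‖w‖ ≤ pathELength (𝓡 2) γ 0 1 := by
  rcases eq_or_ne w 0 with rfl | hw0
  · simp
  have hclosed : Metric.closedBall (0 : V) ‖w‖ ⊆ e.source := by
    rw [he.source]
    exact Metric.closedBall_subset_ball (mem_ball_zero_iff.1 hw)
  have hball : Metric.ball (0 : V) ‖w‖ ⊆ e.source := Metric.ball_subset_closedBall.trans hclosed
  have h0w : (0 : V) ∈ Metric.ball (0 : V) ‖w‖ := Metric.mem_ball_self (norm_pos_iff.2 hw0)
  have hexit : γ 1 ∉ e '' Metric.ball (0 : V) ‖w‖ := by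
    rintro ⟨w', hw', heq⟩
    rw [h1] at heq
    rw [e.injOn (hball hw') (he.source ▸ hw) heq] at hw'
    exact lt_irrefl _ (mem_ball_zero_iff.1 hw')
  obtain ⟨T, ⟨hT0, hT1⟩, hT, hbefore⟩ := exists_first_exit hγ.continuous
    (e.isOpen_image_of_subset_source Metric.isOpen_ball hball) zero_le_one
    ⟨0, h0w, h0.symm⟩ hexit
  have hupTo : MapsTo γ (Icc 0 T) (e '' Metric.closedBall (0 : V) ‖w‖) := by
    have himage : IsClosed (e '' Metric.closedBall (0 : V) ‖w‖) :=
      ((isCompact_closedBall _ _).image_of_continuousOn (e.continuousOn.mono hclosed)).isClosed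
    rw [← closure_Ico hT0.ne, ← himage.closure_eq]
    exact MapsTo.closure (fun t ht => image_mono Metric.ball_subset_closedBall (hbefore t ht))
      hγ.continuous
  have hmem : ∀ t ∈ Icc 0 T, γ t ∈ e.target := fun t ht =>
    e.mapsTo.image_subset (image_mono hclosed (hupTo ht))
  have hnorm : ‖w‖ ≤ ‖e.symm (γ T)‖ := by
    by_contra! hlt
    exact hT ⟨e.symm (γ T), mem_ball_zero_iff.2 hlt, e.right_inv (hmem T (right_mem_Icc.2 hT0.le))⟩
  have hstart : e.symm (γ 0) = 0 := by rw [h0, e.left_inv (hball h0w)]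
  have hlen := he.norm_sub_norm_le_pathELength hγ hT0.le hmem
  rw [hstart, norm_zero, sub_zero] at hlen
  exact (ENNReal.ofReal_le_ofReal hnorm).trans (hlen.trans (pathELength_mono le_rfl hT1))

lemma dist_eq [IsRiemannianManifold (𝓡 2) M] {w : V} (hw : w ∈ Metric.ball (0 : V) δ) :
    dist (e 0) (e w) = ‖w‖ := by
  have h : riemannianEDist (𝓡 2) (e 0) (e w) = ENNReal.ofReal ‖w‖ := by
    refine (he.riemannianEDist_le hw).antisymm (le_of_not_gt fun hlt => ?_)
    obtain ⟨γ, hγ0, hγ1, hγ, hlen, -⟩ :=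
      exists_lt_locally_constant_of_riemannianEDist_lt hlt zero_lt_one
    exact hlen.not_ge (he.le_pathELength hw hγ hγ0 hγ1)
  rw [← IsRiemannianManifold.out (I := 𝓡 2), edist_dist] at h
  exact (ENNReal.ofReal_eq_ofReal_iff dist_nonneg (norm_nonneg _)).1 h

end IsNormalChart

end Distance

/-! ### The Jacobi equation -/

section Jacobi

/-- `y : [0, ℓ] → ℝ`, with derivative `y'`, solves the Jacobi equation `y'' + K y = 0` with
`y(0) = 0` and `y'(0) = 1`. The equation is only required at interior times. -/
structure SolvesJacobi (K : ℝ → ℝ) (ℓ : ℝ) (y y' : ℝ → ℝ) : Prop where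
  hasDerivWithinAt : ∀ t ∈ Icc 0 ℓ, HasDerivWithinAt y (y' t) (Icc 0 ℓ) t
  continuousOn_deriv : ContinuousOn y' (Icc 0 ℓ)
  jacobi : ∀ t ∈ Ioo 0 ℓ, HasDerivAt y' (-(K t * y t)) t
  zero : y 0 = 0
  one : y' 0 = 1

lemma eq_of_hasDerivAt_zero {a b : ℝ} (hab : a ≤ b) {f : ℝ → ℝ} (hf : ContinuousOn f (Icc a b))
    (hf' : ∀ t ∈ Ioo a b, HasDerivAt f 0 t) : f a = f b := by
  rcases hab.eq_or_lt with rfl | hab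
  · rfl
  obtain ⟨-, -, hslope⟩ := exists_hasDerivAt_eq_slope f (fun _ => 0) hab hf hf'
  have h := (div_eq_zero_iff.1 hslope.symm).resolve_right (sub_pos.2 hab).ne'
  exact (sub_eq_zero.1 h).symm

namespace SolvesJacobi

variable {K y y' z z' : ℝ → ℝ} {ℓ t : ℝ}

lemma continuousOn (hy : SolvesJacobi K ℓ y y') : ContinuousOn y (Icc 0 ℓ) :=
  fun t ht => (hy.hasDerivWithinAt t ht).continuousWithinAt

lemma hasDerivAt (hy : SolvesJacobi K ℓ y y') (ht : t ∈ Ioo 0 ℓ) : HasDerivAt y (y' t) t :=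
  (hy.hasDerivWithinAt t (Ioo_subset_Icc_self ht)).hasDerivAt (Icc_mem_nhds ht.1 ht.2)

lemma tendsto_div_id (hy : SolvesJacobi K ℓ y y') (hℓ : 0 < ℓ) :
    Tendsto (fun t => y t / t) (𝓝[>] 0) (𝓝 1) := by
  have h : HasDerivWithinAt y (y' 0) (Ioi 0) 0 :=
    (hy.hasDerivWithinAt 0 (left_mem_Icc.2 hℓ.le)).mono_of_mem_nhdsWithin (Icc_mem_nhdsGT hℓ)
  rw [hy.one, hasDerivWithinAt_iff_tendsto_slope' (by simp)] at h
  exact h.congr fun t => by rw [slope_def_field, hy.zero, sub_zero, sub_zero]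

lemma wronskian_eq_zero (hy : SolvesJacobi K ℓ y y') (hz : SolvesJacobi K ℓ z z')
    (ht : t ∈ Icc 0 ℓ) : y' t * z t - y t * z' t = 0 := by
  have hsub : Icc 0 t ⊆ Icc 0 ℓ := Icc_subset_Icc_right ht.2
  have hcont : ContinuousOn (fun t => y' t * z t - y t * z' t) (Icc 0 t) :=
    ((hy.continuousOn_deriv.mul hz.continuousOn).sub
      (hy.continuousOn.mul hz.continuousOn_deriv)).mono hsub
  have hconst := eq_of_hasDerivAt_zero ht.1 hcont fun s hs => by
    have hs' : s ∈ Ioo 0 ℓ := Ioo_subset_Ioo_right ht.2 hs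
    exact (((hy.jacobi s hs').fun_mul (hz.hasDerivAt hs')).fun_sub
      ((hy.hasDerivAt hs').fun_mul (hz.jacobi s hs'))).congr_deriv (by ring)
  rw [← hconst, hy.zero, hz.zero, mul_zero, zero_mul, sub_zero]

lemma div_eq_div (hy : SolvesJacobi K ℓ y y') (hz : SolvesJacobi K ℓ z z')
    (hz0 : ∀ t ∈ Ioc 0 ℓ, z t ≠ 0) (ht : t ∈ Ioc 0 ℓ) : y t / z t = y ℓ / z ℓ := by
  have hsub : Icc t ℓ ⊆ Icc 0 ℓ := Icc_subset_Icc_left ht.1.le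
  have hne : ∀ s ∈ Icc t ℓ, z s ≠ 0 := fun s hs => hz0 s ⟨ht.1.trans_le hs.1, hs.2⟩
  refine eq_of_hasDerivAt_zero (f := fun t => y t / z t) ht.2
    ((hy.continuousOn.mono hsub).div (hz.continuousOn.mono hsub) hne) fun s hs => ?_
  have hs' : s ∈ Ioo 0 ℓ := Ioo_subset_Ioo_left ht.1.le hs
  refine ((hy.hasDerivAt hs').fun_div (hz.hasDerivAt hs')
    (hne s (Ioo_subset_Icc_self hs))).congr_deriv ?_
  rw [wronskian_eq_zero hy hz (Ioo_subset_Icc_self hs'), zero_div]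

/- The vanishing of the Wronskian makes the quotient `y / z` constant, and its limit at `0` is `1`;
this needs no Lipschitz bound on the equation, as opposed to Gronwall's inequality. -/
lemma eq_of_ne_zero (hℓ : 0 < ℓ) (hy : SolvesJacobi K ℓ y y') (hz : SolvesJacobi K ℓ z z')
    (hz0 : ∀ t ∈ Ioc 0 ℓ, z t ≠ 0) : y ℓ = z ℓ ∧ y' ℓ = z' ℓ := by
  have hzℓ : z ℓ ≠ 0 := hz0 ℓ (right_mem_Ioc.2 hℓ)
  have hlim : Tendsto (fun t => y t / z t) (𝓝[>] 0) (𝓝 1) := by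
    have h := (hy.tendsto_div_id hℓ).div (hz.tendsto_div_id hℓ) one_ne_zero
    rw [div_one] at h
    refine h.congr' ?_
    filter_upwards [self_mem_nhdsWithin] with t ht
    exact div_div_div_cancel_right₀ (ne_of_gt ht) _ _
  have hconst : Tendsto (fun t => y t / z t) (𝓝[>] 0) (𝓝 (y ℓ / z ℓ)) := by
    refine tendsto_const_nhds.congr' ?_
    filter_upwards [Ioc_mem_nhdsGT hℓ] with t ht using (hy.div_eq_div hz hz0 ht).symm
  have hval : y ℓ = z ℓ := (div_eq_one_iff_eq hzℓ).1 (tendsto_nhds_unique hconst hlim)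
  refine ⟨hval, mul_right_cancel₀ hzℓ ?_⟩
  rw [sub_eq_zero.1 (hy.wronskian_eq_zero hz (right_mem_Icc.2 hℓ.le)), hval, mul_comm]

end SolvesJacobi

end Jacobi

/-! ### Polar coordinates in a Euclidean plane -/

section Polar

variable {V : Type*} [NormedAddCommGroup V] [InnerProductSpace ℝ V]
  (b : OrthonormalBasis (Fin 2) ℝ V)

/-- The unit vector at angle `θ` to `b 0`. -/
def unitVec (θ : ℝ) : V := Real.cos θ • b 0 + Real.sin θ • b 1

/-- The unit vector at angle `θ + π / 2` to `b 0`, which is also the derivative of `unitVec b`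
at `θ`. -/
def unitNormal (θ : ℝ) : V := -Real.sin θ • b 0 + Real.cos θ • b 1

lemma inner_smul_add_smul (x y x' y' : ℝ) :
    inner ℝ (x • b 0 + y • b 1) (x' • b 0 + y' • b 1) = x * x' + y * y' := by
  simp [inner_add_left, inner_add_right, real_inner_smul_left, real_inner_smul_right,
    b.inner_eq_ite]
  ring

lemma inner_unitVec_unitVec (θ ψ : ℝ) :
    inner ℝ (unitVec b θ) (unitVec b ψ) = Real.cos (ψ - θ) := by
  rw [unitVec, unitVec, inner_smul_add_smul, Real.cos_sub]
  ring

lemma inner_unitNormal_unitVec (θ ψ : ℝ) :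
    inner ℝ (unitNormal b θ) (unitVec b ψ) = Real.sin (ψ - θ) := by
  rw [unitNormal, unitVec, inner_smul_add_smul, Real.sin_sub]
  ring

lemma norm_unitVec (θ : ℝ) : ‖unitVec b θ‖ = 1 := by
  rw [norm_eq_sqrt_real_inner, inner_unitVec_unitVec, sub_self, Real.cos_zero, Real.sqrt_one]

lemma norm_unitNormal (θ : ℝ) : ‖unitNormal b θ‖ = 1 := by
  rw [norm_eq_sqrt_real_inner, unitNormal, inner_smul_add_smul, neg_mul_neg, ← sq, ← sq,
    Real.sin_sq_add_cos_sq, Real.sqrt_one]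

lemma unitNormal_ne_zero (θ : ℝ) : unitNormal b θ ≠ 0 :=
  norm_ne_zero_iff.1 (by simp [norm_unitNormal])

lemma unitVec_add (θ α : ℝ) :
    unitVec b (θ + α) = Real.cos α • unitVec b θ + Real.sin α • unitNormal b θ := by
  rw [unitVec, unitVec, unitNormal, Real.cos_add, Real.sin_add]
  module

lemma hasDerivAt_unitVec (θ : ℝ) : HasDerivAt (unitVec b) (unitNormal b θ) θ :=
  ((Real.hasDerivAt_cos θ).smul_const (b 0)).add ((Real.hasDerivAt_sin θ).smul_const (b 1))

lemma contDiff_unitVec : ContDiff ℝ ∞ (unitVec b) :=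
  (Real.contDiff_cos.smul contDiff_const).add (Real.contDiff_sin.smul contDiff_const)

/-- The coordinates of `v` in the orthonormal frame `(unitVec b θ, unitNormal b θ)`, as a complex
number. -/
def frameCoord (θ : ℝ) (v : V) : ℂ := ⟨inner ℝ (unitVec b θ) v, inner ℝ (unitNormal b θ) v⟩

lemma frameCoord_smul_unitVec (θ ψ r : ℝ) :
    frameCoord b θ (r • unitVec b ψ) =
      r * (Complex.cos ↑(ψ - θ) + Complex.sin ↑(ψ - θ) * Complex.I) := by
  apply Complex.ext <;>
    simp [frameCoord, real_inner_smul_right, inner_unitVec_unitVec, inner_unitNormal_unitVec,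
      -Complex.ofReal_sub, Complex.cos_ofReal_re, Complex.sin_ofReal_re]

lemma frameCoord_decomposition (θ : ℝ) (v : V) :
    (frameCoord b θ v).re • unitVec b θ + (frameCoord b θ v).im • unitNormal b θ = v := by
  obtain ⟨x, y, rfl⟩ : ∃ x y : ℝ, v = x • b 0 + y • b 1 := by
    refine ⟨b.repr v 0, b.repr v 1, ?_⟩
    rw [← Fin.sum_univ_two fun i => b.repr v i • b i, b.sum_repr]
  simp only [frameCoord, unitVec, unitNormal, inner_smul_add_smul]
  have h := Real.sin_sq_add_cos_sq θ
  match_scalars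
  · linear_combination x * h
  · linear_combination y * h

lemma norm_frameCoord (θ : ℝ) (v : V) : ‖frameCoord b θ v‖ = ‖v‖ := by
  refine (sq_eq_sq₀ (norm_nonneg _) (norm_nonneg _)).1 ?_
  calc ‖frameCoord b θ v‖ ^ 2
      = (frameCoord b θ v).re * inner ℝ (unitVec b θ) v +
          (frameCoord b θ v).im * inner ℝ (unitNormal b θ) v := by
        rw [← Complex.normSq_eq_norm_sq, Complex.normSq_apply, frameCoord]
    _ = inner ℝ
          ((frameCoord b θ v).re • unitVec b θ + (frameCoord b θ v).im • unitNormal b θ) v := by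
        rw [inner_add_left, real_inner_smul_left, real_inner_smul_left]
    _ = ‖v‖ ^ 2 := by rw [frameCoord_decomposition, real_inner_self_eq_norm_sq]

lemma norm_smul_unitVec_arg (θ : ℝ) (v : V) :
    ‖v‖ • unitVec b (θ + (frameCoord b θ v).arg) = v := by
  rw [unitVec_add, smul_add, smul_smul, smul_smul, ← norm_frameCoord b θ, Complex.norm_mul_cos_arg,
    Complex.norm_mul_sin_arg, frameCoord_decomposition]

lemma contDiffAt_arg {n : ℕ∞ω} {z : ℂ} (hz : z ∈ Complex.slitPlane) :
    ContDiffAt ℝ n Complex.arg z := by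
  rw [show Complex.arg = Complex.imCLM ∘ Complex.log from funext fun w => (Complex.log_im w).symm]
  exact Complex.imCLM.contDiff.contDiffAt.comp z ((Complex.contDiffAt_log hz).restrict_scalars ℝ)

variable {u : ℝ → V} {s : ℝ}

lemma contDiffAt_angle {n : ℕ∞ω} {θ : ℝ} (hu : ContDiffAt ℝ n u s)
    (hθ : u s = ‖u s‖ • unitVec b θ) (hu0 : u s ≠ 0) :
    ContDiffAt ℝ n (fun τ => θ + (frameCoord b θ (u τ)).arg) s := by
  have hcoord : ContDiffAt ℝ n (fun τ => frameCoord b θ (u τ)) s := by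
    have h := ((contDiffAt_const (c := unitVec b θ)).inner ℝ hu).prodMk
      ((contDiffAt_const (c := unitNormal b θ)).inner ℝ hu)
    exact Complex.equivRealProdCLM.symm.contDiff.contDiffAt.comp s h
  refine contDiffAt_const.add ((contDiffAt_arg ?_).comp s hcoord)
  rw [hθ, frameCoord_smul_unitVec, sub_self]
  simpa using hu0

lemma eventuallyEq_angle {θ : ℝ → ℝ} (hθ : ContinuousAt θ s) (hu0 : ∀ᶠ τ in 𝓝 s, u τ ≠ 0)
    (hu : ∀ᶠ τ in 𝓝 s, u τ = ‖u τ‖ • unitVec b (θ τ)) :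
    θ =ᶠ[𝓝 s] fun τ => θ s + (frameCoord b (θ s) (u τ)).arg := by
  have hnear : ∀ᶠ τ in 𝓝 s, θ τ ∈ Ioo (θ s - Real.pi) (θ s + Real.pi) :=
    hθ.eventually_mem (Ioo_mem_nhds (sub_lt_self _ Real.pi_pos) (lt_add_of_pos_right _ Real.pi_pos))
  filter_upwards [hu0, hu, hnear] with τ h0 hτ hπ
  have harg : (frameCoord b (θ s) (u τ)).arg = θ τ - θ s := by
    rw [hτ, frameCoord_smul_unitVec]
    exact Complex.arg_mul_cos_add_sin_mul_I (norm_pos_iff.2 h0)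
      ⟨by linarith [hπ.1], by linarith [hπ.2]⟩
  rw [harg, add_sub_cancel]

lemma exists_continuousAt_angle (hu : ContDiffAt ℝ 1 u s) (hu0 : u s ≠ 0) :
    ∃ θ : ℝ → ℝ, ContinuousAt θ s ∧ ∀ τ, u τ = ‖u τ‖ • unitVec b (θ τ) :=
  ⟨_, (contDiffAt_angle b hu (norm_smul_unitVec_arg b 0 (u s)).symm hu0).continuousAt,
    fun τ => (norm_smul_unitVec_arg b _ (u τ)).symm⟩

end Polar

/-! ### Geodesic polar coordinates -/

section Squares

lemma deriv_deriv_slice {P : ℝ × ℝ → ℝ} {t τ : ℝ} (hP : ContDiffAt ℝ 2 P (t, τ)) :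
    deriv (deriv fun s => P (s, τ)) t = dirDeriv (1, 0) (dirDeriv (1, 0) P) (t, τ) := by
  rw [(deriv_slice_eventuallyEq (hP.of_le one_le_two)).deriv_eq]
  exact (hasDerivAt_slice_fst (differentiableAt_dirDeriv hP _)).deriv

variable {G : ℝ → ℝ} {t : ℝ}

lemma deriv_fun_sq (hG : DifferentiableAt ℝ G t) :
    deriv (fun s => G s ^ 2) t = 2 * (G t * deriv G t) := by
  rw [(hG.hasDerivAt.fun_pow 2).deriv]
  norm_num [mul_assoc]

lemma deriv_deriv_fun_sq (hG : ContDiffAt ℝ 2 G t) :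
    deriv (deriv fun s => G s ^ 2) t = 2 * (deriv G t ^ 2 + G t * deriv (deriv G) t) := by
  have hderiv : deriv (fun s => G s ^ 2) =ᶠ[𝓝 t] fun s => 2 * (G s * deriv G s) := by
    filter_upwards [hG.eventually (by simp)] with s hs
      using deriv_fun_sq (hs.differentiableAt two_ne_zero)
  have hprod := ((hG.differentiableAt two_ne_zero).hasDerivAt.fun_mul
    (differentiableAt_dirDeriv hG 1).hasDerivAt).const_mul 2
  simp only [dirDeriv_one] at hprod
  rw [hderiv.deriv_eq, hprod.deriv]
  ring

end Squares

section PolarCoordinates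

variable {M : Type*} [MetricSpace M] [ChartedSpace Plane M]
  {V : Type*} [NormedAddCommGroup V] [InnerProductSpace ℝ V]
  (e : V → M) (b : OrthonormalBasis (Fin 2) ℝ V)

/-- The geodesic polar coordinates `(r, θ) ↦ e (r (cos θ b₀ + sin θ b₁))` of a normal chart `e`,
read in the chart of the surface around `x`. -/
def polarChart (x : M) : ℝ × ℝ → Plane :=
  extChartAt (𝓡 2) x ∘ e ∘ rayFamily (unitVec b)

variable [RiemannianBundle (fun x : M => TangentSpace (𝓡 2) x)]

/-- The density `G` of the metric `dr² + G² dθ²` in geodesic polar coordinates, as a function of the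
radius `t` at the angle `θ`. It is the length of `∂_θ`, with the sign of `t`. -/
def polarDensity (θ t : ℝ) : ℝ :=
  t * ‖pushforward e (t • unitVec b θ) (unitNormal b θ)‖

/-- The coefficient of `dθ²` of the metric in geodesic polar coordinates, read in the chart around
`x`. -/
def angularCoeff (x : M) (z : ℝ × ℝ) : ℝ :=
  metricForm (chartGram x) (polarChart e b x z) (dirDeriv (0, 1) (polarChart e b x) z)
    (dirDeriv (0, 1) (polarChart e b x) z)

lemma polarDensity_zero (θ : ℝ) : polarDensity e b θ 0 = 0 := zero_mul _

lemma polarDensity_sq (θ t : ℝ) :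
    polarDensity e b θ t ^ 2 =
      pullbackMetric e (t • unitVec b θ) (t • unitNormal b θ) (t • unitNormal b θ) := by
  rw [polarDensity, mul_pow, ← real_inner_self_eq_norm_sq, ← pullbackMetric_apply, map_smul,
    LinearMap.map_smul₂, smul_eq_mul, smul_eq_mul, ← mul_assoc, sq]

lemma smul_unitVec_mem_ball {δ t θ : ℝ} (ht : 0 ≤ t) :
    t • unitVec b θ ∈ Metric.ball (0 : V) δ ↔ t < δ := by
  rw [mem_ball_zero_iff, norm_smul, norm_unitVec, mul_one, Real.norm_of_nonneg ht]

lemma dirDeriv_fst_polar (z : ℝ × ℝ) :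
    dirDeriv (1, 0) (rayFamily (unitVec b)) z = unitVec b z.2 :=
  dirDeriv_fst_rayFamily (hasDerivAt_unitVec b z.2).differentiableAt

lemma dirDeriv_snd_polar (z : ℝ × ℝ) :
    dirDeriv (0, 1) (rayFamily (unitVec b)) z = z.1 • unitNormal b z.2 := by
  rw [dirDeriv_snd_rayFamily (hasDerivAt_unitVec b z.2).differentiableAt,
    (hasDerivAt_unitVec b z.2).deriv]

lemma contDiff_polar : ContDiff ℝ ∞ (rayFamily (unitVec b)) :=
  contDiff_iff_contDiffAt.2 fun _ => contDiffAt_rayFamily (contDiff_unitVec b).contDiffAt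

end PolarCoordinates

namespace IsNormalChart

variable {M : Type*} [MetricSpace M] [ChartedSpace Plane M]
  [RiemannianBundle (fun x : M => TangentSpace (𝓡 2) x)]
  {V : Type*} [NormedAddCommGroup V] [InnerProductSpace ℝ V]
  {e : OpenPartialHomeomorph V M} {δ : ℝ} (he : IsNormalChart e δ)
include he

lemma pushforward_injective {w : V} (hw : w ∈ Metric.ball (0 : V) δ) :
    Function.Injective (pushforward e w) := by
  have h : e.MDifferentiable 𝓘(ℝ, V) (𝓡 2) :=
    ⟨he.contMDiffOn.mdifferentiableOn (by simp), he.contMDiffOn_symm.mdifferentiableOn (by simp)⟩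
  exact h.mfderiv_injective (by rwa [he.source])

lemma norm_pushforward_pos {w : V} (hw : w ∈ Metric.ball (0 : V) δ) {a : V} (ha : a ≠ 0) :
    0 < ‖pushforward e w a‖ :=
  norm_pos_iff.2 fun h => ha (he.pushforward_injective hw (h.trans (map_zero _).symm))

variable (b : OrthonormalBasis (Fin 2) ℝ V) {t θ : ℝ}

lemma polarDensity_pos (ht0 : 0 < t) (ht : t < δ) : 0 < polarDensity e b θ t :=
  mul_pos ht0 (he.norm_pushforward_pos ((smul_unitVec_mem_ball b ht0.le).2 ht)
    (unitNormal_ne_zero b θ))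

variable {x : M}

lemma eventually_polar (ht0 : 0 < t) (ht : t < δ)
    (hx : e (t • unitVec b θ) ∈ (chartAt Plane x).source) :
    ∀ᶠ z : ℝ × ℝ in 𝓝 (t, θ),
      0 ≤ z.1 ∧ z.1 < δ ∧ e (z.1 • unitVec b z.2) ∈ (chartAt Plane x).source := by
  have hpos : ∀ᶠ z : ℝ × ℝ in 𝓝 (t, θ), 0 < z.1 := continuousAt_fst.eventually (lt_mem_nhds ht0)
  filter_upwards [hpos, he.eventually_mem (z := (t, θ)) (contDiff_polar b).continuous.continuousAt
    ((smul_unitVec_mem_ball b ht0.le).2 ht) hx] with z hz0 hz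
  exact ⟨hz0.le, (smul_unitVec_mem_ball b hz0.le).1 hz.1, hz.2⟩

variable [IsManifold (𝓡 2) ∞ M]

lemma contDiffAt_polarChart {z : ℝ × ℝ} (hz0 : 0 ≤ z.1) (hz : z.1 < δ)
    (hx : e (z.1 • unitVec b z.2) ∈ (chartAt Plane x).source) :
    ContDiffAt ℝ ∞ (polarChart e b x) z :=
  he.contDiffAt_family (contDiff_polar b).contDiffAt ((smul_unitVec_mem_ball b hz0).2 hz) hx

lemma covDeriv_polarChart {z : ℝ × ℝ} (hz0 : 0 ≤ z.1) (hz : z.1 < δ)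
    (hx : e (z.1 • unitVec b z.2) ∈ (chartAt Plane x).source) :
    covDeriv (chartGram x) (polarChart e b x) (1, 0) (dirDeriv (1, 0) (polarChart e b x)) z = 0 :=
  he.covDeriv_rayFamily hz0 (contDiff_unitVec b).contDiffAt ((smul_unitVec_mem_ball b hz0).2 hz) hx

lemma metricForm_polarChart {z : ℝ × ℝ} (hz0 : 0 ≤ z.1) (hz : z.1 < δ)
    (hx : e (z.1 • unitVec b z.2) ∈ (chartAt Plane x).source) (v w : ℝ × ℝ) :
    metricForm (chartGram x) (polarChart e b x z) (dirDeriv v (polarChart e b x) z)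
        (dirDeriv w (polarChart e b x) z) =
      pullbackMetric e (z.1 • unitVec b z.2) (dirDeriv v (rayFamily (unitVec b)) z)
        (dirDeriv w (rayFamily (unitVec b)) z) :=
  (he.pullbackMetric_eq_metricForm ((contDiff_polar b).differentiable (by simp)).differentiableAt
    ((smul_unitVec_mem_ball b hz0).2 hz) hx v w).symm

lemma angularCoeff_eq {z : ℝ × ℝ} (hz0 : 0 ≤ z.1) (hz : z.1 < δ)
    (hx : e (z.1 • unitVec b z.2) ∈ (chartAt Plane x).source) :
    angularCoeff e b x z = polarDensity e b z.2 z.1 ^ 2 := by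
  rw [angularCoeff, he.metricForm_polarChart b hz0 hz hx, dirDeriv_snd_polar, polarDensity_sq]

lemma angularCoeff_eventuallyEq (ht0 : 0 < t) (ht : t < δ)
    (hx : e (t • unitVec b θ) ∈ (chartAt Plane x).source) :
    (fun s => angularCoeff e b x (s, θ)) =ᶠ[𝓝 t] fun s => polarDensity e b θ s ^ 2 := by
  have hline : ContinuousAt (fun s : ℝ => (s, θ)) t := by fun_prop
  filter_upwards [hline.eventually (he.eventually_polar b ht0 ht hx)] with s hs
    using he.angularCoeff_eq b hs.1 hs.2.1 hs.2.2

variable [IsContMDiffRiemannianBundle (𝓡 2) ∞ Plane (fun x : M => TangentSpace (𝓡 2) x)]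

lemma metricForm_fst_fst {z : ℝ × ℝ} (hz0 : 0 ≤ z.1) (hz : z.1 < δ)
    (hx : e (z.1 • unitVec b z.2) ∈ (chartAt Plane x).source) :
    metricForm (chartGram x) (polarChart e b x z) (dirDeriv (1, 0) (polarChart e b x) z)
      (dirDeriv (1, 0) (polarChart e b x) z) = 1 := by
  rw [he.metricForm_polarChart b hz0 hz hx, dirDeriv_fst_polar,
    he.pullbackMetric_ray_self hz0 ((smul_unitVec_mem_ball b hz0).2 hz), norm_unitVec, one_pow]

lemma metricForm_fst_snd {z : ℝ × ℝ} (hz0 : 0 ≤ z.1) (hz : z.1 < δ)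
    (hx : e (z.1 • unitVec b z.2) ∈ (chartAt Plane x).source) :
    metricForm (chartGram x) (polarChart e b x z) (dirDeriv (1, 0) (polarChart e b x) z)
      (dirDeriv (0, 1) (polarChart e b x) z) = 0 := by
  rw [he.metricForm_polarChart b hz0 hz hx, dirDeriv_fst_polar, dirDeriv_snd_polar, map_smul,
    ← LinearMap.map_smul₂, he.gauss ((smul_unitVec_mem_ball b hz0).2 hz), real_inner_smul_left,
    real_inner_comm, inner_unitNormal_unitVec, sub_self, Real.sin_zero, mul_zero]

lemma contDiffAt_pullbackMetric_const {w : V} (hw : w ∈ Metric.ball (0 : V) δ) (a c : V) :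
    ContDiffAt ℝ ∞ (fun w => pullbackMetric e w a c) w := by
  have h := he.contDiffAt_pullbackMetric (F := fun w : V => w) contDiffAt_id hw a c
  simpa only [dirDeriv, fderiv_fun_id, ContinuousLinearMap.id_apply] using h

lemma contDiffAt_norm_pushforward_ray {u : V} (hw : t • u ∈ Metric.ball (0 : V) δ) {a : V}
    (ha : a ≠ 0) : ContDiffAt ℝ ∞ (fun s : ℝ => ‖pushforward e (s • u) a‖) t := by
  have h := (he.contDiffAt_pullbackMetric_const hw a a).comp (f := fun s : ℝ => s • u) t
    (contDiffAt_id.smul contDiffAt_const)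
  simp only [norm_eq_sqrt_real_inner]
  refine h.sqrt ?_
  rw [Function.comp_apply, pullbackMetric_apply, real_inner_self_eq_norm_sq]
  exact (pow_pos (he.norm_pushforward_pos hw ha) 2).ne'

lemma contDiffAt_polarDensity (ht0 : 0 ≤ t) (ht : t < δ) :
    ContDiffAt ℝ 2 (polarDensity e b θ) t := by
  have h := he.contDiffAt_norm_pushforward_ray ((smul_unitVec_mem_ball b (θ := θ) ht0).2 ht)
    (a := unitNormal b θ) (unitNormal_ne_zero b θ)
  exact contDiffAt_id.mul (h.of_le ENat.LEInfty.out)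

lemma deriv_polarDensity_zero (hδ : 0 < δ) : deriv (polarDensity e b θ) 0 = 1 := by
  have hball : (0 : ℝ) • unitVec b θ ∈ Metric.ball (0 : V) δ :=
    (smul_unitVec_mem_ball b le_rfl).2 hδ
  have hunit : ‖pushforward e ((0 : ℝ) • unitVec b θ) (unitNormal b θ)‖ = 1 := by
    rw [norm_eq_sqrt_real_inner, zero_smul, ← pullbackMetric_apply, he.pullbackMetric_zero hδ,
      norm_unitNormal, one_pow, Real.sqrt_one]
  have hdiff := (he.contDiffAt_norm_pushforward_ray hball (a := unitNormal b θ)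
    (unitNormal_ne_zero b θ)).differentiableAt (by simp)
  refine ((hasDerivAt_id (0 : ℝ)).fun_mul hdiff.hasDerivAt).deriv.trans ?_
  rw [id, one_mul, zero_mul, add_zero, hunit]

lemma contDiffAt_angularCoeff (ht0 : 0 ≤ t) (ht : t < δ)
    (hx : e (t • unitVec b θ) ∈ (chartAt Plane x).source) :
    ContDiffAt ℝ ∞ (angularCoeff e b x) (t, θ) := by
  have hf := he.contDiffAt_polarChart (z := (t, θ)) b ht0 ht hx
  exact (isMetricOn_chartGram x).contDiffAt_metricForm (f := polarChart e b x)
    ((extChartAt (𝓡 2) x).map_source (by rwa [extChartAt_source])) hf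
    (contDiffAt_dirDeriv hf (0, 1)) (contDiffAt_dirDeriv hf (0, 1))

lemma deriv_deriv_polarDensity (ht0 : 0 < t) (ht : t < δ) :
    deriv (deriv (polarDensity e b θ)) t =
      -(gaussianCurvature (e (t • unitVec b θ)) * polarDensity e b θ t) := by
  set x := e (t • unitVec b θ)
  have hx : e (t • unitVec b θ) ∈ (chartAt Plane x).source := mem_chart_source Plane x
  have hev := he.eventually_polar b ht0 ht hx
  have hjacobi := (isMetricOn_chartGram x).jacobi_sq (f := polarChart e b x) (z := (t, θ))
    (w := (0, 1)) (mem_extChartAt_target x) (he.contDiffAt_polarChart b ht0.le ht hx)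
    (hev.mono fun z hz => he.covDeriv_polarChart b hz.1 hz.2.1 hz.2.2)
    (hev.mono fun z hz => he.metricForm_fst_fst b hz.1 hz.2.1 hz.2.2)
    (he.metricForm_fst_snd b ht0.le ht hx)
  have hq := (he.contDiffAt_angularCoeff b ht0.le ht hx).of_le (m := 2) ENat.LEInfty.out
  have hG := he.contDiffAt_polarDensity b (θ := θ) ht0.le ht
  have hsq := he.angularCoeff_eventuallyEq b ht0 ht hx
  change angularCoeff e b x (t, θ) * dirDeriv (1, 0) (dirDeriv (1, 0) (angularCoeff e b x)) (t, θ) =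
    dirDeriv (1, 0) (angularCoeff e b x) (t, θ) ^ 2 / 2 -
      2 * gaussianCurvature x * angularCoeff e b x (t, θ) ^ 2 at hjacobi
  rw [← deriv_deriv_slice hq, ← (hasDerivAt_slice_fst (hq.differentiableAt two_ne_zero)).deriv,
    hsq.deriv.deriv_eq, hsq.deriv_eq, deriv_fun_sq (hG.differentiableAt two_ne_zero),
    deriv_deriv_fun_sq hG, show angularCoeff e b x (t, θ) = _ from hsq.self_of_nhds] at hjacobi
  have hpos : 0 < polarDensity e b θ t := he.polarDensity_pos b ht0 ht
  refine eq_neg_of_add_eq_zero_left (mul_left_cancel₀ (pow_pos hpos 3).ne' ?_)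
  linear_combination hjacobi / 2

lemma solvesJacobi_polarDensity {ℓ : ℝ} (hℓ0 : 0 < ℓ) (hℓ : ℓ < δ) :
    SolvesJacobi (fun t => gaussianCurvature (e (t • unitVec b θ))) ℓ (polarDensity e b θ)
      (deriv (polarDensity e b θ)) := by
  have hG : ∀ t ∈ Icc 0 ℓ, ContDiffAt ℝ 2 (polarDensity e b θ) t := fun t ht =>
    he.contDiffAt_polarDensity b ht.1 (ht.2.trans_lt hℓ)
  exact
    { hasDerivWithinAt := fun t ht =>
        ((hG t ht).differentiableAt two_ne_zero).hasDerivAt.hasDerivWithinAt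
      continuousOn_deriv := fun t ht =>
        (differentiableAt_dirDeriv (hG t ht) 1).continuousAt.continuousWithinAt
      jacobi := fun t ht => by
        rw [← he.deriv_deriv_polarDensity b ht.1 (ht.2.trans hℓ)]
        exact (differentiableAt_dirDeriv (hG t (Ioo_subset_Icc_self ht)) 1).hasDerivAt
      zero := polarDensity_zero e b θ
      one := he.deriv_polarDensity_zero b (hℓ0.trans hℓ) }

end IsNormalChart

section JacobiField

variable {M : Type*} [MetricSpace M] [ChartedSpace Plane M]
  [RiemannianBundle (fun x : M => TangentSpace (𝓡 2) x)]
  {σ : ℝ → M} {ℓ : ℝ} {J J' : ℝ → ℝ}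

lemma IsJacobiField.solvesJacobi (hJ : IsJacobiField σ ℓ J J') {K : ℝ → ℝ}
    (hK : ∀ t ∈ Ioo 0 ℓ, gaussianCurvature (σ t) = K t) : SolvesJacobi K ℓ J J' where
  hasDerivWithinAt := hJ.deriv_J
  continuousOn_deriv t ht := (hJ.jacobi t ht).continuousWithinAt
  jacobi t ht := by
    rw [← hK t ht]
    exact (hJ.jacobi t (Ioo_subset_Icc_self ht)).hasDerivAt (Icc_mem_nhds ht.1 ht.2)
  zero := hJ.zero
  one := hJ.one

variable [IsManifold (𝓡 2) ∞ M]
  [IsContMDiffRiemannianBundle (𝓡 2) ∞ Plane (fun x : M => TangentSpace (𝓡 2) x)]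
  {V : Type*} [NormedAddCommGroup V] [InnerProductSpace ℝ V]
  {e : OpenPartialHomeomorph V M} {δ : ℝ}

lemma IsNormalChart.jacobiField_mul (he : IsNormalChart e δ) (b : OrthonormalBasis (Fin 2) ℝ V)
    {θ : ℝ} (hℓ0 : 0 < ℓ) (hℓ : ℓ < δ) (hσ : ∀ t ∈ Icc 0 ℓ, σ t = e (t • unitVec b θ))
    (hJ : IsJacobiField σ ℓ J J') {x : M}
    (hx : e (ℓ • unitVec b θ) ∈ (chartAt Plane x).source) :
    dirDeriv (1, 0) (angularCoeff e b x) (ℓ, θ) = 2 * (J ℓ * J' ℓ) := by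
  have hJG := (hJ.solvesJacobi fun t ht => by rw [hσ t (Ioo_subset_Icc_self ht)]).eq_of_ne_zero hℓ0
    (he.solvesJacobi_polarDensity b hℓ0 hℓ)
    fun t ht => (he.polarDensity_pos b ht.1 (ht.2.trans_lt hℓ)).ne'
  have hq := (he.contDiffAt_angularCoeff b hℓ0.le hℓ hx).differentiableAt (by simp)
  rw [← (hasDerivAt_slice_fst hq).deriv,
    (he.angularCoeff_eventuallyEq b hℓ0 hℓ hx).deriv_eq,
    deriv_fun_sq ((he.contDiffAt_polarDensity b hℓ0.le hℓ).differentiableAt two_ne_zero),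
    hJG.1, hJG.2]

end JacobiField

/-! ### Curves in a normal chart -/

section Tangency

variable {M : Type*} [MetricSpace M] [ChartedSpace Plane M]

lemma tangentBundle_smul_congr {q₁ q₂ : TangentBundle (𝓡 2) M} (h : q₁ = q₂) (c : ℝ) :
    (⟨q₁.1, c • q₁.2⟩ : TangentBundle (𝓡 2) M) = ⟨q₂.1, c • q₂.2⟩ := by
  rw [h]

lemma areTangent_iff {σ γ : ℝ → M} {t s : ℝ} :
    AreTangent σ t γ s ↔ ∃ ε : ℝ, |ε| = 1 ∧ lift σ t = ⟨γ s, ε • velocity γ s⟩ := by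
  constructor
  · rintro (h | h)
    · exact ⟨1, abs_one, by rw [h, one_smul]⟩
    · exact ⟨-1, by rw [abs_neg, abs_one], by rw [h, neg_one_smul]⟩
  · rintro ⟨ε, hε, h⟩
    rcases (abs_eq zero_le_one).1 hε with rfl | rfl
    · exact Or.inl (by rw [h, one_smul])
    · exact Or.inr (by rw [h, neg_one_smul])

end Tangency

section Curves

lemma hasDerivAt_of_deriv_angle_eq_zero {V : Type*} [NormedAddCommGroup V] [InnerProductSpace ℝ V]
    (b : OrthonormalBasis (Fin 2) ℝ V) {u : ℝ → V} {r θ : ℝ → ℝ} {s : ℝ}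
    (hr : DifferentiableAt ℝ r s) (hθ : DifferentiableAt ℝ θ s) (hθ0 : deriv θ s = 0)
    (hu : ∀ᶠ τ in 𝓝 s, u τ = r τ • unitVec b (θ τ)) :
    HasDerivAt u (deriv r s • unitVec b (θ s)) s := by
  have h := hr.hasDerivAt.fun_smul ((hasDerivAt_unitVec b (θ s)).scomp s hθ.hasDerivAt)
  rw [hθ0, zero_smul, smul_zero, zero_add] at h
  exact h.congr_of_eventuallyEq hu

lemma polarChart_eventuallyEq {M : Type*} [MetricSpace M] [ChartedSpace Plane M] {V : Type*}
    [NormedAddCommGroup V] [InnerProductSpace ℝ V] {e : OpenPartialHomeomorph V M} {γ : ℝ → M}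
    {θ : ℝ → ℝ} {s : ℝ} (b : OrthonormalBasis (Fin 2) ℝ V) (hγ : ContinuousAt γ s)
    (hγe : γ s ∈ e.target)
    (hθ : ∀ᶠ τ in 𝓝 s, e.symm (γ τ) = ‖e.symm (γ τ)‖ • unitVec b (θ τ)) (x : M) :
    (fun τ => polarChart e b x (‖e.symm (γ τ)‖, θ τ)) =ᶠ[𝓝 s] extChartAt (𝓡 2) x ∘ γ := by
  filter_upwards [hθ, hγ.eventually_mem (e.open_target.mem_nhds hγe)] with τ hτ hτe
  change extChartAt (𝓡 2) x (e (‖e.symm (γ τ)‖ • unitVec b (θ τ))) = _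
  rw [← hτ, e.right_inv hτe, Function.comp_apply]

variable {M : Type*} [MetricSpace M] [ChartedSpace Plane M] [IsManifold (𝓡 2) ∞ M]
  [RiemannianBundle (fun x : M => TangentSpace (𝓡 2) x)]
  {V : Type*} [NormedAddCommGroup V] [InnerProductSpace ℝ V]
  {γ : ℝ → M} {s : ℝ}

lemma IsNormalChart.lift_eq_of_eqOn_ray {e : OpenPartialHomeomorph V M} {δ : ℝ}
    (he : IsNormalChart e δ) {σ : ℝ → M} {ℓ : ℝ} {u : V} (hℓ0 : 0 < ℓ)
    (hu : ℓ • u ∈ Metric.ball (0 : V) δ)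
    (hσd : MDifferentiableAt 𝓘(ℝ, ℝ) (𝓡 2) σ ℓ) (hσ : ∀ t ∈ Icc 0 ℓ, σ t = e (t • u)) :
    lift σ ℓ = ⟨e (ℓ • u), pushforward e (ℓ • u) u⟩ := by
  have hℓ : ℓ ∈ Icc 0 ℓ := right_mem_Icc.2 hℓ0.le
  rw [← he.lift_ray hu]
  exact lift_eq_of_eventuallyEq (uniqueDiffOn_Icc hℓ0 ℓ hℓ) hσd
    ((he.geodesic_ray u).mdifferentiableAt ⟨hℓ0.le, hu⟩) (eventuallyEq_nhdsWithin_of_eqOn hσ) hℓ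

lemma covDeriv_chart_eq_zero (hγ : ContMDiffAt 𝓘(ℝ, ℝ) (𝓡 2) 2 γ s)
    (hκ : geodesicCurvature γ s = 0) :
    covDeriv (chartGram (γ s)) (extChartAt (𝓡 2) (γ s) ∘ γ) 1
      (deriv (extChartAt (𝓡 2) (γ s) ∘ γ)) s = 0 := by
  have hc := contDiffAt_chart_comp hγ (γ s) (mem_chart_source Plane _)
  by_contra hne
  refine (Real.sqrt_pos.2 (metricForm_chartGram_pos (γ s) (mem_extChartAt_target (I := 𝓡 2) (γ s))
    hne)).ne' (Eq.trans ?_ hκ)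
  simp only [geodesicCurvature, covAccel_eq_covDeriv (γ s) hc, metricForm_apply]

variable [IsContMDiffRiemannianBundle (𝓡 2) ∞ Plane (fun x : M => TangentSpace (𝓡 2) x)]

namespace IsNormalChart

variable {e : OpenPartialHomeomorph V M} {δ : ℝ} (he : IsNormalChart e δ)
  (b : OrthonormalBasis (Fin 2) ℝ V) {θ : ℝ → ℝ} {σ : ℝ → M} {ℓ : ℝ}
include he

lemma deriv_deriv_norm (hγ : ContMDiffAt 𝓘(ℝ, ℝ) (𝓡 2) 2 γ s) (hγe : γ s ∈ e.target)
    (hκ : geodesicCurvature γ s = 0) (hℓ : ‖e.symm (γ s)‖ = ℓ) (hℓ0 : 0 < ℓ)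
    (hθ : ContDiffAt ℝ 2 θ s)
    (hθγ : ∀ᶠ τ in 𝓝 s, e.symm (γ τ) = ‖e.symm (γ τ)‖ • unitVec b (θ τ)) {J J' : ℝ → ℝ}
    (hσ : ∀ t ∈ Icc 0 ℓ, σ t = e (t • unitVec b (θ s))) (hJ : IsJacobiField σ ℓ J J') :
    deriv (deriv fun τ => ‖e.symm (γ τ)‖) s = deriv θ s ^ 2 * (J ℓ * J' ℓ) := by
  subst hℓ
  have hr : ContDiffAt ℝ 2 (fun τ => ‖e.symm (γ τ)‖) s :=
    (he.contDiffAt_symm_comp ENat.LEInfty.out hγ hγe).norm ℝ (norm_pos_iff.1 hℓ0)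
  have hrδ : ‖e.symm (γ s)‖ < δ := mem_ball_zero_iff.1 (he.symm_mem_ball hγe)
  have hx : e (‖e.symm (γ s)‖ • unitVec b (θ s)) ∈ (chartAt Plane (γ s)).source := by
    rw [← hθγ.self_of_nhds, e.right_inv hγe]
    exact mem_chart_source Plane _
  have hpolar := he.eventually_polar b hℓ0 hrδ hx
  have hcurve := polarChart_eventuallyEq b hγ.continuousAt hγe hθγ (γ s)
  rw [(isMetricOn_chartGram (γ s)).deriv_deriv_radius (f := polarChart e b (γ s))
    ((extChartAt (𝓡 2) (γ s)).map_source (by rwa [extChartAt_source]))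
    ((he.contDiffAt_polarChart b hℓ0.le hrδ hx).of_le ENat.LEInfty.out)
    (he.covDeriv_polarChart b hℓ0.le hrδ hx)
    (hpolar.mono fun z hz => he.metricForm_fst_fst b hz.1 hz.2.1 hz.2.2)
    (hpolar.mono fun z hz => he.metricForm_fst_snd b hz.1 hz.2.1 hz.2.2) hr hθ]
  · have hcoeff := he.jacobiField_mul b hℓ0 hrδ hσ hJ hx
    exact congrArg (deriv θ s ^ 2 * ·)
      ((congrArg (· / 2) hcoeff).trans (mul_div_cancel_left₀ _ two_ne_zero))
  · rw [covDeriv_congr hcurve.deriv, covDeriv_congr_left hcurve]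
    exact covDeriv_chart_eq_zero hγ hκ

lemma areTangent_of_deriv_angle_eq_zero (hγ : ContMDiffAt 𝓘(ℝ, ℝ) (𝓡 2) 1 γ s)
    (hγe : γ s ∈ e.target) (hunit : ‖velocity γ s‖ = 1) (hℓ : ‖e.symm (γ s)‖ = ℓ) (hℓ0 : 0 < ℓ)
    (hθ : DifferentiableAt ℝ θ s) (hθ0 : deriv θ s = 0)
    (hθγ : ∀ᶠ τ in 𝓝 s, e.symm (γ τ) = ‖e.symm (γ τ)‖ • unitVec b (θ τ))
    (hσd : MDifferentiableAt 𝓘(ℝ, ℝ) (𝓡 2) σ ℓ)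
    (hσ : ∀ t ∈ Icc 0 ℓ, σ t = e (t • unitVec b (θ s))) : AreTangent σ ℓ γ s := by
  have hus : ContDiffAt ℝ 1 (e.symm ∘ γ) s := he.contDiffAt_symm_comp (by simp) hγ hγe
  have hr := (hus.norm ℝ (norm_pos_iff.1 (hℓ ▸ hℓ0))).differentiableAt one_ne_zero
  have hu : e.symm (γ s) = ℓ • unitVec b (θ s) := hθγ.self_of_nhds.trans (by rw [hℓ])
  have hub : ℓ • unitVec b (θ s) ∈ Metric.ball (0 : V) δ := hu ▸ he.symm_mem_ball hγe
  set ρ : ℝ := deriv (fun τ => ‖(e.symm ∘ γ) τ‖) s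
  have hud : HasDerivAt (e.symm ∘ γ) (ρ • unitVec b (θ s)) s :=
    hasDerivAt_of_deriv_angle_eq_zero b hr hθ hθ0 hθγ
  have hliftγ := he.lift_eq_pushforward hγ hγe
  rw [hud.deriv, hu, map_smul] at hliftγ
  have hρ : |ρ| = 1 := by
    rw [← hunit, ← Real.norm_eq_abs, ← mul_one ‖ρ‖, ← norm_unitVec b (θ s),
      ← he.norm_pushforward_ray hℓ0.le hub, ← norm_smul]
    exact (congrArg (fun q : TangentBundle (𝓡 2) M => ‖q.2‖) hliftγ).symm
  have hρ2 : ρ * ρ = 1 := by rw [← abs_mul_abs_self, hρ, mul_one]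
  refine areTangent_iff.2 ⟨ρ, hρ, (he.lift_eq_of_eqOn_ray hℓ0 hub hσd hσ).trans ?_⟩
  refine Eq.trans ?_ (tangentBundle_smul_congr hliftγ ρ).symm
  rw [smul_smul, hρ2, one_smul]

end IsNormalChart

end Curves

/-! ### Exponential charts and the generating function -/

section ExpChart

variable {M : Type*} [MetricSpace M] [ChartedSpace Plane M]

lemma finiteDimensional_tangentSpace (p : M) : FiniteDimensional ℝ (TangentSpace (𝓡 2) p) :=
  inferInstanceAs (FiniteDimensional ℝ Plane)

lemma exists_lift_eq {σ : ℝ → M} {t : ℝ} {p : M} (h : σ t = p) :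
    ∃ v : TangentSpace (𝓡 2) p, lift σ t = ⟨p, v⟩ := by
  subst h
  exact ⟨velocity σ t, rfl⟩

variable [RiemannianBundle (fun x : M => TangentSpace (𝓡 2) x)] {p : M}

/-- The normal chart `e` is the exponential map of `p` on the ball of radius `δ` of the tangent
plane at `p`, and its rays leave `p` in their own direction. -/
structure IsExpChart (e : OpenPartialHomeomorph (TangentSpace (𝓡 2) p) M) (δ : ℝ) : Prop
    extends IsNormalChart e δ where
  radius_pos : 0 < δ
  eqOn_expMap : EqOn e (expMap p) (Metric.ball 0 δ)
  lift_ray_zero : ∀ w ∈ Metric.ball (0 : TangentSpace (𝓡 2) p) δ,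
    lift (fun t : ℝ => e (t • w)) 0 = ⟨p, w⟩

lemma IsTotallyNormal.exists_isExpChart [IsManifold (𝓡 2) ∞ M]
    [IsContMDiffRiemannianBundle (𝓡 2) ∞ Plane (fun x : M => TangentSpace (𝓡 2) x)]
    {U : Set M} (hU : IsTotallyNormal U) (hp : p ∈ U) :
    ∃ (δ : ℝ) (e : OpenPartialHomeomorph (TangentSpace (𝓡 2) p) M),
      IsExpChart e δ ∧ U ⊆ e.target := by
  obtain ⟨-, δ, hδ, hnormal⟩ := hU
  obtain ⟨hradius, hsub⟩ := hnormal p hp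
  obtain ⟨e, he, hexp, hlift⟩ := hradius.exists_isNormalChart
  refine ⟨δ, e, ⟨he, hδ, hexp, hlift⟩, hsub.trans ?_⟩
  rw [← he.source, ← image_congr (he.source ▸ hexp)]
  exact e.mapsTo.image_subset

lemma IsUnitGeodesic.norm_eq_one_of_lift_eq {σ : ℝ → M} {ℓ t : ℝ} {q r : M}
    {v : TangentSpace (𝓡 2) r} (hσ : IsUnitGeodesic σ ℓ p q) (ht : t ∈ Icc 0 ℓ)
    (hv : lift σ t = ⟨r, v⟩) : ‖v‖ = 1 :=
  (congrArg (fun z : TangentBundle (𝓡 2) M => ‖z.2‖) hv).symm.trans (hσ.unit_speed t ht)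

namespace IsExpChart

variable {e : OpenPartialHomeomorph (TangentSpace (𝓡 2) p) M} {δ : ℝ} (he : IsExpChart e δ)
include he

lemma zero_mem_ball : (0 : TangentSpace (𝓡 2) p) ∈ Metric.ball 0 δ :=
  Metric.mem_ball_self he.radius_pos

lemma map_zero : e 0 = p := by
  have h := congrArg (·.1) (he.lift_ray_zero 0 he.zero_mem_ball)
  simpa [lift] using h

lemma symm_center : e.symm p = 0 := by
  have h := e.left_inv (he.source ▸ he.zero_mem_ball)
  rwa [he.map_zero] at h

lemma symm_ne_zero {q : M} (hq : q ∈ e.target) (hne : p ≠ q) : e.symm q ≠ 0 := fun h =>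
  hne (by rw [← he.map_zero, ← h, e.right_inv hq])

lemma mk_pushforward_zero (a : TangentSpace (𝓡 2) p) :
    (⟨e 0, pushforward e 0 a⟩ : TangentBundle (𝓡 2) M) = ⟨p, a⟩ := by
  obtain ⟨c, hc, hca⟩ := exists_gt_smul_mem_ball (t := 0) (u := a) (by simpa using he.radius_pos)
  have hz : (0 : ℝ) • c • a = 0 := zero_smul ℝ _
  have hlift := (he.lift_ray (hz ▸ he.zero_mem_ball)).symm.trans (he.lift_ray_zero _ hca)
  rw [hz] at hlift
  have h := tangentBundle_smul_congr hlift c⁻¹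
  rwa [map_smul, inv_smul_smul₀ hc.ne', inv_smul_smul₀ hc.ne'] at h

lemma mem_target : p ∈ e.target := by
  rw [← he.map_zero]
  exact e.map_source (he.source ▸ he.zero_mem_ball)

variable [IsManifold (𝓡 2) ∞ M]
  [IsContMDiffRiemannianBundle (𝓡 2) ∞ Plane (fun x : M => TangentSpace (𝓡 2) x)]

lemma eqOn_ray {σ : ℝ → M} {T : ℝ} {v : TangentSpace (𝓡 2) p} (hσ : IsGeodesicOn σ (Icc 0 T))
    (hv : lift σ 0 = ⟨p, v⟩) (hT : T • v ∈ Metric.ball 0 δ) :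
    ∀ t ∈ Icc 0 T, σ t = e (t • v) := fun t ht => by
  rw [he.eqOn_expMap (smul_mem_ball_of_mem_Icc hT ht), expMap_smul hσ hv ht]

lemma eqOn_ray_reverse {σ : ℝ → M} {T : ℝ} {v : TangentSpace (𝓡 2) p}
    (hσ : IsGeodesicOn σ (Icc 0 T)) (hv : lift σ T = ⟨p, v⟩) (hT0 : 0 ≤ T)
    (hT : T • -v ∈ Metric.ball 0 δ) : ∀ t ∈ Icc 0 T, σ (T - t) = e (t • -v) := by
  have hgeo : IsGeodesicOn (fun τ => σ (-1 * τ + T)) (Icc 0 T) :=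
    hσ.affine (-1) T fun t ht => ⟨by linarith [ht.2], by linarith [ht.1]⟩
  have hstart : -1 * 0 + T = T := by ring
  have hlift : lift (fun τ => σ (-1 * τ + T)) 0 = ⟨p, -v⟩ := by
    have haffine : HasDerivAt (fun τ => -1 * τ + T) (-1) 0 :=
      (((hasDerivAt_id' (0 : ℝ)).const_mul (-1)).add_const T).congr_deriv (mul_one _)
    rw [← neg_one_smul ℝ v]
    exact lift_comp (φ := fun τ => -1 * τ + T)
      (hσ.mdifferentiableAt (by rwa [hstart, right_mem_Icc])) haffine (by rwa [hstart])
  intro t ht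
  rw [← he.eqOn_ray hgeo hlift hT t ht, neg_one_mul, neg_add_eq_sub]

variable [IsRiemannianManifold (𝓡 2) M]

lemma dist_eq_norm_symm {q : M} (hq : q ∈ e.target) : dist p q = ‖e.symm q‖ := by
  have := finiteDimensional_tangentSpace p
  rw [← he.dist_eq (he.symm_mem_ball hq), he.map_zero, e.right_inv hq]

lemma dist_lt {q : M} (hq : q ∈ e.target) : dist p q < δ := by
  rw [he.dist_eq_norm_symm hq]
  exact mem_ball_zero_iff.1 (he.symm_mem_ball hq)

lemma eqOn_chord {q : M} {σ : ℝ → M} (hσ : IsUnitGeodesic σ (dist p q) p q) (hq : q ∈ e.target)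
    (hne : p ≠ q) {u : TangentSpace (𝓡 2) p} (hu : e.symm q = ‖e.symm q‖ • u) :
    ∀ t ∈ Icc 0 (dist p q), σ t = e (t • u) := by
  obtain ⟨v, hlift⟩ := exists_lift_eq hσ.source
  have hv := hσ.norm_eq_one_of_lift_eq (left_mem_Icc.2 dist_nonneg) hlift
  have hmem : dist p q • v ∈ Metric.ball (0 : TangentSpace (𝓡 2) p) δ := by
    rw [mem_ball_zero_iff, norm_smul, hv, mul_one, Real.norm_of_nonneg dist_nonneg]
    exact he.dist_lt hq
  have hray := he.eqOn_ray hσ.geodesic hlift hmem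
  have hend : dist p q • v = dist p q • u := by
    rw [he.dist_eq_norm_symm hq, ← hu, ← he.dist_eq_norm_symm hq,
      ← e.left_inv (x := dist p q • v) (he.source ▸ hmem),
      ← hray _ (right_mem_Icc.2 dist_nonneg), hσ.target]
  rwa [smul_right_injective _ (dist_pos.2 hne).ne' hend] at hray

end IsExpChart

namespace IsExpChart

variable [IsManifold (𝓡 2) ∞ M]
  [IsContMDiffRiemannianBundle (𝓡 2) ∞ Plane (fun x : M => TangentSpace (𝓡 2) x)]
  [IsRiemannianManifold (𝓡 2) M] {γ : ℝ → M} {s₀ s : ℝ}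
  {e : OpenPartialHomeomorph (TangentSpace (𝓡 2) (γ s₀)) M} {δ : ℝ} (he : IsExpChart e δ)
include he

lemma genFun_eventuallyEq (hγ : ContinuousAt γ s) (hγe : γ s ∈ e.target) :
    genFun γ s₀ =ᶠ[𝓝 s] fun τ => ‖e.symm (γ τ)‖ :=
  (hγ.eventually_mem (e.open_target.mem_nhds hγe)).mono fun _ hτ => he.dist_eq_norm_symm hτ

lemma contDiffAt_genFun {n : WithTop ℕ∞} (hn : n ≤ ∞) (hγ : ContMDiffAt 𝓘(ℝ, ℝ) (𝓡 2) n γ s)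
    (hγe : γ s ∈ e.target) (hne : γ s₀ ≠ γ s) : ContDiffAt ℝ n (genFun γ s₀) s :=
  ((he.contDiffAt_symm_comp hn hγ hγe).norm ℝ (he.symm_ne_zero hγe hne)).congr_of_eventuallyEq
    (he.genFun_eventuallyEq hγ.continuousAt hγe)

variable (b : OrthonormalBasis (Fin 2) ℝ (TangentSpace (𝓡 2) (γ s₀)))

lemma eq_polar_genFun_iff (hγe : γ s ∈ e.target) (θ : ℝ) :
    γ s = polar (γ s₀) b (genFun γ s₀ s) θ ↔ e.symm (γ s) = ‖e.symm (γ s)‖ • unitVec b θ := by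
  have hmem : genFun γ s₀ s • unitVec b θ ∈ Metric.ball 0 δ :=
    (smul_unitVec_mem_ball b dist_nonneg).2 (he.dist_lt hγe)
  have hpolar : polar (γ s₀) b (genFun γ s₀ s) θ = e (genFun γ s₀ s • unitVec b θ) :=
    (he.eqOn_expMap hmem).symm
  rw [hpolar, ← he.dist_eq_norm_symm hγe, eq_comm]
  exact (e.eq_symm_apply (he.source ▸ hmem) hγe).symm.trans eq_comm

variable {θ : ℝ → ℝ}

lemma isPolarAngle_iff (hγ : ContinuousAt γ s) (hγe : γ s ∈ e.target) :
    IsPolarAngle γ s₀ s b θ ↔ ContinuousAt θ s ∧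
      ∀ᶠ τ in 𝓝 s, e.symm (γ τ) = ‖e.symm (γ τ)‖ • unitVec b (θ τ) :=
  and_congr_right fun _ => eventually_congr <|
    (hγ.eventually_mem (e.open_target.mem_nhds hγe)).mono fun τ hτ =>
      he.eq_polar_genFun_iff b hτ (θ τ)

lemma exists_isPolarAngle (hγ : ContMDiffAt 𝓘(ℝ, ℝ) (𝓡 2) 1 γ s) (hγe : γ s ∈ e.target)
    (hne : γ s₀ ≠ γ s) : ∃ θ, IsPolarAngle γ s₀ s b θ := by
  obtain ⟨θ, hθ, hu⟩ := exists_continuousAt_angle b (he.contDiffAt_symm_comp (by simp) hγ hγe)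
    (he.symm_ne_zero hγe hne)
  exact ⟨θ, (he.isPolarAngle_iff b hγ.continuousAt hγe).2 ⟨hθ, Eventually.of_forall hu⟩⟩

variable {b}

lemma contDiffAt_of_isPolarAngle {n : WithTop ℕ∞} (hn : n ≤ ∞)
    (hγ : ContMDiffAt 𝓘(ℝ, ℝ) (𝓡 2) n γ s) (hγe : γ s ∈ e.target) (hne : γ s₀ ≠ γ s)
    (hθ : IsPolarAngle γ s₀ s b θ) : ContDiffAt ℝ n θ s := by
  obtain ⟨hθc, hθγ⟩ := (he.isPolarAngle_iff b hγ.continuousAt hγe).1 hθ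
  have hu := he.contDiffAt_symm_comp hn hγ hγe
  have hu0 := he.symm_ne_zero hγe hne
  exact (contDiffAt_angle b hu hθγ.self_of_nhds hu0).congr_of_eventuallyEq
    (eventuallyEq_angle b hθc (hu.continuousAt.eventually_ne hu0) hθγ)

variable {σ : ℝ → M}

lemma iteratedDeriv_genFun (hγ : ContMDiffAt 𝓘(ℝ, ℝ) (𝓡 2) 2 γ s) (hγe : γ s ∈ e.target)
    (hne : γ s₀ ≠ γ s) (hκ : geodesicCurvature γ s = 0)
    (hσ : IsUnitGeodesic σ (genFun γ s₀ s) (γ s₀) (γ s)) {J J' : ℝ → ℝ}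
    (hJ : IsJacobiField σ (genFun γ s₀ s) J J') (hθ : IsPolarAngle γ s₀ s b θ) :
    iteratedDeriv 2 (genFun γ s₀) s =
      deriv θ s ^ 2 * (J (genFun γ s₀ s) * J' (genFun γ s₀ s)) := by
  obtain ⟨-, hθγ⟩ := (he.isPolarAngle_iff b hγ.continuousAt hγe).1 hθ
  rw [iteratedDeriv_succ, iteratedDeriv_one,
    (he.genFun_eventuallyEq hγ.continuousAt hγe).deriv.deriv_eq]
  exact he.deriv_deriv_norm b hγ hγe hκ (he.dist_eq_norm_symm hγe).symm (dist_pos.2 hne)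
    (he.contDiffAt_of_isPolarAngle ENat.LEInfty.out hγ hγe hne hθ) hθγ
    (he.eqOn_chord hσ hγe hne hθγ.self_of_nhds) hJ

lemma deriv_ne_zero_of_isPolarAngle (hγ : ContMDiffAt 𝓘(ℝ, ℝ) (𝓡 2) 1 γ s)
    (hunit : ‖velocity γ s‖ = 1) (hγe : γ s ∈ e.target) (hne : γ s₀ ≠ γ s)
    (hσ : IsUnitGeodesic σ (genFun γ s₀ s) (γ s₀) (γ s))
    (htan : ¬ AreTangent σ (genFun γ s₀ s) γ s) (hθ : IsPolarAngle γ s₀ s b θ) :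
    deriv θ s ≠ 0 := fun hθ0 => by
  obtain ⟨-, hθγ⟩ := (he.isPolarAngle_iff b hγ.continuousAt hγe).1 hθ
  exact htan (he.areTangent_of_deriv_angle_eq_zero b hγ hγe hunit
    (he.dist_eq_norm_symm hγe).symm (dist_pos.2 hne)
    ((he.contDiffAt_of_isPolarAngle (by simp) hγ hγe hne hθ).differentiableAt one_ne_zero) hθ0 hθγ
    (hσ.geodesic.mdifferentiableAt ⟨dist_nonneg, le_rfl⟩)
    (he.eqOn_chord hσ hγe hne hθγ.self_of_nhds))

lemma sign_iteratedDeriv_genFun (hγ : ContMDiffAt 𝓘(ℝ, ℝ) (𝓡 2) 2 γ s)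
    (hunit : ‖velocity γ s‖ = 1) (hγe : γ s ∈ e.target) (hne : γ s₀ ≠ γ s)
    (hκ : geodesicCurvature γ s = 0) (hσ : IsUnitGeodesic σ (genFun γ s₀ s) (γ s₀) (γ s))
    {J J' : ℝ → ℝ} (hJ : IsJacobiField σ (genFun γ s₀ s) J J')
    (htan : ¬ AreTangent σ (genFun γ s₀ s) γ s) :
    SignType.sign (iteratedDeriv 2 (genFun γ s₀) s) =
      SignType.sign (J (genFun γ s₀ s) * J' (genFun γ s₀ s)) := by
  have hγ₁ : ContMDiffAt 𝓘(ℝ, ℝ) (𝓡 2) 1 γ s := hγ.of_le one_le_two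
  have := finiteDimensional_tangentSpace (γ s₀)
  have hrank : Module.finrank ℝ (TangentSpace (𝓡 2) (γ s₀)) = 2 := finrank_euclideanSpace_fin
  let b := (stdOrthonormalBasis ℝ (TangentSpace (𝓡 2) (γ s₀))).reindex (finCongr hrank)
  obtain ⟨θ, hθ⟩ := he.exists_isPolarAngle b hγ₁ hγe hne
  have hθ0 := he.deriv_ne_zero_of_isPolarAngle hγ₁ hunit hγe hne hσ htan hθ
  rw [he.iteratedDeriv_genFun hγ hγe hne hκ hσ hJ hθ, sign_mul, sign_pos (by positivity), one_mul]

end IsExpChart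

end ExpChart

/-! ### Strictly convex regions -/

section Convex

variable {M : Type*} [MetricSpace M] [ChartedSpace Plane M]
  [RiemannianBundle (fun x : M => TangentSpace (𝓡 2) x)] {D : Set M}

/-- Strict geodesic convexity, as in the definition of `IsConvexCurve`: the open minimizing geodesic
segments between distinct points of `D` lie in the interior of `D`. -/
def IsStrictlyGeodesicallyConvex (D : Set M) : Prop :=
  ∀ p ∈ D, ∀ q ∈ D, p ≠ q → ∀ σ : ℝ → M, IsUnitGeodesic σ (dist p q) p q →
    ∀ t ∈ Ioo 0 (dist p q), σ t ∈ interior D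

namespace IsNormalChart

variable {V : Type*} [NormedAddCommGroup V] [InnerProductSpace ℝ V]
  [IsManifold (𝓡 2) ∞ M]
  [IsContMDiffRiemannianBundle (𝓡 2) ∞ Plane (fun x : M => TangentSpace (𝓡 2) x)]
  {e : OpenPartialHomeomorph V M} {δ : ℝ} (he : IsNormalChart e δ) {w : V}
include he

lemma isUnitGeodesic_ray (hw : w ∈ Metric.ball (0 : V) δ) (hw0 : w ≠ 0) :
    IsUnitGeodesic (fun t : ℝ => e (t • ‖w‖⁻¹ • w)) ‖w‖ (e 0) (e w) := by
  have hT : ‖w‖ • ‖w‖⁻¹ • w = w := smul_inv_smul₀ (norm_ne_zero_iff.2 hw0) w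
  have hmem : ∀ t ∈ Icc 0 ‖w‖, t • ‖w‖⁻¹ • w ∈ Metric.ball (0 : V) δ := fun t ht =>
    smul_mem_ball_of_mem_Icc (by rwa [hT]) ht
  refine ⟨(he.geodesic_ray _).mono fun t ht => ⟨ht.1, hmem t ht⟩, fun t ht => ?_, ?_, ?_⟩
  · rw [he.norm_velocity_ray ht.1 (hmem t ht)]
    exact norm_smul_inv_norm (𝕜 := ℝ) hw0
  · rw [zero_smul]
  · rw [hT]

variable [FiniteDimensional ℝ V] [IsRiemannianManifold (𝓡 2) M]

lemma smul_mem_interior (hD : IsStrictlyGeodesicallyConvex D) (h0 : e 0 ∈ D)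
    (hw : w ∈ Metric.ball (0 : V) δ) (hw0 : w ≠ 0) (hwD : e w ∈ D) {c : ℝ} (hc : c ∈ Ioo 0 1) :
    e (c • w) ∈ interior D := by
  have hn : 0 < ‖w‖ := norm_pos_iff.2 hw0
  have hdist := he.dist_eq hw
  have hne : e 0 ≠ e w := dist_pos.1 (hn.trans_eq hdist.symm)
  have h := hD _ h0 _ hwD hne _ (by rw [hdist]; exact he.isUnitGeodesic_ray hw hw0) (c * ‖w‖)
    (by rw [hdist]; exact ⟨mul_pos hc.1 hn, mul_lt_of_lt_one_left hn hc.2⟩)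
  rwa [mul_smul, smul_inv_smul₀ hn.ne'] at h

/-- The chords from `e 0` to points near `e w` sweep out a cone of directions around `w`, and the
curve `u` enters it. -/
lemma eventually_mem_interior (hD : IsStrictlyGeodesicallyConvex D) (h0 : e 0 ∈ D)
    (hw : w ∈ Metric.ball (0 : V) δ) (hw0 : w ≠ 0) (hwD : e w ∈ interior D) {u : ℝ → V}
    (hu0 : u 0 = 0) (hu : HasDerivAt u w 0) : ∀ᶠ t in 𝓝[>] (0 : ℝ), e (u t) ∈ interior D := by
  have hslope : Tendsto (fun t : ℝ => t⁻¹ • u t) (𝓝[>] 0) (𝓝 w) := by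
    simpa only [zero_add, hu0, sub_zero] using hu.tendsto_slope_zero_right
  have hball := hslope.eventually (Metric.isOpen_ball.eventually_mem hw)
  have hDint := hslope.eventually
    ((he.contMDiffAt hw).continuousAt.eventually_mem (isOpen_interior.mem_nhds hwD))
  filter_upwards [hball, hslope.eventually_ne hw0, hDint, Ioo_mem_nhdsGT one_pos]
    with t htb ht0 htD ht
  simpa only [smul_inv_smul₀ ht.1.ne'] using
    he.smul_mem_interior hD h0 htb ht0 (interior_subset htD) ht

end IsNormalChart

variable [IsManifold (𝓡 2) ∞ M] {p : M} {γ : ℝ → M} {s : ℝ}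

namespace IsExpChart

variable {e : OpenPartialHomeomorph (TangentSpace (𝓡 2) (γ s)) M} {δ : ℝ} (he : IsExpChart e δ)
include he

lemma hasDerivAt_symm_comp (hγ : ContMDiffAt 𝓘(ℝ, ℝ) (𝓡 2) 1 γ s) :
    HasDerivAt (e.symm ∘ γ) (velocity γ s) s := by
  have hlift := he.lift_eq_pushforward hγ he.mem_target
  rw [he.symm_center, he.mk_pushforward_zero] at hlift
  rw [TotalSpace.mk_injective (γ s) hlift]
  exact ((he.contDiffAt_symm_comp (by simp) hγ he.mem_target).differentiableAt
    one_ne_zero).hasDerivAt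

variable [IsContMDiffRiemannianBundle (𝓡 2) ∞ Plane (fun x : M => TangentSpace (𝓡 2) x)]
  [IsRiemannianManifold (𝓡 2) M]

lemma exists_mem_interior (hγ : ContMDiffAt 𝓘(ℝ, ℝ) (𝓡 2) 1 γ s)
    (hD : IsStrictlyGeodesicallyConvex D) (hs : γ s ∈ D) {c : ℝ}
    (hball : c • velocity γ s ∈ Metric.ball 0 δ) (h0 : c • velocity γ s ≠ 0)
    (hDint : e (c • velocity γ s) ∈ interior D) : ∃ τ, γ τ ∈ interior D := by
  have := finiteDimensional_tangentSpace (γ s)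
  have hshift : HasDerivAt (fun t : ℝ => s + t * c) c 0 := by
    simpa only [one_mul] using ((hasDerivAt_id' (0 : ℝ)).mul_const c).const_add s
  have hstart : s + 0 * c = s := by ring
  have hu : HasDerivAt (fun t : ℝ => e.symm (γ (s + t * c))) (c • velocity γ s) 0 :=
    HasDerivAt.scomp (g₁ := e.symm ∘ γ) (h := fun t : ℝ => s + t * c) 0
      (by rw [hstart]; exact he.hasDerivAt_symm_comp hγ) hshift
  have hev := he.eventually_mem_interior hD (he.map_zero.symm ▸ hs) hball h0 hDint
    (by rw [hstart, he.symm_center]) hu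
  have htarget : ∀ᶠ t in 𝓝[>] (0 : ℝ), γ (s + t * c) ∈ e.target :=
    nhdsWithin_le_nhds <| (ContinuousAt.comp (f := fun t : ℝ => s + t * c)
      (by rw [hstart]; exact hγ.continuousAt) hshift.continuousAt).eventually_mem
        (by rw [Function.comp_apply, hstart]; exact e.open_target.mem_nhds he.mem_target)
  obtain ⟨t, ht, hte⟩ := (hev.and htarget).exists
  exact ⟨_, e.right_inv hte ▸ ht⟩

/-- If the chord from `p` were tangent to `γ` at `γ s`, its points would be reached from `γ s` in a
direction `±γ'(s)`, so `γ` would enter the interior of `D`. -/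
lemma not_areTangent (hγ : ContMDiffAt 𝓘(ℝ, ℝ) (𝓡 2) 1 γ s) (hD : IsStrictlyGeodesicallyConvex D)
    (hDc : IsClosed D) (hDγ : frontier D = range γ) (hp : p ∈ D) (hpe : p ∈ e.target)
    (hne : p ≠ γ s) {σ : ℝ → M} (hσ : IsUnitGeodesic σ (dist p (γ s)) p (γ s)) :
    ¬ AreTangent σ (dist p (γ s)) γ s := fun htan => by
  have hfrontier (τ : ℝ) : γ τ ∉ interior D := (hDγ ▸ mem_range_self τ : γ τ ∈ frontier D).2
  have hs : γ s ∈ D := hDc.frontier_subset (hDγ ▸ mem_range_self s)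
  have hℓ0 : 0 < dist p (γ s) := dist_pos.2 hne
  set ℓ := dist p (γ s)
  obtain ⟨ε, -, hlift⟩ := areTangent_iff.1 htan
  have hnorm : ‖-(ε • velocity γ s)‖ = 1 := by
    rw [norm_neg, hσ.norm_eq_one_of_lift_eq (right_mem_Icc.2 hℓ0.le) hlift]
  have hball : ℓ • -(ε • velocity γ s) ∈ Metric.ball (0 : TangentSpace (𝓡 2) (γ s)) δ := by
    rw [mem_ball_zero_iff, norm_smul, hnorm, mul_one, Real.norm_of_nonneg hℓ0.le]
    exact (dist_comm p (γ s)).trans_lt (he.dist_lt hpe)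
  have hhalf : ℓ / 2 ∈ Ioo 0 ℓ := ⟨half_pos hℓ0, half_lt_self hℓ0⟩
  have hmid : e ((ℓ / 2) • -(ε • velocity γ s)) ∈ interior D := by
    rw [← he.eqOn_ray_reverse hσ.geodesic hlift hℓ0.le hball _ (Ioo_subset_Icc_self hhalf),
      sub_half]
    exact hD p hp _ hs hne σ hσ _ hhalf
  have hdir : (ℓ / 2) • -(ε • velocity γ s) = (-(ℓ / 2 * ε)) • velocity γ s := by
    rw [smul_neg, smul_smul, neg_smul]
  have hmid_ball := smul_mem_ball_of_mem_Icc hball (Ioo_subset_Icc_self hhalf)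
  rw [hdir] at hmid hmid_ball
  have hmid0 : (-(ℓ / 2 * ε)) • velocity γ s ≠ 0 := fun h => by
    rw [h, he.map_zero] at hmid
    exact hfrontier s hmid
  obtain ⟨τ, hτ⟩ := he.exists_mem_interior hγ hD hs hmid_ball hmid0 hmid
  exact hfrontier τ hτ

end IsExpChart

variable [IsContMDiffRiemannianBundle (𝓡 2) ∞ Plane (fun x : M => TangentSpace (𝓡 2) x)]
  [IsRiemannianManifold (𝓡 2) M]

lemma IsConvexCurve.not_areTangent {U : Set M} {L : ℝ} (hL : IsConvexCurve U γ L)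
    (hU : IsTotallyNormal U) (hγ : ContMDiffAt 𝓘(ℝ, ℝ) (𝓡 2) 1 γ s) (hγU : ∀ τ, γ τ ∈ U) {s₀ : ℝ}
    (hne : γ s₀ ≠ γ s) {σ : ℝ → M} (hσ : IsUnitGeodesic σ (genFun γ s₀ s) (γ s₀) (γ s)) :
    ¬ AreTangent σ (genFun γ s₀ s) γ s := by
  obtain ⟨D, hDc, -, hDγ, hD⟩ := hL.convex
  obtain ⟨δ, e, he, hUe⟩ := hU.exists_isExpChart (hγU s)
  exact he.not_areTangent hγ hD hDc.isClosed hDγ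
    (hDc.isClosed.frontier_subset (hDγ ▸ mem_range_self s₀)) (hUe (hγU s₀)) hne hσ

end Convex

end SurfaceBilliard

end

theorem mainTheorem3 {M : Type*} [MetricSpace M] [ChartedSpace SurfaceBilliard.Plane M]
    [IsManifold (𝓡 2) ∞ M]
    [RiemannianBundle (fun x : M => TangentSpace (𝓡 2) x)]
    [IsContMDiffRiemannianBundle (𝓡 2) ∞ SurfaceBilliard.Plane
      (fun x : M => TangentSpace (𝓡 2) x)]
    [IsRiemannianManifold (𝓡 2) M]
    (U : Set M) (hU : SurfaceBilliard.IsTotallyNormal U)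
    (γ : ℝ → M) (hγ : ContMDiff 𝓘(ℝ, ℝ) (𝓡 2) 2 γ)
    (hunit : ∀ s, ‖SurfaceBilliard.velocity γ s‖ = 1) (hγU : ∀ s, γ s ∈ U)
    (s₀ s₁ : ℝ) (hne : γ s₀ ≠ γ s₁)
    (hκ : SurfaceBilliard.geodesicCurvature γ s₁ = 0)
    (σ : ℝ → M)
    (hσ : SurfaceBilliard.IsUnitGeodesic σ (SurfaceBilliard.genFun γ s₀ s₁) (γ s₀) (γ s₁))
    (J J' : ℝ → ℝ)
    (hJ : SurfaceBilliard.IsJacobiField σ (SurfaceBilliard.genFun γ s₀ s₁) J J')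
    (b : OrthonormalBasis (Fin 2) ℝ (TangentSpace (𝓡 2) (γ s₀))) :
    ContDiffAt ℝ 2 (SurfaceBilliard.genFun γ s₀) s₁ ∧
    (∃ θ : ℝ → ℝ, SurfaceBilliard.IsPolarAngle γ s₀ s₁ b θ) ∧
    (∀ θ : ℝ → ℝ, SurfaceBilliard.IsPolarAngle γ s₀ s₁ b θ →
      ContDiffAt ℝ 2 θ s₁ ∧
      iteratedDeriv 2 (SurfaceBilliard.genFun γ s₀) s₁ =
        deriv θ s₁ ^ 2 *
          (J (SurfaceBilliard.genFun γ s₀ s₁) * J' (SurfaceBilliard.genFun γ s₀ s₁))) ∧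
    (¬ SurfaceBilliard.AreTangent σ (SurfaceBilliard.genFun γ s₀ s₁) γ s₁ →
      SignType.sign (iteratedDeriv 2 (SurfaceBilliard.genFun γ s₀) s₁) =
        SignType.sign
          (J (SurfaceBilliard.genFun γ s₀ s₁) * J' (SurfaceBilliard.genFun γ s₀ s₁))) ∧
    (∀ L : ℝ, SurfaceBilliard.IsConvexCurve U γ L →
      SignType.sign (iteratedDeriv 2 (SurfaceBilliard.genFun γ s₀) s₁) =
        SignType.sign
          (J (SurfaceBilliard.genFun γ s₀ s₁) * J' (SurfaceBilliard.genFun γ s₀ s₁))) := by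
  obtain ⟨δ, e, he, hUe⟩ := hU.exists_isExpChart (hγU s₀)
  have hγe : γ s₁ ∈ e.target := hUe (hγU s₁)
  have hγ₁ : ContMDiffAt 𝓘(ℝ, ℝ) (𝓡 2) 2 γ s₁ := hγ.contMDiffAt
  have hsign := he.sign_iteratedDeriv_genFun hγ₁ (hunit s₁) hγe hne hκ hσ hJ
  refine ⟨he.contDiffAt_genFun ENat.LEInfty.out hγ₁ hγe hne,
    he.exists_isPolarAngle b (hγ₁.of_le one_le_two) hγe hne, fun θ hθ => ⟨?_, ?_⟩, hsign,
    fun L hL => hsign (hL.not_areTangent hU (hγ₁.of_le one_le_two) hγU hne hσ)⟩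
  · exact he.contDiffAt_of_isPolarAngle ENat.LEInfty.out hγ₁ hγe hne hθ
  · exact he.iteratedDeriv_genFun hγ₁ hγe hne hκ hσ hJ hθ
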